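/- Let $p$ be a prime, $k\ge 1$, $E=\mathbb{Q}(\mu_{p^k})$, and let $\zeta\in E$ be a primitive $p^k$-th root of unity. Let $\mu_\infty$ be the torsion subgroup of $\mathbb{C}^*$ and $\mu_n\subseteq\mu_\infty$ its subgroup of $n$-th roots of unity. For a group $G$, a $G$-grading of $E$ is a family $(R_g)_{g\in G}$ of $\mathbb{Q}$-subspaces of $E$ with $E=\bigoplus_{g\in G} R_g$, $1\in R_1$ and $R_gR_h\subseteq R_{gh}$ for all $g,h\in G$. For a homomorphism $\varphi:G\to H$ let $\varphi_*(R_g)_{g\in G}$ be the $H$-indexed family with $h$-th component $\sum_{g\in\varphi^{-1}(h)}R_g$. If $p=2$ and $k\ge 4$, let $\zeta_8\in E$ be a primitive $8$-th root of unity. Then the $\mu_\infty$-gradings of $E$ are precisely the following. (a) $\varphi_*(\zeta^n\mathbb{Q}(\mu_p))_{n\in\mathbb{Z}/p^{k-1}\mathbb{Z}}$ for the $p^{k-1}$ homomorphisms $\varphi:\mathbb{Z}/p^{k-1}\mathbb{Z}\to\mu_\infty$. (b) With $\alpha=\zeta+\zeta^{-1}$ and $\beta=\zeta-\zeta^{-1}$: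 if $p\ne 2$ or $k\ge 3$, the push-forward along $\mu_2\subseteq\mu_\infty$ of $R_1=\mathbb{Q}(\alpha)$, $R_{-1}=\beta\,\mathbb{Q}(\alpha)$; and, if $p=2$ and $k\ge3$, also that of $I_1=\mathbb{Q}(\beta)$, $I_{-1}=\alpha\,\mathbb{Q}(\beta)$. (c) If $p=2$ and $k\ge 4$: $\varphi_*(\alpha^n\mathbb{Q})_{n\in\mathbb{Z}/2^{k-1}\mathbb{Z}}$ with $\alpha=\zeta\,(\zeta_8+\zeta_8^{-1})$, for the $2^{k-2}$ injective homomorphisms $\varphi:\mathbb{Z}/2^{k-1}\mathbb{Z}\to\mu_\infty$. (d) If $p=2$ and $k\ge 4$: $\varphi_*(\beta^n\mathbb{Q}(\alpha))_{n\in\mathbb{Z}/4\mathbb{Z}}$ with $\alpha=\zeta^2+\zeta^{-2}$ and $\beta=\zeta_8(\zeta+\zeta^{-1})$, for the two injective homomorphisms $\varphi:\mathbb{Z}/4\mathbb{Z}\to\mu_\infty$. All gradings in this list are distinct. Hence, for odd $p$, $E$ has exactly $p^{k-1}+1$ gradings by $\mu_\infty$, and exactly $p^{k-1}$ gradings by $\mu_{p^k}$.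 For $p=2$, the number of $\mu_\infty$-gradings equals the number of $\mu_{2^k}$-gradings, and it is $1$ if $k=1$, $2$ if $k=2$, $6$ if $k=3$, and $4+2^{k-2}+2^{k-1}$ if $k\ge 4$. -/

import Mathlib

namespace CyclotomicGradings

/-- The group `μ_∞` of all complex roots of unity. -/
abbrev muInf : Subgroup ℂˣ := CommGroup.torsion ℂˣ

/-- The group `μ_n` of complex `n`-th roots of unity. -/
abbrev mu (n : ℕ) : Subgroup ℂˣ := rootsOfUnity n ℂ

theorem mu_le_muInf (n : ℕ) (hn : n ≠ 0) : mu n ≤ muInf := by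
  intro x hx
  exact isOfFinOrder_iff_pow_eq_one.2 ⟨n, Nat.pos_of_ne_zero hn, (mem_rootsOfUnity n x).1 hx⟩

section General

variable {G H E : Type*} [Group G] [Field E] [Algebra ℚ E]

open Classical in
/-- The family `(R g)_{g ∈ G}` of `ℚ`-subspaces is a `G`-grading of the `ℚ`-algebra `E`. -/
structure IsGrading (R : G → Submodule ℚ E) : Prop where
  isInternal : DirectSum.IsInternal R
  one_mem : (1 : E) ∈ R 1
  mul_mem : ∀ (g h : G) (x y : E), x ∈ R g → y ∈ R h → x * y ∈ R (g * h)

variable (G E) in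
/-- The set of all `G`-gradings of `E`. -/
def gradings : Set (G → Submodule ℚ E) := {R | IsGrading R}

/-- The push-forward `f_* R` of a family of subspaces along a map of index sets: its component at
`h` is the sum of all `R g` with `f g = h`. -/
def pushforward (f : G → H) (R : G → Submodule ℚ E) : H → Submodule ℚ E :=
  fun h => ⨆ (g : G) (_ : f g = h), R g

/-- The subspace `a · K`, for an element `a` and a subfield `K` of `E`. -/
def mulSubfield (a : E) (K : IntermediateField ℚ E) : Submodule ℚ E :=
  (Subalgebra.toSubmodule K.toSubalgebra).map (LinearMap.mulLeft ℚ a)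

/-- The family `(a ^ n · K)_n` indexed by the cyclic group `ℤ/mℤ` (written multiplicatively),
where `n` runs through the representatives `0, …, m - 1`. It is used only when `a ^ m ∈ K`, so
that the choice of representatives is immaterial. -/
def powerFamily (m : ℕ) (a : E) (K : IntermediateField ℚ E) :
    Multiplicative (ZMod m) → Submodule ℚ E :=
  fun n => mulSubfield (a ^ (Multiplicative.toAdd n).val) K

open Classical in
/-- The family indexed by `μ_2 = {1, -1}` with `K` at `1` and `b · K` at `-1`. -/
noncomputable def signFamily (K : IntermediateField ℚ E) (b : E) : mu 2 → Submodule ℚ E :=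
  fun s => if s = 1 then Subalgebra.toSubmodule K.toSubalgebra else mulSubfield b K

end General

section Lists

variable {E : Type*} [Field E] [Algebra ℚ E]

/-- The `μ_∞`-gradings obtained from `C_n = ζ^n · ℚ(μ_p)`, `n ∈ ℤ/p^(k-1)ℤ`, along all
homomorphisms `ℤ/p^(k-1)ℤ → μ_∞`. -/
def listA (p k : ℕ) (ζ : E) : Set (muInf → Submodule ℚ E) :=
  {R | ∃ φ : Multiplicative (ZMod (p ^ (k - 1))) →* muInf,
    R = pushforward φ
      (powerFamily (p ^ (k - 1)) ζ (IntermediateField.adjoin ℚ {x : E | x ^ p = 1}))}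

/-- The `μ_∞`-gradings obtained along the inclusion `μ_2 ⊆ μ_∞` from the decomposition of `E` into
`ℚ(α)` and `β · ℚ(α)` (if `p ≠ 2` or `k ≥ 3`), and from the decomposition into `ℚ(β)` and
`α · ℚ(β)` (if `p = 2` and `k ≥ 3`), where `α = ζ + ζ⁻¹` and `β = ζ - ζ⁻¹`. -/
def listB (p k : ℕ) (ζ : E) : Set (muInf → Submodule ℚ E) :=
  {R | ((p ≠ 2 ∨ 3 ≤ k) ∧
      R = pushforward (Subgroup.inclusion (mu_le_muInf 2 two_ne_zero))
        (signFamily (IntermediateField.adjoin ℚ {ζ + ζ⁻¹}) (ζ - ζ⁻¹))) ∨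
    ((p = 2 ∧ 3 ≤ k) ∧
      R = pushforward (Subgroup.inclusion (mu_le_muInf 2 two_ne_zero))
        (signFamily (IntermediateField.adjoin ℚ {ζ - ζ⁻¹}) (ζ + ζ⁻¹)))}

/-- For `p = 2` and `k ≥ 4`: the `μ_∞`-gradings obtained from `S_n = α^n · ℚ`,
`n ∈ ℤ/2^(k-1)ℤ`, with `α = ζ √2` and `√2 = ζ₈ + ζ₈⁻¹`, along all injective homomorphisms
`ℤ/2^(k-1)ℤ → μ_∞`. -/
def listC (p k : ℕ) (ζ ζ₈ : E) : Set (muInf → Submodule ℚ E) :=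
  {R | (p = 2 ∧ 4 ≤ k) ∧ ∃ φ : Multiplicative (ZMod (2 ^ (k - 1))) →* muInf,
    Function.Injective φ ∧
      R = pushforward φ (powerFamily (2 ^ (k - 1)) (ζ * (ζ₈ + ζ₈⁻¹)) ⊥)}

/-- For `p = 2` and `k ≥ 4`: the `μ_∞`-gradings obtained from `W_n = β^n · ℚ(α)`, `n ∈ ℤ/4ℤ`,
with `α = ζ² + ζ⁻²` and `β = ζ₈ (ζ + ζ⁻¹)`, along the injective homomorphisms `ℤ/4ℤ → μ_∞`. -/
def listD (p k : ℕ) (ζ ζ₈ : E) : Set (muInf → Submodule ℚ E) :=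
  {R | (p = 2 ∧ 4 ≤ k) ∧ ∃ φ : Multiplicative (ZMod 4) →* muInf,
    Function.Injective φ ∧
      R = pushforward φ (powerFamily 4 (ζ₈ * (ζ + ζ⁻¹))
        (IntermediateField.adjoin ℚ {ζ ^ 2 + (ζ ^ 2)⁻¹}))}

end Lists

end CyclotomicGradings

namespace CyclotomicGradings

/-! ### Push-forwards of families of subspaces -/

section Pushforward

variable {G H E : Type*} [Field E] [Algebra ℚ E]

/-! Let K be the component of degree 1 of a grading and H = Gal(E/K). Inverses of homogeneous
elements are homogeneous, so K is a field and the support is a finite group of roots of unity,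
cyclic of some order m with generator g. Choose x ≠ 0 of degree g. Then c(σ) = σx/x is an injective
map from H to μ_m(E) with c(στ) = σ(c(τ))c(σ), and independence of 1, x, …, x^(m-1) over K forces it
to be bijective (`IsGrading.exists_kummerData`). This is Kummer theory in which H may act on μ_m. An
element y has degree g^n as soon as σy/y = c(σ)^n for generators σ of H. So one looks for subgroups
of the abelian group Gal(E/ℚ) with such a bijective cocycle.

If H acts on roots of unity by exponents s ≡ 1 mod p (mod 4 if p = 2), lifting the exponent shows
that c(σ) = z implies c(σ^a) = 1 exactly when z^a = 1. Then H is cyclic, generated by any σ with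
c(σ) primitive, and ζ is homogeneous (`KummerData.exists_mem_of_forall_modEq`); this is list (a).
For odd p the remaining case is m even. Then -1 is the value of complex conjugation, and
commutativity leaves only m = 2.

For p = 2 the remaining H move √-1. If m = 2, the nontrivial element sends ζ to ±ζ⁻¹. If m ≥ 4, the
stabiliser of √-1 in H is cyclic of index two, and H contains complex conjugation κ, with η = c(κ)
primitive (`KummerData.exists_conj`). For m = 4 the group is generated by κ and ζ ↦ -ζ. For m ≥ 8,
taking c(σ) = η⁻², the relation κσ = σκ makes the exponent of σ equal to 5 mod m; comparing orders,
H is the whole Galois group and σζ = ±ζ^5. The sign decides whether ζ or ζ√2 is homogeneous.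

Conversely, `isGrading_powerFamily` produces the listed gradings by a degree count. Since comparable
gradings coincide, membership in each list is equivalent to homogeneity of one or two explicit
elements in suitable degrees. This reduces counting to counting images of a generator, and
disjointness to comparing degrees. -/

theorem mem_pushforward {f : G → H} {R : G → Submodule ℚ E} (g : G) {x : E} (hx : x ∈ R g) :
    x ∈ pushforward f R (f g) :=
  (le_iSup₂_of_le (f := fun g' (_ : f g' = f g) => R g') g rfl le_rfl) hx

theorem pushforward_le {f : G → H} {R : G → Submodule ℚ E} {S : H → Submodule ℚ E}
    (h : ∀ g, R g ≤ S (f g)) (b : H) : pushforward f R b ≤ S b :=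
  iSup₂_le fun g hg => hg ▸ h g

theorem pushforward_of_forall_ne {f : G → H} {R : G → Submodule ℚ E} {b : H}
    (h : ∀ g, f g ≠ b) : pushforward f R b = ⊥ :=
  le_bot_iff.1 (iSup₂_le fun g hg => absurd hg (h g))

theorem pushforward_apply_of_injective {f : G → H} (hf : Function.Injective f)
    (R : G → Submodule ℚ E) (g : G) : pushforward f R (f g) = R g :=
  le_antisymm (iSup₂_le fun g' hg' => by rw [hf hg']) fun _ hx => mem_pushforward g hx

end Pushforward

/-! ### Formal properties of gradings -/

section Gradings

variable {G H E : Type*} [Group G] [Group H] [Field E] [Algebra ℚ E]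

open Classical in
theorem isInternal_iff {ι : Type*} (R : ι → Submodule ℚ E) :
    DirectSum.IsInternal R ↔ iSupIndep R ∧ iSup R = ⊤ :=
  DirectSum.isInternal_submodule_iff_iSupIndep_and_iSup_eq_top R

theorem IsGrading.iSupIndep {R : G → Submodule ℚ E} (hR : IsGrading R) : iSupIndep R :=
  ((isInternal_iff R).1 hR.isInternal).1

theorem IsGrading.iSup_eq_top {R : G → Submodule ℚ E} (hR : IsGrading R) : iSup R = ⊤ :=
  ((isInternal_iff R).1 hR.isInternal).2

theorem IsGrading.mk' {R : G → Submodule ℚ E} (h1 : _root_.iSupIndep R) (h2 : iSup R = ⊤)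
    (h3 : (1 : E) ∈ R 1)
    (h4 : ∀ (g h : G) (x y : E), x ∈ R g → y ∈ R h → x * y ∈ R (g * h)) : IsGrading R :=
  ⟨(isInternal_iff R).2 ⟨h1, h2⟩, h3, h4⟩

/-- A nonzero homogeneous element has a unique degree. -/
theorem IsGrading.eq_of_mem {R : G → Submodule ℚ E} (hR : IsGrading R) {g h : G} {x : E}
    (hx : x ≠ 0) (hg : x ∈ R g) (hh : x ∈ R h) : g = h := by
  by_contra hne
  exact hx (Submodule.disjoint_def.1 (hR.iSupIndep.pairwiseDisjoint hne) x hg hh)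

theorem IsGrading.pow_mem {R : G → Submodule ℚ E} (hR : IsGrading R) {g : G} {x : E}
    (hg : x ∈ R g) (n : ℕ) : x ^ n ∈ R (g ^ n) := by
  induction n with
  | zero => simpa using hR.one_mem
  | succ n ih => rw [pow_succ, pow_succ]; exact hR.mul_mem _ _ _ _ ih hg

theorem IsGrading.algebraMap_mem {R : G → Submodule ℚ E} (hR : IsGrading R) (r : ℚ) :
    algebraMap ℚ E r ∈ R 1 := by
  rw [Algebra.algebraMap_eq_smul_one]; exact (R 1).smul_mem _ hR.one_mem

/-- Gradings are minimal, and maximal, among families of subspaces for inclusion. -/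
theorem IsGrading.eq_of_le {R S : G → Submodule ℚ E} (hR : IsGrading R) (hS : IsGrading S)
    (h : ∀ g, R g ≤ S g) : R = S := by
  funext g
  refine le_antisymm (h g) fun x hx => ?_
  have hx' : x ∈ iSup R := hR.iSup_eq_top ▸ Submodule.mem_top
  -- Only components of degree other than `g` are enlarged, so the error term `z` lies both in `S g`
  -- and in the sum of the other `S j`.
  have hle : iSup R ≤ R g ⊔ ⨆ (j) (_ : j ≠ g), S j := by
    refine iSup_le fun j => ?_
    by_cases hj : j = g
    · subst hj; exact le_sup_left
    · exact ((h j).trans (le_iSup₂_of_le j hj le_rfl)).trans le_sup_right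
  obtain ⟨y, hy, z, hz, hyz⟩ := Submodule.mem_sup.1 (hle hx')
  have hz' : z ∈ S g := by
    have : z = x - y := by rw [← hyz]; ring
    rw [this]; exact (S g).sub_mem hx (h g hy)
  have : z = 0 := Submodule.disjoint_def.1 (hS.iSupIndep g) z hz' hz
  rw [← hyz, this, add_zero]; exact hy

theorem IsGrading.pushforward {R : G → Submodule ℚ E} (hR : IsGrading R) (f : G →* H) :
    IsGrading (pushforward f R) := by
  refine IsGrading.mk' (fun b => ?_) ?_ ?_ ?_
  -- The fibre over `b` and its complement are disjoint sets of degrees.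
  · have hd := hR.iSupIndep.disjoint_biSup_biSup (s := {g | f g = b}) (t := {g | f g ≠ b})
      (Set.disjoint_left.2 fun g h1 h2 => h2 h1)
    refine hd.mono le_rfl (iSup₂_le fun c hc => iSup₂_le fun g hg => ?_)
    exact le_iSup₂_of_le (f := fun g (_ : g ∈ {g | f g ≠ b}) => R g) g
      (by simp only [Set.mem_ofPred_eq]; rw [hg]; exact hc) le_rfl
  · rw [eq_top_iff, ← hR.iSup_eq_top]
    exact iSup_le fun g => le_iSup_of_le (f g) fun x hx => mem_pushforward g hx
  · simpa using mem_pushforward (f := f) 1 hR.one_mem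
  · intro b c x y hx hy
    have key : ∀ g, f g = b → ∀ x ∈ R g, ∀ y ∈ CyclotomicGradings.pushforward f R c,
        x * y ∈ CyclotomicGradings.pushforward f R (b * c) := by
      rintro g rfl x hx y hy
      have : CyclotomicGradings.pushforward f R c ≤
          (CyclotomicGradings.pushforward f R (f g * c)).comap (LinearMap.mulLeft ℚ x) := by
        refine iSup₂_le fun h hh => ?_
        subst hh
        intro z hz
        simp only [Submodule.mem_comap, LinearMap.mulLeft_apply]
        rw [← map_mul]
        exact mem_pushforward _ (hR.mul_mem _ _ _ _ hx hz)
      exact this hy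
    have : CyclotomicGradings.pushforward f R b ≤
        (CyclotomicGradings.pushforward f R (b * c)).comap (LinearMap.mulRight ℚ y) := by
      refine iSup₂_le fun g hg z hz => ?_
      simpa using key g hg z hz y hy
    simpa using this hx

/-- A grading supported on a subgroup is a grading by that subgroup. -/
theorem IsGrading.restrict {S : H → Submodule ℚ E} (hS : IsGrading S) {f : G →* H}
    (hf : Function.Injective f) (hsupp : ∀ h, S h ≠ ⊥ → h ∈ Set.range f) :
    IsGrading (fun g => S (f g)) ∧ CyclotomicGradings.pushforward f (fun g => S (f g)) = S := by
  have hgr : IsGrading (fun g => S (f g)) := by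
    refine IsGrading.mk' (hS.iSupIndep.comp hf) ?_ (by simpa using hS.one_mem) fun g h x y hx hy => ?_
    · rw [eq_top_iff, ← hS.iSup_eq_top]
      refine iSup_le fun b => ?_
      by_cases hb : S b = ⊥
      · simp [hb]
      · obtain ⟨g, rfl⟩ := hsupp b hb
        exact le_iSup (fun g => S (f g)) g
    · rw [map_mul]; exact hS.mul_mem _ _ _ _ hx hy
  exact ⟨hgr, (hgr.pushforward f).eq_of_le hS (pushforward_le fun g => le_rfl)⟩

open Classical in
-- The map from the external direct sum is onto, and the dimension bound leaves no room for a
-- kernel.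
theorem isInternal_of_iSup_eq_top_of_finrank_le {ι : Type*} [Fintype ι] [FiniteDimensional ℚ E]
    (R : ι → Submodule ℚ E) (h : iSup R = ⊤)
    (hd : ∑ i, Module.finrank ℚ (R i) ≤ Module.finrank ℚ E) : DirectSum.IsInternal R := by
  have hs : Function.Surjective (DirectSum.coeLinearMap R) := by
    rw [← LinearMap.range_eq_top, DirectSum.range_coeLinearMap, h]
  have hfin : Module.finrank ℚ (DirectSum ι fun i => R i) = Module.finrank ℚ E :=
    le_antisymm (by rw [Module.finrank_directSum]; exact hd)
      (LinearMap.finrank_le_finrank_of_surjective hs)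
  have hi : Function.Injective (DirectSum.coeLinearMap R) :=
    OrzechProperty.injective_of_surjective_of_injective
      (LinearEquiv.ofFinrankEq _ _ hfin).toLinearMap (DirectSum.coeLinearMap R)
      (LinearEquiv.injective _) hs
  exact ⟨hi, hs⟩

end Gradings

/-! ### Gradings by powers of one element -/

section PowerFamily

variable {E : Type*} [Field E] [Algebra ℚ E]

theorem mem_mulSubfield {a : E} {K : IntermediateField ℚ E} {y : E} :
    y ∈ mulSubfield a K ↔ ∃ c ∈ K, a * c = y := by
  simp [mulSubfield, Submodule.mem_map]

theorem mem_powerFamily {m : ℕ} {a : E} {K : IntermediateField ℚ E}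
    {n : Multiplicative (ZMod m)} {y : E} :
    y ∈ powerFamily m a K n ↔ ∃ c ∈ K, a ^ (Multiplicative.toAdd n).val * c = y :=
  mem_mulSubfield

theorem pow_mul_mem_powerFamily {m : ℕ} [NeZero m] {a : E} {K : IntermediateField ℚ E}
    (ha : a ^ m ∈ K) (n : ℕ) {c : E} (hc : c ∈ K) :
    a ^ n * c ∈ powerFamily m a K (Multiplicative.ofAdd (n : ZMod m)) := by
  rw [mem_powerFamily]
  -- Division of `n` by `m`: the surplus factor is a power of `a ^ m`, which lies in `K`.
  refine ⟨(a ^ m) ^ (n / m) * c, mul_mem (pow_mem ha _) hc, ?_⟩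
  rw [toAdd_ofAdd, ZMod.val_natCast, ← mul_assoc, ← pow_mul, ← pow_add, Nat.mod_add_div]

/-- If `E = K(a)` has degree at least `m` over `K` and `a ^ m ∈ K`, then the powers of `a` grade
`E` by `ℤ/mℤ`. -/
theorem isGrading_powerFamily [FiniteDimensional ℚ E] [IsGalois ℚ E] (m : ℕ) [NeZero m] (a : E)
    (K : IntermediateField ℚ E) (ha : a ^ m ∈ K)
    (hgen : ∀ σ : E ≃ₐ[ℚ] E, (∀ c ∈ K, σ c = c) → σ a = a → σ = 1)
    (hdim : m * Module.finrank ℚ K ≤ Module.finrank ℚ E) :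
    IsGrading (powerFamily m a K) := by
  refine ⟨?_, ?_, ?_⟩
  · haveI : Fintype (Multiplicative (ZMod m)) := Fintype.ofFinite _
    convert isInternal_of_iSup_eq_top_of_finrank_le (powerFamily m a K) ?_ ?_
    -- By the Galois correspondence `K(a) = E`, so the powers of `a` span `E` over `K`.
    · have htop : IntermediateField.adjoin K {a} = ⊤ := by
        have : (IntermediateField.adjoin K {a}).fixingSubgroup = ⊥ := by
          rw [eq_bot_iff]
          intro τ hτ
          have h1 := hgen (τ.restrictScalars ℚ) (fun c hc => τ.commutes ⟨c, hc⟩)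
            (hτ ⟨a, IntermediateField.mem_adjoin_simple_self K a⟩)
          rw [Subgroup.mem_bot]
          ext z
          exact DFunLike.congr_fun h1 z
        rw [← IsGalois.fixedField_fixingSubgroup (IntermediateField.adjoin K {a}), this,
          IntermediateField.fixedField_bot]
      have halg : Algebra.adjoin K {a} = ⊤ := by
        rw [← IntermediateField.adjoin_simple_toSubalgebra_of_isAlgebraic
          (Algebra.IsIntegral.isIntegral a).isAlgebraic, htop, IntermediateField.top_toSubalgebra]
      rw [eq_top_iff]
      intro y _
      have hy : y ∈ Algebra.adjoin K {a} := halg ▸ Algebra.mem_top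
      rw [Algebra.adjoin_singleton_eq_range_aeval] at hy
      obtain ⟨P, rfl⟩ := hy
      change Polynomial.aeval a P ∈ _
      rw [Polynomial.aeval_eq_sum_range]
      refine Submodule.sum_mem _ fun i _ => ?_
      have := pow_mul_mem_powerFamily ha i (P.coeff i).2
      rw [Algebra.smul_def, mul_comm]
      exact Submodule.mem_iSup_of_mem _ this
    -- Each of the `m` components is a linear image of `K`.
    · refine le_trans (Finset.sum_le_card_nsmul _ _ (Module.finrank ℚ K) fun n _ => ?_) ?_
      · exact Submodule.finrank_map_le _ _
      · rw [Finset.card_univ, ← Nat.card_eq_fintype_card, Nat.card_congr Multiplicative.toAdd,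
          Nat.card_zmod, smul_eq_mul]
        exact hdim
  · simpa using pow_mul_mem_powerFamily ha 0 K.one_mem
  · intro g h x y hx hy
    obtain ⟨c, hc, rfl⟩ := mem_powerFamily.1 hx
    obtain ⟨d, hd, rfl⟩ := mem_powerFamily.1 hy
    have := pow_mul_mem_powerFamily ha
      ((Multiplicative.toAdd g).val + (Multiplicative.toAdd h).val) (mul_mem hc hd)
    rw [Nat.cast_add, ZMod.natCast_zmod_val, ZMod.natCast_zmod_val, ofAdd_add, ofAdd_toAdd,
      ofAdd_toAdd] at this
    convert this using 1
    ring

/-- A homogeneous generator determines the push-forward of a power family. -/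
theorem pushforward_powerFamily_eq {H : Type*} [Group H] {m : ℕ} [NeZero m] {a : E}
    {K : IntermediateField ℚ E} (hP : IsGrading (powerFamily m a K))
    (φ : Multiplicative (ZMod m) →* H) {R : H → Submodule ℚ E} (hR : IsGrading R)
    (hK : ∀ c ∈ K, c ∈ R 1) (ha : a ∈ R (φ (Multiplicative.ofAdd 1))) :
    R = pushforward φ (powerFamily m a K) := by
  refine ((hP.pushforward φ).eq_of_le hR (pushforward_le fun n x hx => ?_)).symm
  obtain ⟨c, hc, rfl⟩ := mem_powerFamily.1 hx
  have := hR.mul_mem _ _ _ _ (hR.pow_mem ha (Multiplicative.toAdd n).val) (hK c hc)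
  rw [mul_one, ← map_pow, ← ofAdd_nsmul, nsmul_one, ZMod.natCast_zmod_val, ofAdd_toAdd] at this
  exact this

theorem mem_pushforward_powerFamily {H : Type*} [Group H] {m : ℕ} [NeZero m] {a : E}
    {K : IntermediateField ℚ E} (ha : a ^ m ∈ K) (φ : Multiplicative (ZMod m) →* H) :
    a ∈ pushforward φ (powerFamily m a K) (φ (Multiplicative.ofAdd 1)) := by
  have := pow_mul_mem_powerFamily ha 1 K.one_mem
  rw [pow_one, mul_one, Nat.cast_one] at this
  exact mem_pushforward _ this

theorem mem_pushforward_powerFamily_one {H : Type*} [Group H] {m : ℕ} [NeZero m] {a : E}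
    {K : IntermediateField ℚ E} (φ : Multiplicative (ZMod m) →* H) {c : E} (hc : c ∈ K) :
    c ∈ pushforward φ (powerFamily m a K) 1 := by
  have : c ∈ powerFamily m a K 1 := mem_powerFamily.2 ⟨c, hc, by simp⟩
  simpa using mem_pushforward (f := φ) _ this

end PowerFamily

/-! ### Homomorphisms out of finite cyclic groups -/

/-- The homomorphism from a cyclic group `ℤ/mℤ` with a prescribed image of the generator. -/
theorem exists_zmod_hom {H : Type*} [CommGroup H] {m : ℕ} (g : H) (hg : g ^ m = 1) :
    ∃ φ : Multiplicative (ZMod m) →* H, φ (Multiplicative.ofAdd 1) = g := by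
  refine ⟨AddMonoidHom.toMultiplicativeLeft (ZMod.lift m ⟨zmultiplesHom (Additive H)
    (Additive.ofMul g), ?_⟩), ?_⟩
  · simpa [← ofMul_pow] using hg
  · have := ZMod.lift_coe m (A := Additive H) ⟨zmultiplesHom (Additive H)
      (Additive.ofMul g), by simpa [← ofMul_pow] using hg⟩ 1
    have h2 := congrArg Additive.toMul this
    simpa using h2

theorem zmod_hom_ext {H : Type*} [Group H] {m : ℕ} [NeZero m]
    {φ ψ : Multiplicative (ZMod m) →* H}
    (h : φ (Multiplicative.ofAdd 1) = ψ (Multiplicative.ofAdd 1)) : φ = ψ := by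
  refine MonoidHom.ext fun n => ?_
  have : n = Multiplicative.ofAdd (1 : ZMod m) ^ (Multiplicative.toAdd n).val := by
    rw [← ofAdd_nsmul, nsmul_one, ZMod.natCast_zmod_val, ofAdd_toAdd]
  rw [this, map_pow, map_pow, h]

theorem zmod_hom_apply_pow {H : Type*} [Group H] {m : ℕ} (φ : Multiplicative (ZMod m) →* H) :
    φ (Multiplicative.ofAdd 1) ^ m = 1 := by
  rw [← map_pow, ← ofAdd_nsmul, nsmul_one, ZMod.natCast_self, ofAdd_zero, map_one]

theorem zmod_hom_injective_iff {H : Type*} [Group H] {m : ℕ} [NeZero m]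
    (φ : Multiplicative (ZMod m) →* H) :
    Function.Injective φ ↔ orderOf (φ (Multiplicative.ofAdd 1)) = m := by
  have h1 : orderOf (Multiplicative.ofAdd (1 : ZMod m)) = m := by
    rw [orderOf_ofAdd_eq_addOrderOf, ZMod.addOrderOf_one]
  constructor
  · intro h
    rw [orderOf_injective φ h, h1]
  · intro h
    rw [injective_iff_map_eq_one]
    intro n hn
    have : n = Multiplicative.ofAdd (1 : ZMod m) ^ (Multiplicative.toAdd n).val := by
      rw [← ofAdd_nsmul, nsmul_one, ZMod.natCast_zmod_val, ofAdd_toAdd]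
    rw [this, map_pow, ← orderOf_dvd_iff_pow_eq_one, h] at hn
    rw [this, ← orderOf_dvd_iff_pow_eq_one, h1]
    exact hn

end CyclotomicGradings
namespace CyclotomicGradings

/-! ### The cocycle attached to a grading -/

section Structure

variable {E : Type*} [Field E] [Algebra ℚ E]

/-- The Kummer-theoretic description of a grading `R`: the group `H` fixes the component of degree
`1`, the element `x` generates the component of degree `g`, and `σ ↦ σ x / x` is a bijection
from `H` to the group of `m`-th roots of unity. -/
structure KummerData (R : muInf → Submodule ℚ E) (H : Subgroup (E ≃ₐ[ℚ] E)) (m : ℕ) (g : muInf)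
    (x : E) : Prop where
  pos : 0 < m
  ne_zero : x ≠ 0
  orderOf_eq : orderOf g = m
  card_eq : Nat.card H = m
  exists_root : ∀ σ ∈ H, ∃ z : E, z ^ m = 1 ∧ σ x = z * x
  eq_one : ∀ σ ∈ H, σ x = x → σ = 1
  exists_aut : ∀ z : E, z ^ m = 1 → ∃ σ ∈ H, σ x = z * x
  exists_primitive : ∃ z : E, IsPrimitiveRoot z m
  mem_of : ∀ (n : ℕ) (y : E), (∀ σ ∈ H, ∀ z : E, σ x = z * x → σ y = z ^ n * y) → y ∈ R (g ^ n)

variable [FiniteDimensional ℚ E]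

/-- The degree `g` has finite order `m`, so `x⁻¹ = x ^ (m - 1) * (x ^ m)⁻¹` reduces the claim to
degree `1`. There, the inverse of an algebraic element is a polynomial in it. -/
theorem IsGrading.inv_mem {R : muInf → Submodule ℚ E} (hR : IsGrading R) {g : muInf} {x : E}
    (hx : x ∈ R g) : x⁻¹ ∈ R g⁻¹ := by
  rcases eq_or_ne x 0 with rfl | hx0
  · simp
  have hinv1 : ∀ y ∈ R 1, y⁻¹ ∈ R 1 := by
    intro y hy
    have : y⁻¹ ∈ Algebra.adjoin ℚ {y} := by
      have h := (Algebra.IsAlgebraic.isAlgebraic (R := ℚ) y)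
      have h2 := (IntermediateField.adjoin ℚ {y}).inv_mem
        (IntermediateField.mem_adjoin_simple_self ℚ y)
      rwa [← IntermediateField.mem_toSubalgebra,
        IntermediateField.adjoin_simple_toSubalgebra_of_isAlgebraic h] at h2
    refine Algebra.adjoin_induction (p := fun z _ => z ∈ R 1) ?_ ?_ ?_ ?_ this
    · rintro z rfl; exact hy
    · exact hR.algebraMap_mem
    · exact fun a b _ _ ha hb => (R 1).add_mem ha hb
    · intro a b _ _ ha hb
      simpa using hR.mul_mem 1 1 a b ha hb
  have hg : IsOfFinOrder g := by
    obtain ⟨n, hn, h⟩ := isOfFinOrder_iff_pow_eq_one.1 g.2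
    exact isOfFinOrder_iff_pow_eq_one.2 ⟨n, hn, Subtype.ext h⟩
  have h0 := orderOf_pos_iff.2 hg
  set m := orderOf g with hm
  have h1 := hR.pow_mem hx m
  rw [hm, pow_orderOf_eq_one, ← hm] at h1
  have h2 := hR.mul_mem _ _ _ _ (hR.pow_mem hx (m - 1)) (hinv1 _ h1)
  have e1 : x ^ (m - 1) * (x ^ m)⁻¹ = x⁻¹ := by
    obtain ⟨j, hj⟩ := Nat.exists_eq_succ_of_ne_zero h0.ne'
    rw [hj, Nat.succ_sub_one, Nat.succ_eq_add_one, pow_succ]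
    field_simp
  have e2 : g ^ (m - 1) * 1 = g⁻¹ := by
    rw [mul_one, eq_inv_iff_mul_eq_one, ← pow_succ, Nat.sub_add_cancel h0, hm, pow_orderOf_eq_one]
  rwa [e1, e2] at h2

/-- The component of degree `1` of a grading is a subfield. -/
theorem IsGrading.exists_subfield {R : muInf → Submodule ℚ E} (hR : IsGrading R) :
    ∃ K : IntermediateField ℚ E, ∀ y, y ∈ K ↔ y ∈ R 1 :=
  ⟨{ carrier := R 1
     mul_mem' := fun {a b} ha hb => by simpa using hR.mul_mem 1 1 a b ha hb
     one_mem' := hR.one_mem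
     add_mem' := (R 1).add_mem
     zero_mem' := (R 1).zero_mem
     algebraMap_mem' := hR.algebraMap_mem
     inv_mem' := fun a ha => by simpa using hR.inv_mem ha }, fun _ => Iff.rfl⟩

/-- The support of a grading by roots of unity is a finite cyclic group. -/
theorem IsGrading.exists_generator {R : muInf → Submodule ℚ E} (hR : IsGrading R) :
    ∃ g : muInf, 0 < orderOf g ∧ R g ≠ ⊥ ∧ ∀ h, R h ≠ ⊥ → ∃ n : ℕ, h = g ^ n := by
  have hfin : Finite {h : muInf // R h ≠ ⊥} :=
    (WellFoundedGT.finite_ne_bot_of_iSupIndep hR.iSupIndep).to_subtype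
  have hex : ∀ h, R h ≠ ⊥ ↔ ∃ y ∈ R h, y ≠ 0 := fun h => Submodule.ne_bot_iff _
  let S : Subgroup muInf :=
    { carrier := {h | R h ≠ ⊥}
      mul_mem' := by
        intro a b ha hb
        obtain ⟨y, hy, hy0⟩ := (hex a).1 ha
        obtain ⟨z, hz, hz0⟩ := (hex b).1 hb
        exact (hex _).2 ⟨y * z, hR.mul_mem _ _ _ _ hy hz, mul_ne_zero hy0 hz0⟩
      one_mem' := (hex 1).2 ⟨1, hR.one_mem, one_ne_zero⟩
      inv_mem' := by
        intro a ha
        obtain ⟨y, hy, hy0⟩ := (hex a).1 ha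
        exact (hex _).2 ⟨y⁻¹, hR.inv_mem hy, inv_ne_zero hy0⟩ }
  have hS : Finite S := hfin
  -- A finite group embedded in the multiplicative monoid of a field is cyclic.
  let f : S →* ℂ := (Units.coeHom ℂ).comp (muInf.subtype.comp S.subtype)
  have hf : Function.Injective f := by
    intro a b hab
    exact Subtype.ext (Subtype.ext (Units.ext hab))
  have hc : IsCyclic S := isCyclic_of_injective_ringHom f hf
  obtain ⟨g, hg⟩ := hc.exists_generator
  refine ⟨g.1, ?_, g.2, fun h hh => ?_⟩
  · rw [Subgroup.orderOf_coe]; exact orderOf_pos g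
  · have := hg ⟨h, hh⟩
    rw [← mem_powers_iff_mem_zpowers] at this
    obtain ⟨n, hn⟩ := this
    refine ⟨n, ?_⟩
    have := congrArg Subtype.val hn
    simpa using this.symm

/-- The ratios `σ x / x` lie in `μ_m(E)` because `x ^ m` is in the fixed field `K`. They determine
`σ` because `K` and `x` generate `E`, and they exhaust `μ_m(E)` because `[E : K] ≥ m`. -/
theorem IsGrading.exists_kummerData [IsGalois ℚ E] {R : muInf → Submodule ℚ E}
    (hR : IsGrading R) : ∃ H m g x, KummerData R H m g x := by
  obtain ⟨K, hK⟩ := hR.exists_subfield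
  obtain ⟨g, hg0, hg1, hg2⟩ := hR.exists_generator
  obtain ⟨x, hx, hx0⟩ := (Submodule.ne_bot_iff _).1 hg1
  set m := orderOf g with hm
  have hxm : x ^ m ∈ K := by
    rw [hK]; simpa [hm, pow_orderOf_eq_one] using hR.pow_mem hx m
  have hfix : ∀ y, (∀ σ ∈ K.fixingSubgroup, σ y = y) → y ∈ K := by
    intro y hy
    rw [← IsGalois.fixedField_fixingSubgroup K]
    exact fun σ => hy σ σ.2
  have hfix' : ∀ σ ∈ K.fixingSubgroup, ∀ y ∈ K, σ y = y := fun σ hσ y hy => hσ ⟨y, hy⟩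
  have hroot : ∀ σ ∈ K.fixingSubgroup, ∃ z : E, z ^ m = 1 ∧ σ x = z * x := by
    intro σ hσ
    refine ⟨σ x / x, ?_, by field_simp⟩
    rw [div_pow, ← map_pow, hfix' σ hσ _ hxm, div_self (pow_ne_zero _ hx0)]
  have hone : ∀ σ ∈ K.fixingSubgroup, σ x = x → σ = 1 := by
    intro σ hσ hσx
    have : ∀ y ∈ iSup R, σ y = y := by
      intro y hy
      refine Submodule.iSup_induction R (motive := fun y => σ y = y) hy ?_ (map_zero σ) ?_
      · intro h y hy
        rcases eq_or_ne y 0 with rfl | hy0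
        · simp
        obtain ⟨n, rfl⟩ := hg2 h ((Submodule.ne_bot_iff _).2 ⟨y, hy, hy0⟩)
        -- A homogeneous `y` of degree `g ^ n` is a `K`-multiple of `x ^ n`.
        have h1 := hR.mul_mem _ _ _ _ hy (hR.inv_mem (hR.pow_mem hx n))
        rw [mul_inv_cancel, ← hK] at h1
        have h2 := hfix' σ hσ _ h1
        rw [map_mul, map_inv₀, map_pow, hσx] at h2
        exact mul_right_cancel₀ (inv_ne_zero (pow_ne_zero n hx0)) h2
      · intro a b ha hb
        rw [map_add, ha, hb]
    ext y
    exact this y (hR.iSup_eq_top ▸ Submodule.mem_top)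
  have hmle : m ≤ Nat.card K.fixingSubgroup := by
    rw [IsGalois.card_fixingSubgroup_eq_finrank]
    -- For `i < m` the powers `x ^ i` have pairwise distinct degrees.
    have hli : LinearIndependent K (fun i : Fin m => x ^ (i : ℕ)) := by
      rw [Fintype.linearIndependent_iff]
      intro c hc i
      have hinj : Function.Injective (fun i : Fin m => g ^ (i : ℕ)) := fun a b hab =>
        Fin.ext (pow_injOn_Iio_orderOf (hm ▸ a.2) (hm ▸ b.2) hab)
      have hind := hR.iSupIndep.comp hinj
      have hmem : ∀ i : Fin m, c i • x ^ (i : ℕ) ∈ R (g ^ (i : ℕ)) := by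
        intro i
        have := hR.mul_mem _ _ _ _ ((hK _).1 (c i).2) (hR.pow_mem hx i)
        rwa [one_mul] at this
      have h0 : c i • x ^ (i : ℕ) = 0 := by
        have h1 := Finset.add_sum_erase Finset.univ (fun i => c i • x ^ (i : ℕ)) (Finset.mem_univ i)
        rw [hc] at h1
        refine Submodule.disjoint_def.1 (hind i) _ (hmem i) ?_
        rw [eq_neg_of_add_eq_zero_left h1]
        refine Submodule.neg_mem _ (Submodule.sum_mem _ fun j hj => ?_)
        exact (le_iSup₂_of_le (f := fun j (_ : j ≠ i) => R (g ^ (j : ℕ))) j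
          (Finset.ne_of_mem_erase hj) le_rfl) (hmem j)
      exact (smul_eq_zero.1 h0).resolve_right (pow_ne_zero _ hx0)
    simpa using hli.fintype_card_le_finrank
  have : NeZero m := ⟨hg0.ne'⟩
  choose c hc1 hc2 using hroot
  let C : K.fixingSubgroup → rootsOfUnity m E := fun σ =>
    rootsOfUnity.mkOfPowEq (c σ σ.2) (hc1 σ σ.2)
  have hC : ∀ σ, ((C σ : Eˣ) : E) = c σ σ.2 := fun σ => rootsOfUnity.coe_mkOfPowEq _
  have hCinj : Function.Injective C := by
    intro σ τ hστ
    have h1 : c σ σ.2 = c τ τ.2 :=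
      (hC σ).symm.trans ((congrArg (fun u : rootsOfUnity m E => ((u : Eˣ) : E)) hστ).trans (hC τ))
    have h2 : (σ : E ≃ₐ[ℚ] E) x = (τ : E ≃ₐ[ℚ] E) x := by rw [hc2 _ σ.2, hc2 _ τ.2, h1]
    have h3 := hone _ (Subgroup.mul_mem _ (Subgroup.inv_mem _ τ.2) σ.2) (by
      rw [AlgEquiv.mul_apply, h2, ← AlgEquiv.mul_apply, inv_mul_cancel, AlgEquiv.one_apply])
    exact Subtype.ext (inv_mul_eq_one.1 h3).symm
  have hcard : Nat.card (rootsOfUnity m E) ≤ m := card_rootsOfUnity E m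
  have hle := Nat.card_le_card_of_injective C hCinj
  -- The chain m ≤ |H| ≤ |μ_m(E)| ≤ m consists of equalities.
  have hbij := hCinj.bijective_of_nat_card_le (hcard.trans hmle)
  refine ⟨K.fixingSubgroup, m, g, x, hg0, hx0, rfl, le_antisymm (hle.trans hcard) hmle,
    fun σ hσ => ⟨c σ hσ, hc1 σ hσ, hc2 σ hσ⟩, hone, ?_, ?_, ?_⟩
  · intro z hz
    obtain ⟨σ, hσ⟩ := hbij.2 (rootsOfUnity.mkOfPowEq z hz)
    refine ⟨σ, σ.2, ?_⟩
    rw [hc2 σ σ.2, ← hC, hσ, rootsOfUnity.coe_mkOfPowEq]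
  · refine card_rootsOfUnity_eq_iff_exists_isPrimitiveRoot.1 ?_
    exact le_antisymm hcard (hmle.trans hle)
  · intro n y hy
    -- `y` and `x ^ n` transform under `H` by the same factors.
    have h1 : y * (x ^ n)⁻¹ ∈ K := by
      refine hfix _ fun σ hσ => ?_
      rw [map_mul, map_inv₀, map_pow, hy σ hσ _ (hc2 σ hσ), hc2 σ hσ, mul_pow, mul_inv]
      have hc0 : c σ hσ ≠ 0 := by
        intro h
        have := hc1 σ hσ
        rw [h, zero_pow hg0.ne'] at this
        exact zero_ne_one this
      field_simp
    have h2 := hR.mul_mem _ _ _ _ ((hK _).1 h1) (hR.pow_mem hx n)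
    rwa [one_mul, inv_mul_cancel_right₀ (pow_ne_zero n hx0)] at h2

end Structure

end CyclotomicGradings
namespace CyclotomicGradings

/-! ### Lifting the exponent -/

section Arithmetic

/-- Lifting the exponent for geometric sums. -/
theorem prime_pow_dvd_geom_sum_iff {p : ℕ} (hp : p.Prime) {s : ℕ} (hs : s ≡ 1 [MOD p])
    (hs4 : p = 2 → s ≡ 1 [MOD 4]) (n a : ℕ) :
    p ^ n ∣ ∑ i ∈ Finset.range a, s ^ i ↔ p ^ n ∣ a := by
  -- The case `s = 1` is split off because `s - 1` then has infinite multiplicity.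
  rcases eq_or_ne s 1 with rfl | hs1
  · simp
  have hd : (p : ℤ) ∣ (s : ℤ) - 1 := by
    have := (Nat.modEq_iff_dvd.1 hs.symm); simpa using this
  have hpz : Prime (p : ℤ) := Nat.prime_iff_prime_int.1 hp
  have hnd : ¬ (p : ℤ) ∣ (s : ℤ) := by
    intro h
    have := dvd_sub h hd
    rw [sub_sub_cancel] at this
    exact hpz.not_isUnit (isUnit_of_dvd_one this)
  have key : emultiplicity (p : ℤ) ((s : ℤ) ^ a - 1 ^ a) =
      emultiplicity (p : ℤ) ((s : ℤ) - 1) + emultiplicity (p : ℤ) (a : ℤ) := by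
    rcases hp.eq_two_or_odd' with rfl | hodd
    · have h4 : (4 : ℤ) ∣ (s : ℤ) - 1 := by
        have := (Nat.modEq_iff_dvd.1 (hs4 rfl).symm); simpa using this
      exact Int.two_pow_sub_pow' a h4 hnd
    · rw [Int.emultiplicity_pow_sub_pow hp hodd hd hnd, Int.natCast_emultiplicity]
  -- Factor `s ^ a - 1` through `s - 1`, whose finite multiplicity then cancels.
  rw [one_pow, ← geom_sum_mul, emultiplicity_mul hpz, add_comm] at key
  have hfin : FiniteMultiplicity (p : ℤ) ((s : ℤ) - 1) :=
    Int.finiteMultiplicity_iff.2 ⟨by simpa using hp.ne_one, by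
      rw [sub_ne_zero]; exact_mod_cast hs1⟩
  have key2 := (ENat.add_right_injective_of_ne_top
    (finiteMultiplicity_iff_emultiplicity_ne_top.1 hfin)) key
  rw [← Int.natCast_dvd_natCast, ← Int.natCast_dvd_natCast (n := a), Nat.cast_pow,
    pow_dvd_iff_le_emultiplicity, pow_dvd_iff_le_emultiplicity, ← key2]
  simp

/-- The order of `z` is a power of `p`, which turns both conditions into divisibilities. -/
theorem pow_geom_sum_eq_one_iff {M : Type*} [Monoid M] {p k : ℕ} (hp : p.Prime) {s : ℕ}
    (hs : s ≡ 1 [MOD p]) (hs4 : p = 2 → s ≡ 1 [MOD 4]) {z : M} (hz : z ^ p ^ k = 1) (a : ℕ) :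
    z ^ (∑ i ∈ Finset.range a, s ^ i) = 1 ↔ z ^ a = 1 := by
  obtain ⟨r, -, hr⟩ := (Nat.dvd_prime_pow hp).1 (orderOf_dvd_of_pow_eq_one hz)
  rw [← orderOf_dvd_iff_pow_eq_one, ← orderOf_dvd_iff_pow_eq_one, hr]
  exact prime_pow_dvd_geom_sum_iff hp hs hs4 r a

end Arithmetic

/-! ### Computing with the cocycle -/

section Kummer

variable {E : Type*} [Field E] [Algebra ℚ E]

/-- Iterating c(στ) = σ(c(τ))c(σ) replaces the exponent `a` of ordinary Kummer theory by a geometric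
sum. -/
theorem aut_pow_apply {σ : E ≃ₐ[ℚ] E} {x z : E} {s : ℕ} (hx : σ x = z * x) (hz : σ z = z ^ s)
    (a : ℕ) : (σ ^ a) x = z ^ (∑ i ∈ Finset.range a, s ^ i) * x := by
  induction a with
  | zero => simp
  | succ a ih =>
    rw [pow_succ', AlgEquiv.mul_apply, ih, map_mul, map_pow, hz, hx, geom_sum_succ, pow_succ,
      pow_mul]
    ring

variable {R : muInf → Submodule ℚ E} {H : Subgroup (E ≃ₐ[ℚ] E)} {m : ℕ} {g : muInf} {x : E}

theorem KummerData.eq_of_apply_eq (D : KummerData R H m g x) {σ τ : E ≃ₐ[ℚ] E} (hσ : σ ∈ H)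
    (hτ : τ ∈ H) (h : σ x = τ x) : σ = τ := by
  have := D.eq_one _ (mul_mem (inv_mem hτ) hσ) (by
    rw [AlgEquiv.mul_apply, h, ← AlgEquiv.mul_apply, inv_mul_cancel, AlgEquiv.one_apply])
  exact (inv_mul_eq_one.1 this).symm

/-- It suffices to test homogeneity on generators. -/
theorem KummerData.mem_of_closure (D : KummerData R H m g x) {S : Set (E ≃ₐ[ℚ] E)}
    (hS : ∀ σ ∈ H, σ ∈ Submonoid.closure S) (n : ℕ) (y : E)
    (h : ∀ σ ∈ S, ∃ z : E, σ x = z * x ∧ σ y = z ^ n * y) : y ∈ R (g ^ n) := by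
  refine D.mem_of n y fun σ hσ z hz => ?_
  have key : ∃ z : E, σ x = z * x ∧ σ y = z ^ n * y := by
    refine Submonoid.closure_induction (motive := fun σ _ => ∃ z : E, σ x = z * x ∧ σ y = z ^ n * y)
      h ⟨1, by simp, by simp⟩ ?_ (hS σ hσ)
    rintro σ τ - - ⟨z, hz1, hz2⟩ ⟨w, hw1, hw2⟩
    -- The cocycle rule is compatible with taking `n`-th powers, so the condition passes to
    -- products.
    refine ⟨σ w * z, ?_, ?_⟩
    · rw [AlgEquiv.mul_apply, hw1, map_mul, hz1, mul_assoc]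
    · rw [AlgEquiv.mul_apply, hw2, map_mul, map_pow, hz2, mul_pow, mul_assoc]
  obtain ⟨z', h1, h2⟩ := key
  rw [mul_right_cancel₀ D.ne_zero (hz.symm.trans h1), h2]

/-- An automorphism acting on roots of unity by an exponent close to `1` has the order of the
root of unity attached to it. -/
theorem KummerData.orderOf_aut (D : KummerData R H m g x) {p k s : ℕ} (hp : p.Prime)
    (hs : s ≡ 1 [MOD p]) (hs4 : p = 2 → s ≡ 1 [MOD 4]) {σ : E ≃ₐ[ℚ] E} (hσ : σ ∈ H) {z : E}
    (hz : z ^ p ^ k = 1) (hx : σ x = z * x) (hσz : σ z = z ^ s) : orderOf σ = orderOf z := by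
  have h : ∀ a, σ ^ a = 1 ↔ z ^ a = 1 := by
    intro a
    rw [← pow_geom_sum_eq_one_iff hp hs hs4 hz]
    constructor
    · intro h
      have h1 := aut_pow_apply hx hσz a
      rw [h, AlgEquiv.one_apply] at h1
      exact (mul_eq_right₀ D.ne_zero).1 h1.symm
    · intro h
      refine D.eq_one _ (pow_mem hσ a) ?_
      rw [aut_pow_apply hx hσz, h, one_mul]
  refine Nat.dvd_antisymm ?_ ?_
  · rw [orderOf_dvd_iff_pow_eq_one, h, pow_orderOf_eq_one]
  · rw [orderOf_dvd_iff_pow_eq_one, ← h, pow_orderOf_eq_one]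

end Kummer

/-! ### Automorphisms of cyclotomic fields -/

section Cyclotomic

variable {E : Type*} [Field E] [Algebra ℚ E] {n : ℕ} [NeZero n] {ζ : E}

theorem exists_pow_eq_apply (hζ : IsPrimitiveRoot ζ n) (σ : E ≃ₐ[ℚ] E) :
    ∃ s : ℕ, s.Coprime n ∧ σ ζ = ζ ^ s :=
  ⟨_, ZMod.val_coe_unit_coprime (hζ.autToPow ℚ σ), (hζ.autToPow_spec ℚ σ).symm⟩

theorem apply_eq_pow (hζ : IsPrimitiveRoot ζ n) {σ : E ≃ₐ[ℚ] E} {s : ℕ} (hs : σ ζ = ζ ^ s)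
    {z : E} (hz : z ^ n = 1) : σ z = z ^ s := by
  obtain ⟨t, -, rfl⟩ := hζ.eq_pow_of_pow_eq_one hz
  rw [map_pow, hs, ← pow_mul, ← pow_mul, mul_comm]

variable [IsCyclotomicExtension {n} ℚ E]

theorem aut_ext (hζ : IsPrimitiveRoot ζ n) {σ τ : E ≃ₐ[ℚ] E} (h : σ ζ = τ ζ) : σ = τ := by
  have h1 : (σ : E →ₐ[ℚ] E) = τ := (hζ.powerBasis ℚ).algHom_ext (by simpa using h)
  ext y
  exact DFunLike.congr_fun h1 y

theorem aut_comm (hζ : IsPrimitiveRoot ζ n) (σ τ : E ≃ₐ[ℚ] E) : σ * τ = τ * σ := by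
  obtain ⟨s, -, hs⟩ := exists_pow_eq_apply hζ σ
  obtain ⟨t, -, ht⟩ := exists_pow_eq_apply hζ τ
  refine aut_ext hζ ?_
  rw [AlgEquiv.mul_apply, AlgEquiv.mul_apply, hs, ht, map_pow, map_pow, hs, ht, ← pow_mul,
    ← pow_mul, mul_comm]

theorem exists_aut_apply_eq (hζ : IsPrimitiveRoot ζ n) {ξ : E} (hξ : IsPrimitiveRoot ξ n) :
    ∃ σ : E ≃ₐ[ℚ] E, σ ζ = ξ := by
  have hirr := Polynomial.cyclotomic.irreducible_rat (NeZero.pos n)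
  refine ⟨(IsCyclotomicExtension.fromZetaAut hζ hirr).symm.trans
    (IsCyclotomicExtension.fromZetaAut hξ hirr), ?_⟩
  rw [AlgEquiv.trans_apply, (AlgEquiv.symm_apply_eq _).2
    (IsCyclotomicExtension.fromZetaAut_spec hζ hirr).symm,
    IsCyclotomicExtension.fromZetaAut_spec]

variable {p k : ℕ} [IsCyclotomicExtension {p ^ k} ℚ E]
  {R : muInf → Submodule ℚ E} {H : Subgroup (E ≃ₐ[ℚ] E)} {m : ℕ} {g : muInf} {x : E}

omit [NeZero n] [IsCyclotomicExtension {n} ℚ E] in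
theorem KummerData.finite (D : KummerData R H m g x) : Finite H :=
  Nat.finite_of_card_ne_zero (by rw [D.card_eq]; exact D.pos.ne')

/-- If the group fixing the component of degree `1` acts on roots of unity by exponents close to
`1`, then `ζ` is homogeneous. -/
theorem KummerData.exists_mem_of_forall_modEq (hp : p.Prime) (hζ : IsPrimitiveRoot ζ (p ^ k))
    (D : KummerData R H m g x) (hm : m ∣ p ^ k)
    (hs : ∀ σ ∈ H, ∃ s : ℕ, s ≡ 1 [MOD p] ∧ (p = 2 → s ≡ 1 [MOD 4]) ∧ σ ζ = ζ ^ s) :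
    ∃ n : ℕ, ζ ∈ R (g ^ n) := by
  have : NeZero (p ^ k) := ⟨pow_ne_zero _ hp.ne_zero⟩
  have : NeZero m := ⟨D.pos.ne'⟩
  have := D.finite
  have := IsCyclotomicExtension.finiteDimensional {p ^ k} ℚ E
  obtain ⟨z, hz⟩ := D.exists_primitive
  obtain ⟨σ, hσ, hx⟩ := D.exists_aut z hz.pow_eq_one
  obtain ⟨s, hs1, hs4, hs⟩ := hs σ hσ
  have hzq : z ^ p ^ k = 1 := (hz.pow_eq_one_iff_dvd _).2 hm
  have hord := D.orderOf_aut hp hs1 hs4 hσ hzq hx (apply_eq_pow hζ hs hzq)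
  rw [← hz.eq_orderOf] at hord
  have htop : Subgroup.zpowers σ = H := by
    refine Subgroup.eq_of_le_of_card_ge (Subgroup.zpowers_le.2 hσ) ?_
    rw [Nat.card_zpowers, hord, D.card_eq]
  have hspos : s ≠ 0 := by
    rintro rfl
    have := (Nat.modEq_zero_iff_dvd.1 hs1.symm)
    exact hp.ne_one (Nat.dvd_one.1 this)
  have hw : σ ζ = ζ ^ (s - 1) * ζ := by rw [← pow_succ, Nat.sub_add_cancel (by omega), hs]
  have hwq : (ζ ^ (s - 1)) ^ p ^ k = 1 := by
    rw [← pow_mul, mul_comm, pow_mul, hζ.pow_eq_one, one_pow]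
  -- The geometric-sum criterion is now applied to `σ ζ / ζ = ζ ^ (s - 1)`: from `σ ^ m = 1`, this
  -- ratio is an `m`-th root of unity and hence a power of `z`.
  have hwm : (ζ ^ (s - 1)) ^ m = 1 := by
    rw [← pow_geom_sum_eq_one_iff hp hs1 hs4 hwq]
    have h1 := aut_pow_apply hw (apply_eq_pow hζ hs hwq) m
    rw [← hord, pow_orderOf_eq_one, AlgEquiv.one_apply] at h1
    rw [← hord]
    exact (mul_eq_right₀ (hζ.ne_zero (NeZero.ne _))).1 h1.symm
  obtain ⟨v, -, hv⟩ := hz.eq_pow_of_pow_eq_one hwm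
  refine ⟨v, D.mem_of_closure (S := {σ}) ?_ v ζ ?_⟩
  · intro τ hτ
    rw [← htop, ← mem_powers_iff_mem_zpowers] at hτ
    rw [← Submonoid.powers_eq_closure]
    exact hτ
  · rintro _ rfl
    exact ⟨z, hx, by rw [hv, hw]⟩

end Cyclotomic

end CyclotomicGradings
namespace CyclotomicGradings

/-! ### Classification for odd primes -/

section Odd

variable {E : Type*} [Field E] [Algebra ℚ E] {p k : ℕ} {ζ : E} [IsCyclotomicExtension {p ^ k} ℚ E]
  {R : muInf → Submodule ℚ E} {H : Subgroup (E ≃ₐ[ℚ] E)} {m : ℕ} {g : muInf} {x : E}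

theorem pow_eq_or_neg_pow_of_pow_eq_one (hp : p.Prime) (hp2 : p ≠ 2)
    (hζ : IsPrimitiveRoot ζ (p ^ k)) {z : E} (hm : 0 < m) (hz : z ^ m = 1) :
    ∃ r, z = ζ ^ r ∨ z = -ζ ^ r := by
  have : NeZero (p ^ k) := ⟨pow_ne_zero _ hp.ne_zero⟩
  have : CharZero E := algebraRat.charZero E
  -- `NumberField` refers to the canonical `ℚ`-algebra structure; the given one equals it by
  -- uniqueness.
  have e : (inferInstance : Algebra ℚ E) = DivisionRing.toRatAlgebra := Subsingleton.elim _ _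
  have hc : @IsCyclotomicExtension {p ^ k} ℚ E _ _ DivisionRing.toRatAlgebra :=
    e ▸ (inferInstance : IsCyclotomicExtension {p ^ k} ℚ E)
  have : NumberField E :=
    @NumberField.mk E _ _ (@IsCyclotomicExtension.finiteDimensional {p ^ k} ℚ _ E _ _
      DivisionRing.toRatAlgebra _ hc)
  obtain ⟨r, -, hr⟩ := hζ.exists_pow_or_neg_mul_pow_of_isOfFinOrder
    ((hp.odd_of_ne_two hp2).pow) (isOfFinOrder_iff_pow_eq_one.2 ⟨m, hm, hz⟩)
  exact ⟨r, hr⟩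

/-- An involution acts by inversion on roots of unity of odd prime power order. -/
theorem apply_eq_inv_of_sq_eq_one (hp : p.Prime) (hp2 : p ≠ 2)
    (hζ : IsPrimitiveRoot ζ (p ^ k)) {τ : E ≃ₐ[ℚ] E} (hτ : τ ^ 2 = 1) (h1 : τ ≠ 1) :
    τ ζ = ζ⁻¹ := by
  have : NeZero (p ^ k) := ⟨pow_ne_zero _ hp.ne_zero⟩
  have hζ0 : ζ ≠ 0 := hζ.ne_zero (NeZero.ne _)
  obtain ⟨s, -, hs⟩ := exists_pow_eq_apply hζ τ
  have h2 : ζ ^ (s * s) = ζ := by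
    have := DFunLike.congr_fun hτ ζ
    rwa [pow_two, AlgEquiv.mul_apply, hs, map_pow, hs, ← pow_mul, AlgEquiv.one_apply] at this
  have hz : ∀ a : ℤ, ζ ^ a = 1 ↔ (p : ℤ) ^ k ∣ a := fun a => by
    rw [hζ.zpow_eq_one_iff_dvd]; push_cast; rfl
  have h3 : (p : ℤ) ^ k ∣ ((s : ℤ) - 1) * (s + 1) := by
    rw [← hz]
    have : ((s : ℤ) - 1) * (s + 1) = ((s * s : ℕ) : ℤ) - 1 := by push_cast; ring
    rw [this, zpow_sub₀ hζ0, zpow_natCast, h2, zpow_one, div_self hζ0]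
  have hpz : Prime (p : ℤ) := Nat.prime_iff_prime_int.1 hp
  -- An odd prime cannot divide both factors, so all of `p ^ k` divides one of them.
  have hnot : ¬ ((p : ℤ) ∣ (s : ℤ) - 1 ∧ (p : ℤ) ∣ (s : ℤ) + 1) := by
    rintro ⟨ha, hb⟩
    have h := dvd_sub hb ha
    have h2 : (s : ℤ) + 1 - (s - 1) = ((2 : ℕ) : ℤ) := by push_cast; ring
    rw [h2, Int.natCast_dvd_natCast] at h
    exact hp2 ((Nat.prime_dvd_prime_iff_eq hp Nat.prime_two).1 h)
  rcases Classical.not_and_iff_not_or_not.1 hnot with h | h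
  · have h4 := (IsCoprime.pow_left ((Prime.coprime_iff_not_dvd hpz).2 h)).dvd_of_dvd_mul_left h3
    have h5 := (hz _).2 h4
    rw [zpow_add₀ hζ0, zpow_natCast, zpow_one, ← hs] at h5
    exact eq_inv_of_mul_eq_one_left h5
  · have h4 := (IsCoprime.pow_left ((Prime.coprime_iff_not_dvd hpz).2 h)).dvd_of_dvd_mul_right h3
    have h5 := (hz _).2 h4
    rw [zpow_sub₀ hζ0, zpow_natCast, zpow_one, div_eq_one_iff_eq hζ0, ← hs] at h5
    exact absurd (aut_ext hζ (by simpa using h5)) h1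

/-- The gradings of `ℚ(μ_{p^k})` for odd `p`, in terms of homogeneous elements. -/
theorem IsGrading.classification_odd (hp : p.Prime) (hp2 : p ≠ 2)
    (hζ : IsPrimitiveRoot ζ (p ^ k)) (hR : IsGrading R) :
    (∃ g, ζ ∈ R g) ∨ ∃ g, orderOf g = 2 ∧ ζ + ζ⁻¹ ∈ R 1 ∧ ζ - ζ⁻¹ ∈ R g := by
  have : NeZero (p ^ k) := ⟨pow_ne_zero _ hp.ne_zero⟩
  have := IsCyclotomicExtension.finiteDimensional {p ^ k} ℚ E
  have := IsCyclotomicExtension.isGalois {p ^ k} ℚ E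
  have : CharZero E := algebraRat.charZero E
  obtain ⟨H, m, g, x, D⟩ := hR.exists_kummerData
  have hroot : ∀ z : E, z ^ m = 1 → ∃ r, z = ζ ^ r ∨ z = -ζ ^ r := fun z hz =>
    pow_eq_or_neg_pow_of_pow_eq_one hp hp2 hζ D.pos hz
  obtain ⟨z, hz⟩ := D.exists_primitive
  rcases Nat.even_or_odd m with hm | hm
  -- For even `m` the value `-1` belongs to an involution, which must be complex conjugation.
  · obtain ⟨τ, hτ, hτx⟩ := D.exists_aut (-1) hm.neg_one_pow
    rw [neg_one_mul] at hτx
    have hτ2 : τ ^ 2 = 1 := by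
      refine D.eq_one _ (_root_.pow_mem hτ 2) ?_
      rw [pow_two, AlgEquiv.mul_apply, hτx, map_neg, hτx, neg_neg]
    have hτ1 : τ ≠ 1 := by
      rintro rfl
      exact D.ne_zero (self_eq_neg.1 hτx)
    have hτζ := apply_eq_inv_of_sq_eq_one hp hp2 hζ hτ2 hτ1
    have hsq : z ^ 2 = 1 := by
      obtain ⟨σ, hσ, hσx⟩ := D.exists_aut z hz.pow_eq_one
      -- Compare `σ τ` and `τ σ` at `x`. Since `τ` inverts `ζ`, a fixed root of unity squares to
      -- `1`.
      have h1 : τ z = z := by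
        have h := DFunLike.congr_fun (aut_comm hζ σ τ) x
        rw [AlgEquiv.mul_apply, AlgEquiv.mul_apply, hτx, map_neg, hσx, map_mul, hτx, mul_neg,
          neg_inj] at h
        exact (mul_right_cancel₀ D.ne_zero h).symm
      obtain ⟨r, hr⟩ := hroot z hz.pow_eq_one
      have h2 : (ζ ^ r)⁻¹ = ζ ^ r := by
        rcases hr with rfl | rfl <;> simpa [hτζ] using h1
      have h0 : ζ ^ r ≠ 0 := pow_ne_zero _ (hζ.ne_zero (NeZero.ne _))
      have h3 : (ζ ^ r) ^ 2 = 1 := by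
        rw [pow_two]; nth_rw 1 [← h2]; exact inv_mul_cancel₀ h0
      rcases hr with rfl | rfl
      · exact h3
      · rw [neg_sq]; exact h3
    have hm2 : m = 2 :=
      le_antisymm (Nat.le_of_dvd two_pos (hz.dvd_of_pow_eq_one _ hsq))
        (by obtain ⟨a, ha⟩ := hm; have := D.pos; omega)
    subst hm2
    refine Or.inr ⟨g, D.orderOf_eq, ?_, ?_⟩
    all_goals
      have hcases : ∀ σ ∈ H, ∀ w : E, σ x = w * x → (w = 1 ∧ σ = 1) ∨ (w = -1 ∧ σ = τ) := by
        intro σ hσ w hw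
        obtain ⟨w', hw'1, hw'2⟩ := D.exists_root σ hσ
        obtain rfl := mul_right_cancel₀ D.ne_zero (hw.symm.trans hw'2)
        rcases sq_eq_one_iff.1 hw'1 with rfl | rfl
        · exact Or.inl ⟨rfl, D.eq_one σ hσ (by simpa using hw)⟩
        · exact Or.inr ⟨rfl, D.eq_of_apply_eq hσ hτ (by rw [hw, hτx, neg_one_mul])⟩
    · have := D.mem_of 0 (ζ + ζ⁻¹) fun σ hσ w hw => by
        rcases hcases σ hσ w hw with ⟨rfl, rfl⟩ | ⟨rfl, rfl⟩
        · simp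
        · simp [hτζ, add_comm]
      simpa using this
    · have := D.mem_of 1 (ζ - ζ⁻¹) fun σ hσ w hw => by
        rcases hcases σ hσ w hw with ⟨rfl, rfl⟩ | ⟨rfl, rfl⟩
        · simp
        · simp [hτζ]
      simpa using this
  · left
    have hmp : m ∣ p ^ k := by
      -- Every root of unity `±ζ ^ r` is killed by `2 p ^ k`, and here `m` is odd.
      have h1 : z ^ (2 * p ^ k) = 1 := by
        obtain ⟨r, hr⟩ := hroot z hz.pow_eq_one
        have h2 : (ζ ^ r) ^ p ^ k = 1 := by
          rw [← pow_mul, mul_comm, pow_mul, hζ.pow_eq_one, one_pow]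
        rcases hr with rfl | rfl
        · rw [pow_mul', h2, one_pow]
        · rw [pow_mul, neg_sq, ← pow_mul, pow_mul', h2, one_pow]
      exact (Nat.Coprime.symm (Nat.coprime_two_left.2 hm)).dvd_of_dvd_mul_left
        (hz.dvd_of_pow_eq_one _ h1)
    obtain ⟨n, hn⟩ := D.exists_mem_of_forall_modEq hp hζ hmp fun σ hσ => by
      obtain ⟨s, -, hs⟩ := exists_pow_eq_apply hζ σ
      -- For `k = 0` a congruence modulo `p ^ k` carries no information, but `ζ = 1` allows the
      -- exponent `1`.
      rcases Nat.eq_zero_or_pos k with rfl | hk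
      · refine ⟨1, rfl, fun h => absurd h hp2, ?_⟩
        have : ζ = 1 := by simpa using hζ.pow_eq_one
        simp [this]
      refine ⟨s, ?_, fun h => absurd h hp2, hs⟩
      have h1 : σ ^ m = 1 := by
        have := pow_card_eq_one' (x := (⟨σ, hσ⟩ : H))
        rw [D.card_eq] at this
        exact congrArg Subtype.val this
      obtain ⟨j, -, rfl⟩ := (Nat.dvd_prime_pow hp).1 hmp
      have h2 : ∀ a, (σ ^ a) ζ = ζ ^ s ^ a := by
        intro a
        induction a with
        | zero => simp
        | succ a ih => rw [pow_succ, AlgEquiv.mul_apply, hs, map_pow, ih, ← pow_mul, pow_succ]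
      have h3 := h2 (p ^ j)
      rw [h1, AlgEquiv.one_apply] at h3
      have h4 : s ^ p ^ j ≡ 1 [MOD p ^ k] := by
        have h5 : ζ ^ s ^ p ^ j = ζ ^ 1 := by rw [← h3, pow_one]
        rw [(hζ.isOfFinOrder (NeZero.ne _)).pow_eq_pow_iff_modEq, ← hζ.eq_orderOf] at h5
        exact h5
      -- Fermat: `s ^ p ^ j = s` modulo `p`.
      have h5 := (h4.of_dvd (dvd_pow_self p hk.ne'))
      have := Fact.mk hp
      rw [← ZMod.natCast_eq_natCast_iff, Nat.cast_pow, ZMod.pow_card_pow] at h5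
      exact (ZMod.natCast_eq_natCast_iff _ _ _).1 h5
    exact ⟨_, hn⟩

end Odd

end CyclotomicGradings
namespace CyclotomicGradings

/-! ### Involutions of 2-power cyclotomic fields -/

section Two

variable {E : Type*} [Field E] [Algebra ℚ E] {k : ℕ} {ζ : E} [IsCyclotomicExtension {2 ^ k} ℚ E]
  {R : muInf → Submodule ℚ E} {H : Subgroup (E ≃ₐ[ℚ] E)} {m : ℕ} {g : muInf} {x : E}

omit [IsCyclotomicExtension {2 ^ k} ℚ E] [Algebra ℚ E] in
theorem pow_two_pow_eq_neg_one (hk : 1 ≤ k) (hζ : IsPrimitiveRoot ζ (2 ^ k)) :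
    ζ ^ 2 ^ (k - 1) = -1 := by
  have h := hζ.pow (pow_pos two_pos k) (a := 2 ^ (k - 1)) (b := 2)
    (by rw [← pow_succ, Nat.sub_add_cancel hk])
  exact h.eq_neg_one_of_two_right

omit [IsCyclotomicExtension {2 ^ k} ℚ E] [Algebra ℚ E] in
theorem sq_pow_two_pow_eq_neg_one (hk : 2 ≤ k) (hζ : IsPrimitiveRoot ζ (2 ^ k)) :
    (ζ ^ 2 ^ (k - 2)) ^ 2 = -1 := by
  rw [← pow_mul, ← pow_succ, show k - 2 + 1 = k - 1 by omega]
  exact pow_two_pow_eq_neg_one (by omega) hζ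

omit [IsCyclotomicExtension {2 ^ k} ℚ E] in
/-- An automorphism fixes `√-1` if and only if its exponent is `1` modulo `4`. -/
theorem exists_exponent (hk : 2 ≤ k) (hζ : IsPrimitiveRoot ζ (2 ^ k)) (σ : E ≃ₐ[ℚ] E) :
    (σ (ζ ^ 2 ^ (k - 2)) = ζ ^ 2 ^ (k - 2) ∧ ∃ s : ℕ, s ≡ 1 [MOD 4] ∧ σ ζ = ζ ^ s) ∨
    (σ (ζ ^ 2 ^ (k - 2)) = -ζ ^ 2 ^ (k - 2) ∧ ∃ s : ℕ, s ≡ 3 [MOD 4] ∧ σ ζ = ζ ^ s) := by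
  have : NeZero (2 ^ k) := ⟨by positivity⟩
  obtain ⟨s, hsc, hs⟩ := exists_pow_eq_apply hζ σ
  have h2 := sq_pow_two_pow_eq_neg_one hk hζ
  have hodd : ¬ 2 ∣ s := fun h => by
    have := (Nat.Coprime.coprime_dvd_left h hsc).coprime_dvd_right (dvd_pow_self 2 (by omega))
    simp at this
  have hi : σ (ζ ^ 2 ^ (k - 2)) = (ζ ^ 2 ^ (k - 2)) ^ s := by
    rw [map_pow, hs, ← pow_mul, ← pow_mul, mul_comm]
  generalize ζ ^ 2 ^ (k - 2) = i at h2 hi ⊢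
  have h4 : i ^ 4 = 1 := by rw [show 4 = 2 * 2 from rfl, pow_mul, h2]; norm_num
  have hmod : i ^ s = i ^ (s % 4) := by
    conv_lhs => rw [← Nat.mod_add_div s 4, pow_add, pow_mul, h4, one_pow, mul_one]
  have : s % 4 = 1 ∨ s % 4 = 3 := by omega
  rcases this with h | h
  · exact Or.inl ⟨by rw [hi, hmod, h, pow_one], s, h, hs⟩
  · exact Or.inr ⟨by rw [hi, hmod, h, pow_succ, h2, neg_one_mul], s, h, hs⟩

omit [Algebra ℚ E] [IsCyclotomicExtension {2 ^ k} ℚ E] in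
theorem ne_neg_self_of_sq_eq_neg_one [CharZero E] {i : E} (h : i ^ 2 = -1) : i ≠ -i := by
  intro h1
  have h0 : i = 0 := self_eq_neg.1 h1
  rw [h0] at h
  norm_num at h

omit [IsCyclotomicExtension {2 ^ k} ℚ E] in
-- From `τ ^ 2 = 1` the ratio `w = τ ζ / ζ` satisfies `w ^ (1 + s) = 1`, which for `s ≡ 1` mod 4 is
-- equivalent to `w ^ 2 = 1`.
theorem apply_eq_or_eq_neg_of_sq_eq_one (hζ : IsPrimitiveRoot ζ (2 ^ k)) {τ : E ≃ₐ[ℚ] E}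
    (hτ : τ ^ 2 = 1) {s : ℕ} (hs : s ≡ 1 [MOD 4]) (h : τ ζ = ζ ^ s) : τ ζ = ζ ∨ τ ζ = -ζ := by
  have : NeZero (2 ^ k) := ⟨by positivity⟩
  have hs0 : 0 < s := by
    rcases Nat.eq_zero_or_pos s with rfl | h
    · exact absurd hs (by decide)
    · exact h
  have hw : τ ζ = ζ ^ (s - 1) * ζ := by rw [← pow_succ, Nat.sub_add_cancel hs0, h]
  have hwq : (ζ ^ (s - 1)) ^ 2 ^ k = 1 := by
    rw [← pow_mul, mul_comm, pow_mul, hζ.pow_eq_one, one_pow]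
  have h1 := aut_pow_apply hw (apply_eq_pow hζ h hwq) 2
  rw [hτ, AlgEquiv.one_apply] at h1
  have h2 := (mul_eq_right₀ (hζ.ne_zero (NeZero.ne _))).1 h1.symm
  rw [pow_geom_sum_eq_one_iff Nat.prime_two (hs.of_dvd (by norm_num)) (fun _ => hs) hwq,
    sq_eq_one_iff] at h2
  rcases h2 with h2 | h2
  · left; rw [hw, h2, one_mul]
  · right; rw [hw, h2, neg_one_mul]

omit [IsCyclotomicExtension {2 ^ k} ℚ E] in
-- The product `w = τ ζ * ζ` is fixed by `τ`, so `w ^ (s - 1) = 1`. As `w` has 2-power order and `s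
-- - 1 ≡ 2` mod 4, `w = ±1`.
theorem apply_eq_inv_or_eq_neg_inv_of_sq_eq_one (hζ : IsPrimitiveRoot ζ (2 ^ k))
    {τ : E ≃ₐ[ℚ] E} (hτ : τ ^ 2 = 1) {s : ℕ} (hs : s ≡ 3 [MOD 4]) (h : τ ζ = ζ ^ s) :
    τ ζ = ζ⁻¹ ∨ τ ζ = -ζ⁻¹ := by
  have : NeZero (2 ^ k) := ⟨by positivity⟩
  have hζ0 : ζ ≠ 0 := hζ.ne_zero (NeZero.ne _)
  set w := ζ ^ (s + 1) with hw
  have hw' : τ ζ = w * ζ⁻¹ := by rw [h, hw, pow_succ, mul_inv_cancel_right₀ hζ0]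
  have hwq : w ^ 2 ^ k = 1 := by
    rw [hw, ← pow_mul, mul_comm, pow_mul, hζ.pow_eq_one, one_pow]
  have h1 : τ w = w := by
    have h2 := DFunLike.congr_fun hτ ζ
    rw [pow_two, AlgEquiv.mul_apply, AlgEquiv.one_apply] at h2
    have : w = τ ζ * ζ := by rw [h, hw, pow_succ]
    rw [this, map_mul, h2, mul_comm]
  have hw0 : w ≠ 0 := pow_ne_zero _ hζ0
  have h3 : w ^ (s - 1) = 1 := by
    rw [apply_eq_pow hζ h hwq] at h1
    have hs0 : s - 1 + 1 = s := Nat.sub_add_cancel (by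
      rcases Nat.eq_zero_or_pos s with rfl | h
      · exact absurd hs (by decide)
      · exact h)
    rw [← hs0, pow_succ] at h1
    exact (mul_eq_right₀ hw0).1 h1
  have h4 : w ^ 2 = 1 := by
    rw [← orderOf_dvd_iff_pow_eq_one]
    obtain ⟨r, -, hr⟩ := (Nat.dvd_prime_pow Nat.prime_two).1 (orderOf_dvd_of_pow_eq_one hwq)
    have h5 := orderOf_dvd_of_pow_eq_one h3
    rw [hr] at h5 ⊢
    have hr1 : r ≤ 1 := by
      by_contra hr1
      have h6 : 2 ^ 2 ∣ s - 1 := (pow_dvd_pow 2 (by omega)).trans h5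
      have : s % 4 = 3 := hs
      omega
    simpa using pow_dvd_pow 2 hr1
  rcases sq_eq_one_iff.1 h4 with h5 | h5
  · left; rw [hw', h5, one_mul]
  · right; rw [hw', h5, neg_one_mul]

theorem KummerData.dvd_two_pow (hk : 1 ≤ k) (D : KummerData R H m g x) : m ∣ 2 ^ (k - 1) := by
  have := IsCyclotomicExtension.finiteDimensional {2 ^ k} ℚ E
  have := IsCyclotomicExtension.isGalois {2 ^ k} ℚ E
  have : NeZero (2 ^ k) := ⟨by positivity⟩
  have h := Subgroup.card_subgroup_dvd_card H
  rw [D.card_eq, IsGalois.card_aut_eq_finrank, IsCyclotomicExtension.finrank (n := 2 ^ k) E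
    (Polynomial.cyclotomic.irreducible_rat (NeZero.pos _)),
    Nat.totient_prime_pow Nat.prime_two hk] at h
  simpa using h

end Two

end CyclotomicGradings
namespace CyclotomicGradings

/-! ### Structure of groups moving √-1 -/

section Noncyclic

variable {E : Type*} [Field E] [Algebra ℚ E] {k : ℕ} {ζ : E} [IsCyclotomicExtension {2 ^ k} ℚ E]
  {R : muInf → Submodule ℚ E} {H : Subgroup (E ≃ₐ[ℚ] E)} {m : ℕ} {g : muInf} {x : E}

/-- The automorphism attached to a primitive root of unity, if it fixes `√-1`, generates. -/
theorem KummerData.orderOf_aut_two (hk : 2 ≤ k) (hζ : IsPrimitiveRoot ζ (2 ^ k))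
    (D : KummerData R H m g x) {σ : E ≃ₐ[ℚ] E} (hσ : σ ∈ H) {w : E} (hw : w ^ m = 1)
    (hx : σ x = w * x) (hi : σ (ζ ^ 2 ^ (k - 2)) = ζ ^ 2 ^ (k - 2)) :
    orderOf σ = orderOf w := by
  have : NeZero (2 ^ k) := ⟨by positivity⟩
  have : CharZero E := algebraRat.charZero E
  have hwq : w ^ 2 ^ k = 1 := by
    obtain ⟨c, hc⟩ := (D.dvd_two_pow (k := k) (by omega)).trans
      (pow_dvd_pow 2 (Nat.sub_le k 1))
    rw [hc, pow_mul, hw, one_pow]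
  rcases exists_exponent hk hζ σ with ⟨-, s, hs, h⟩ | ⟨h, -⟩
  · exact D.orderOf_aut Nat.prime_two (hs.of_dvd (by norm_num)) (fun _ => hs) hσ hwq hx
      (apply_eq_pow hζ h hwq)
  · exact absurd (hi.symm.trans h)
      (ne_neg_self_of_sq_eq_neg_one (sq_pow_two_pow_eq_neg_one hk hζ))

omit [IsCyclotomicExtension {2 ^ k} ℚ E] in
theorem pow_apply_eq_self {σ : E ≃ₐ[ℚ] E} {y : E} (h : σ y = y) (a : ℕ) : (σ ^ a) y = y := by
  induction a with
  | zero => simp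
  | succ a ih => rw [pow_succ, AlgEquiv.mul_apply, h, ih]

omit [IsCyclotomicExtension {2 ^ k} ℚ E] in
-- An element of order `m = |H|` generates `H`; if it fixed `y`, so would `ρ`.
theorem KummerData.apply_eq_of_primitive
    (D : KummerData R H m g x) {y : E} {σ ρ : E ≃ₐ[ℚ] E} (hσ : σ ∈ H) (hρ : ρ ∈ H)
    (hρi : ρ y ≠ y) (hord : orderOf σ = m) : σ y ≠ y := by
  intro hi
  have := D.finite
  have htop : Subgroup.zpowers σ = H := by
    refine Subgroup.eq_of_le_of_card_ge (Subgroup.zpowers_le.2 hσ) ?_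
    rw [Nat.card_zpowers, hord, D.card_eq]
  have hfin : IsOfFinOrder σ := orderOf_pos_iff.1 (hord ▸ D.pos)
  rw [← htop, ← hfin.mem_powers_iff_mem_zpowers] at hρ
  obtain ⟨a, rfl⟩ := hρ
  exact hρi (pow_apply_eq_self hi a)

/-- If `H` does not fix `√-1`, the automorphisms attached to non-primitive roots of unity do. -/
theorem KummerData.apply_eq_of_pow_eq_one (hk : 2 ≤ k) (hζ : IsPrimitiveRoot ζ (2 ^ k)) {j : ℕ}
    (D : KummerData R H (2 ^ (j + 2)) g x) {ρ : E ≃ₐ[ℚ] E} (hρ : ρ ∈ H)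
    (hρi : ρ (ζ ^ 2 ^ (k - 2)) ≠ ζ ^ 2 ^ (k - 2)) {σ : E ≃ₐ[ℚ] E} (hσ : σ ∈ H) {w : E}
    (hw : w ^ 2 ^ (j + 1) = 1) (hx : σ x = w * x) :
    σ (ζ ^ 2 ^ (k - 2)) = ζ ^ 2 ^ (k - 2) := by
  have : NeZero (2 ^ k) := ⟨by positivity⟩
  have hm := (D.dvd_two_pow (k := k) (by omega)).trans (pow_dvd_pow 2 (Nat.sub_le k 1))
  obtain ⟨z, hz⟩ := D.exists_primitive
  obtain ⟨ρ', hρ', hρx⟩ := D.exists_aut z hz.pow_eq_one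
  -- An automorphism with primitive value that fixed √-1 would have order `m` and generate `H`.
  have hz' : ∀ σ ∈ H, ∀ z, IsPrimitiveRoot z (2 ^ (j + 2)) → σ x = z * x →
      σ (ζ ^ 2 ^ (k - 2)) = -ζ ^ 2 ^ (k - 2) := by
    intro σ hσ z hz hx
    rcases exists_exponent hk hζ σ with ⟨h, -⟩ | ⟨h, -⟩
    · have := D.orderOf_aut_two hk hζ hσ hz.pow_eq_one hx h
      rw [← hz.eq_orderOf] at this
      exact absurd h (D.apply_eq_of_primitive hσ hρ hρi this)
    · exact h
  rcases exists_exponent hk hζ σ with ⟨h, -⟩ | ⟨h, -⟩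
  · exact h
  exfalso
  obtain ⟨s, -, hs⟩ := exists_pow_eq_apply hζ ρ'
  have h2 : IsPrimitiveRoot (z ^ 2) (2 ^ (j + 1)) :=
    hz.pow (by positivity) (by rw [pow_succ'])
  obtain ⟨t, -, ht⟩ := h2.eq_pow_of_pow_eq_one hw
  -- Suppose `σ` negates √-1. The value of `ρ' * σ` is an odd power of `z`, hence primitive, so `ρ'
  -- * σ` negates √-1; yet it is a product of two negations.
  have hprod : (ρ' * σ) x = z ^ (2 * (t * s) + 1) * x := by
    have hwz : ρ' w = z ^ (2 * (t * s)) := by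
      rw [← ht, map_pow, map_pow, apply_eq_pow hζ hs ((hz.pow_eq_one_iff_dvd _).2 hm)]
      ring
    rw [AlgEquiv.mul_apply, hx, map_mul, hwz, hρx]
    ring
  have hpr : IsPrimitiveRoot (z ^ (2 * (t * s) + 1)) (2 ^ (j + 2)) :=
    hz.pow_of_coprime _ (Nat.Coprime.pow_right _ (by simp))
  have h3 := hz' _ (mul_mem hρ' hσ) _ hpr hprod
  rw [AlgEquiv.mul_apply, h, map_neg, hz' ρ' hρ' z hz hρx, neg_neg] at h3
  have : CharZero E := algebraRat.charZero E
  exact ne_neg_self_of_sq_eq_neg_one (sq_pow_two_pow_eq_neg_one hk hζ) h3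

/-- The stabiliser of √-1 in `H` is a proper subgroup, so its order is at most `2 ^ (j + 1)`; `σ`
lies in it and has exactly this order. -/
theorem KummerData.mem_powers_of_apply_eq (hk : 2 ≤ k) (hζ : IsPrimitiveRoot ζ (2 ^ k)) {j : ℕ}
    (D : KummerData R H (2 ^ (j + 2)) g x) {ρ : E ≃ₐ[ℚ] E} (hρ : ρ ∈ H)
    (hρi : ρ (ζ ^ 2 ^ (k - 2)) ≠ ζ ^ 2 ^ (k - 2)) {σ : E ≃ₐ[ℚ] E} (hσ : σ ∈ H) {w : E}
    (hw : IsPrimitiveRoot w (2 ^ (j + 1))) (hx : σ x = w * x) {h : E ≃ₐ[ℚ] E} (hh : h ∈ H)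
    (hi : h (ζ ^ 2 ^ (k - 2)) = ζ ^ 2 ^ (k - 2)) : ∃ a : ℕ, h = σ ^ a := by
  have := D.finite
  set H' : Subgroup (E ≃ₐ[ℚ] E) :=
    H ⊓ MulAction.stabilizer (E ≃ₐ[ℚ] E) (ζ ^ 2 ^ (k - 2)) with hH'
  have hmem : ∀ h : E ≃ₐ[ℚ] E, h ∈ H' ↔ h ∈ H ∧ h (ζ ^ 2 ^ (k - 2)) = ζ ^ 2 ^ (k - 2) :=
    fun h => Iff.rfl
  have hσi := D.apply_eq_of_pow_eq_one hk hζ hρ hρi hσ hw.pow_eq_one hx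
  have hord : orderOf σ = 2 ^ (j + 1) := by
    rw [hw.eq_orderOf]
    refine D.orderOf_aut_two hk hζ hσ ?_ hx hσi
    rw [pow_succ 2 (j + 1), pow_mul, hw.pow_eq_one, one_pow]
  have hfin : IsOfFinOrder σ := orderOf_pos_iff.1 (by rw [hord]; positivity)
  have hle : H' ≤ H := inf_le_left
  have hfin' : Finite H' := Finite.of_injective _ (Subgroup.inclusion_injective hle)
  have hcard : Nat.card H' ≤ 2 ^ (j + 1) := by
    have hd := Subgroup.card_dvd_of_le hle
    rw [D.card_eq] at hd
    obtain ⟨r, hr, hr'⟩ := (Nat.dvd_prime_pow Nat.prime_two).1 hd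
    rw [hr']
    refine Nat.pow_le_pow_right two_pos ?_
    by_contra hlt
    have hr2 : r = j + 2 := by omega
    have : H' = H := Subgroup.eq_of_le_of_card_ge hle (by rw [hr', hr2, D.card_eq])
    rw [← this] at hρ
    exact hρi ((hmem ρ).1 hρ).2
  have htop : Subgroup.zpowers σ = H' := by
    refine Subgroup.eq_of_le_of_card_ge (Subgroup.zpowers_le.2 ((hmem σ).2 ⟨hσ, hσi⟩)) ?_
    rw [Nat.card_zpowers, hord]
    exact hcard
  have h1 : h ∈ Subgroup.zpowers σ := by rw [htop]; exact (hmem h).2 ⟨hh, hi⟩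
  rw [← hfin.mem_powers_iff_mem_zpowers] at h1
  obtain ⟨a, ha⟩ := h1
  exact ⟨a, ha.symm⟩

/-- The automorphism with value `-1` is a nontrivial involution fixing √-1, which leaves only `ζ ↦
-ζ`. -/
theorem KummerData.exists_neg (hk : 2 ≤ k) (hζ : IsPrimitiveRoot ζ (2 ^ k)) {j : ℕ}
    (D : KummerData R H (2 ^ (j + 2)) g x) {ρ : E ≃ₐ[ℚ] E} (hρ : ρ ∈ H)
    (hρi : ρ (ζ ^ 2 ^ (k - 2)) ≠ ζ ^ 2 ^ (k - 2)) : ∃ τ ∈ H, τ x = -1 * x ∧ τ ζ = -ζ := by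
  have : CharZero E := algebraRat.charZero E
  have he : (-1 : E) ^ 2 ^ (j + 1) = 1 := by
    rw [pow_succ', pow_mul, neg_one_sq, one_pow]
  obtain ⟨τ, hτ, hx⟩ := D.exists_aut (-1) (by
    rw [pow_succ, pow_mul, he, one_pow])
  refine ⟨τ, hτ, hx, ?_⟩
  have hτi := D.apply_eq_of_pow_eq_one hk hζ hρ hρi hτ he hx
  have hτ2 : τ ^ 2 = 1 := by
    refine D.eq_one _ (_root_.pow_mem hτ 2) ?_
    rw [pow_two, AlgEquiv.mul_apply, hx, map_mul, hx, map_neg, map_one]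
    ring
  have : NeZero (2 ^ k) := ⟨by positivity⟩
  rcases exists_exponent hk hζ τ with ⟨-, s, hs, h⟩ | ⟨h, -⟩
  · rcases apply_eq_or_eq_neg_of_sq_eq_one hζ hτ2 hs h with h1 | h1
    · have : τ = 1 := aut_ext hζ (by simpa using h1)
      subst this
      rw [AlgEquiv.one_apply, neg_one_mul] at hx
      exact absurd (self_eq_neg.1 hx) D.ne_zero
    · exact h1
  · exact absurd (hτi.symm.trans h)
      (ne_neg_self_of_sq_eq_neg_one (sq_pow_two_pow_eq_neg_one hk hζ))

/-- If `H` does not fix `√-1`, it contains complex conjugation, and the root of unity attached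
to the latter is primitive. -/
theorem KummerData.exists_conj (hk : 2 ≤ k) (hζ : IsPrimitiveRoot ζ (2 ^ k)) {j : ℕ}
    (D : KummerData R H (2 ^ (j + 2)) g x) {ρ : E ≃ₐ[ℚ] E} (hρ : ρ ∈ H)
    (hρi : ρ (ζ ^ 2 ^ (k - 2)) ≠ ζ ^ 2 ^ (k - 2)) :
    ∃ κ ∈ H, κ ζ = ζ⁻¹ ∧ κ (ζ ^ 2 ^ (k - 2)) = -ζ ^ 2 ^ (k - 2) ∧
      ∃ η, IsPrimitiveRoot η (2 ^ (j + 2)) ∧ κ x = η * x := by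
  have : NeZero (2 ^ k) := ⟨by positivity⟩
  have : CharZero E := algebraRat.charZero E
  have hi2 := sq_pow_two_pow_eq_neg_one hk hζ
  have hneg := ne_neg_self_of_sq_eq_neg_one hi2
  have hm := (D.dvd_two_pow (k := k) (by omega)).trans (pow_dvd_pow 2 (Nat.sub_le k 1))
  have hprim : ∀ κ ∈ H, κ (ζ ^ 2 ^ (k - 2)) = -ζ ^ 2 ^ (k - 2) →
      ∃ η, IsPrimitiveRoot η (2 ^ (j + 2)) ∧ κ x = η * x := by
    intro κ hκ hκi
    obtain ⟨η, hη, hx⟩ := D.exists_root κ hκ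
    refine ⟨η, ?_, hx⟩
    refine IsPrimitiveRoot.iff_orderOf.2 (orderOf_eq_prime_pow ?_ hη)
    intro h
    exact hneg ((D.apply_eq_of_pow_eq_one hk hζ hρ hρi hκ h hx).symm.trans hκi)
  obtain ⟨τ, hτ, hτx, hτζ⟩ := D.exists_neg hk hζ hρ hρi
  obtain ⟨z, hz⟩ := D.exists_primitive
  have hρneg : ρ (ζ ^ 2 ^ (k - 2)) = -ζ ^ 2 ^ (k - 2) := by
    rcases exists_exponent hk hζ ρ with ⟨h, -⟩ | ⟨h, -⟩
    · exact absurd h hρi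
    · exact h
  obtain ⟨z, hz, hρx⟩ := hprim ρ hρ hρneg
  have hzq : z ^ 2 ^ k = 1 := (hz.pow_eq_one_iff_dvd _).2 hm
  have hz2 : IsPrimitiveRoot (z ^ 2) (2 ^ (j + 1)) :=
    hz.pow (by positivity) (by rw [pow_succ'])
  have hz2q : (z ^ 2) ^ 2 ^ k = 1 := by rw [← pow_mul, mul_comm, pow_mul, hzq, one_pow]
  obtain ⟨σ, hσ, hσx⟩ := D.exists_aut (z ^ 2) (by
    rw [← pow_mul, mul_comm, pow_mul, hz.pow_eq_one, one_pow])
  have hσi := D.apply_eq_of_pow_eq_one hk hζ hρ hρi hσ hz2.pow_eq_one hσx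
  obtain ⟨a, ha⟩ := D.mem_powers_of_apply_eq hk hζ hρ hρi hσ hz2 hσx (_root_.pow_mem hρ 2) (by
    rw [pow_two, AlgEquiv.mul_apply, hρneg, map_neg, hρneg, neg_neg])
  obtain ⟨s, hs, hρζ⟩ : ∃ s : ℕ, s ≡ 3 [MOD 4] ∧ ρ ζ = ζ ^ s := by
    rcases exists_exponent hk hζ ρ with ⟨h, -⟩ | ⟨-, h⟩
    · exact absurd h hρi
    · exact h
  obtain ⟨t, ht, hσζ⟩ : ∃ t : ℕ, t ≡ 1 [MOD 4] ∧ σ ζ = ζ ^ t := by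
    rcases exists_exponent hk hζ σ with ⟨-, h⟩ | ⟨h, -⟩
    · exact h
    · exact absurd (hσi.symm.trans h) hneg
  -- Compare exponents of `z` in `ρ ^ 2 = σ ^ a` modulo 4: twice a sum of the parity of `a` is
  -- congruent to `1 + s ≡ 0`.
  have ha2 : 2 ∣ a := by
    have h1 := aut_pow_apply hρx (apply_eq_pow hζ hρζ hzq) 2
    rw [ha, aut_pow_apply hσx (apply_eq_pow hζ hσζ hz2q), ← pow_mul] at h1
    have h2 := mul_right_cancel₀ D.ne_zero h1
    rw [(hz.isOfFinOrder (by positivity)).pow_eq_pow_iff_modEq, ← hz.eq_orderOf] at h2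
    have h3 : 2 * ∑ i ∈ Finset.range a, t ^ i ≡ ∑ i ∈ Finset.range 2, s ^ i [MOD 4] :=
      h2.of_dvd ⟨2 ^ j, by rw [pow_add, mul_comm]; norm_num⟩
    have h4 := prime_pow_dvd_geom_sum_iff Nat.prime_two (s := t) (ht.of_dvd (by norm_num))
      (fun _ => ht) 1 a
    rw [pow_one] at h4
    rw [← h4]
    have hs' : s % 4 = 3 := hs
    rw [Nat.ModEq, Finset.sum_range_succ, Finset.sum_range_one, pow_zero, pow_one] at h3
    omega
  obtain ⟨b, rfl⟩ := ha2
  -- Since `ρ ^ 2 = (σ ^ b) ^ 2` in a commutative group, this quotient is an involution.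
  set κ := ρ * (σ ^ b)⁻¹ with hκ
  have hκH : κ ∈ H := mul_mem hρ (inv_mem (_root_.pow_mem hσ b))
  have hσbi : (σ ^ b)⁻¹ (ζ ^ 2 ^ (k - 2)) = ζ ^ 2 ^ (k - 2) := by
    have h1 := pow_apply_eq_self hσi b
    nth_rw 1 [← h1]
    rw [← AlgEquiv.mul_apply, inv_mul_cancel, AlgEquiv.one_apply]
  have hκi : κ (ζ ^ 2 ^ (k - 2)) = -ζ ^ 2 ^ (k - 2) := by
    rw [hκ, AlgEquiv.mul_apply, hσbi, hρneg]
  have hκ2 : κ ^ 2 = 1 := by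
    have hc : Commute ρ (σ ^ b)⁻¹ := aut_comm hζ _ _
    rw [hκ, hc.mul_pow, ha, mul_comm 2 b, pow_mul, inv_pow, mul_inv_cancel]
  obtain ⟨u, hu, hκζ⟩ : ∃ u : ℕ, u ≡ 3 [MOD 4] ∧ κ ζ = ζ ^ u := by
    rcases exists_exponent hk hζ κ with ⟨h, -⟩ | ⟨-, h⟩
    · exact absurd (h.symm.trans hκi) hneg
    · exact h
  rcases apply_eq_inv_or_eq_neg_inv_of_sq_eq_one hζ hκ2 hu hκζ with h | h
  · exact ⟨κ, hκH, h, hκi, hprim κ hκH hκi⟩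
  -- The involution `ζ ↦ -ζ⁻¹` becomes complex conjugation after composition with `τ`.
  · have hτi : τ (ζ ^ 2 ^ (k - 2)) = ζ ^ 2 ^ (k - 2) :=
      D.apply_eq_of_pow_eq_one hk hζ hρ hρi hτ (by
        rw [pow_succ', pow_mul, neg_one_sq, one_pow]) hτx
    have h1 : (κ * τ) (ζ ^ 2 ^ (k - 2)) = -ζ ^ 2 ^ (k - 2) := by
      rw [AlgEquiv.mul_apply, hτi, hκi]
    exact ⟨κ * τ, mul_mem hκH hτ, by rw [AlgEquiv.mul_apply, hτζ, map_neg, h, neg_neg], h1,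
      hprim _ (mul_mem hκH hτ) h1⟩

end Noncyclic

end CyclotomicGradings
namespace CyclotomicGradings

/-! ### Homogeneous elements for groups moving √-1 -/

section Noncyclic

variable {E : Type*} [Field E] [Algebra ℚ E] {k : ℕ} {ζ ζ₈ : E}
  [IsCyclotomicExtension {2 ^ k} ℚ E]
  {R : muInf → Submodule ℚ E} {H : Subgroup (E ≃ₐ[ℚ] E)} {m : ℕ} {g : muInf} {x : E}

/-- Elements of `H` fixing √-1 are powers of `σ`, and multiplication by `κ` carries the others to
these. -/
theorem KummerData.mem_closure_of_conj (hk : 2 ≤ k) (hζ : IsPrimitiveRoot ζ (2 ^ k)) {j : ℕ}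
    (D : KummerData R H (2 ^ (j + 2)) g x) {κ : E ≃ₐ[ℚ] E} (hκ : κ ∈ H) (hκζ : κ ζ = ζ⁻¹)
    (hκi : κ (ζ ^ 2 ^ (k - 2)) = -ζ ^ 2 ^ (k - 2)) {σ : E ≃ₐ[ℚ] E} (hσ : σ ∈ H) {w : E}
    (hw : IsPrimitiveRoot w (2 ^ (j + 1))) (hx : σ x = w * x) {h : E ≃ₐ[ℚ] E} (hh : h ∈ H) :
    h ∈ Submonoid.closure {κ, σ} := by
  have : CharZero E := algebraRat.charZero E
  have : NeZero (2 ^ k) := ⟨by positivity⟩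
  have hneg := ne_neg_self_of_sq_eq_neg_one (sq_pow_two_pow_eq_neg_one hk hζ)
  have hκi' : κ (ζ ^ 2 ^ (k - 2)) ≠ ζ ^ 2 ^ (k - 2) := fun h => hneg (h.symm.trans hκi)
  have hκκ : κ * κ = 1 := aut_ext hζ (by
    rw [AlgEquiv.mul_apply, hκζ, map_inv₀, hκζ, inv_inv, AlgEquiv.one_apply])
  have hκm : κ ∈ Submonoid.closure {κ, σ} := Submonoid.subset_closure (by simp)
  have hσm : σ ∈ Submonoid.closure {κ, σ} := Submonoid.subset_closure (by simp)
  rcases exists_exponent hk hζ h with ⟨hi, -⟩ | ⟨hi, -⟩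
  · obtain ⟨a, rfl⟩ := D.mem_powers_of_apply_eq hk hζ hκ hκi' hσ hw hx hh hi
    exact _root_.pow_mem hσm a
  · obtain ⟨a, ha⟩ := D.mem_powers_of_apply_eq hk hζ hκ hκi' hσ hw hx (mul_mem hκ hh)
      (by rw [AlgEquiv.mul_apply, hi, map_neg, hκi, neg_neg])
    have : h = κ * σ ^ a := by rw [← ha, ← mul_assoc, hκκ, one_mul]
    rw [this]
    exact mul_mem hκm (_root_.pow_mem hσm a)

/-- A noncyclic group of order four. -/
theorem KummerData.mem_of_card_eq_four (hk : 3 ≤ k) (hζ : IsPrimitiveRoot ζ (2 ^ k))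
    (hζ₈ : 4 ≤ k → IsPrimitiveRoot ζ₈ 8)
    (D : KummerData R H (2 ^ 2) g x) {ρ : E ≃ₐ[ℚ] E} (hρ : ρ ∈ H)
    (hρi : ρ (ζ ^ 2 ^ (k - 2)) ≠ ζ ^ 2 ^ (k - 2)) :
    (∃ g, ζ ∈ R g) ∨ (4 ≤ k ∧ ∃ g, orderOf g = 4 ∧ ζ₈ * (ζ + ζ⁻¹) ∈ R g ∧
      ζ ^ 2 + (ζ ^ 2)⁻¹ ∈ R 1) := by
  have : NeZero (2 ^ k) := ⟨by positivity⟩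
  have hζ0 : ζ ≠ 0 := hζ.ne_zero (NeZero.ne _)
  have hk2 : 2 ≤ k := by omega
  obtain ⟨κ, hκ, hκζ, hκi, η, hη, hκx⟩ := D.exists_conj (j := 0) hk2 hζ hρ hρi
  obtain ⟨τ, hτ, hτx, hτζ⟩ := D.exists_neg (j := 0) hk2 hζ hρ hρi
  have : CharZero E := algebraRat.charZero E
  have hcl : ∀ h ∈ H, h ∈ Submonoid.closure {κ, τ} := fun h hh =>
    D.mem_closure_of_conj (j := 0) hk2 hζ hκ hκζ hκi hτ
      (by simpa using IsPrimitiveRoot.neg_one (R := E) 0 (by norm_num)) hτx hh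
  -- A root of order four is an odd power of `η`, so the same exponent `n` also gives `(-1) ^ n =
  -- -1`, as needed for `τ`.
  have hpow : ∀ w : E, IsPrimitiveRoot w 4 → ∃ n : ℕ, n.Coprime 4 ∧ w = η ^ n ∧
      (-1 : E) ^ n = -1 := by
    intro w hw
    have hη4 : IsPrimitiveRoot η 4 := by simpa using hη
    obtain ⟨n, -, rfl⟩ := hη4.eq_pow_of_pow_eq_one hw.pow_eq_one
    have hn := (hη4.pow_iff_coprime (by norm_num) n).1 hw
    refine ⟨n, hn, rfl, Odd.neg_one_pow ?_⟩
    rw [← Nat.coprime_two_right]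
    exact hn.coprime_dvd_right (by norm_num)
  rcases hk.eq_or_lt with rfl | hk4
  · left
    have h8 : IsPrimitiveRoot ζ 8 := by simpa using hζ
    -- This is the ratio `κ ζ / ζ`.
    have hw : IsPrimitiveRoot ((ζ ^ 2)⁻¹) 4 := (h8.pow (by norm_num) (by norm_num)).inv
    obtain ⟨n, hn, hn1, hn2⟩ := hpow _ hw
    refine ⟨_, D.mem_of_closure hcl n ζ ?_⟩
    rintro σ (rfl | rfl)
    · refine ⟨η, hκx, ?_⟩
      rw [← hn1, hκζ]; field_simp
    · refine ⟨-1, hτx, ?_⟩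
      rw [hn2, hτζ, neg_one_mul]
  · right
    have h8 := hζ₈ hk4
    have h80 : ζ₈ ≠ 0 := h8.ne_zero (by norm_num)
    have h8q : ζ₈ ^ 2 ^ k = 1 := (h8.pow_eq_one_iff_dvd _).2
      ⟨2 ^ (k - 3), by rw [show 8 = 2 ^ 3 by norm_num, ← pow_add, show 3 + (k - 3) = k by omega]⟩
    -- `ζ + ζ⁻¹` is fixed by `κ` and negated by `τ`; the factor `ζ₈` supplies the ratio `κ ζ₈ / ζ₈`
    -- of order four.
    have hw : IsPrimitiveRoot ((ζ₈ ^ 2)⁻¹) 4 := (h8.pow (by norm_num) (by norm_num)).inv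
    obtain ⟨n, hn, hn1, hn2⟩ := hpow _ hw
    refine ⟨hk4, g ^ n, ?_, ?_, ?_⟩
    · have h4 : orderOf g = 4 := by rw [D.orderOf_eq]; norm_num
      rw [Nat.Coprime.orderOf_pow (by rw [h4]; exact hn.symm), h4]
    · obtain ⟨t, -, ht⟩ := hζ.eq_pow_of_pow_eq_one h8q
      have hκ8 : κ ζ₈ = ζ₈⁻¹ := by rw [← ht, map_pow, hκζ, inv_pow]
      have hτ8 : τ ζ₈ = ζ₈ := by
        have h1 : τ ζ = ζ ^ (1 + 2 ^ (k - 1)) := by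
          rw [pow_add, pow_two_pow_eq_neg_one (by omega) hζ, pow_one, hτζ, mul_neg_one]
        rw [apply_eq_pow hζ h1 h8q, pow_add, pow_one]
        have : (2 : ℕ) ^ (k - 1) = 8 * 2 ^ (k - 4) := by
          rw [show 8 = 2 ^ 3 by norm_num, ← pow_add]; congr 1; omega
        rw [this, pow_mul, h8.pow_eq_one, one_pow, mul_one]
      refine D.mem_of_closure hcl n _ ?_
      rintro σ (rfl | rfl)
      · refine ⟨η, hκx, ?_⟩
        rw [← hn1, map_mul, map_add, map_inv₀, hκζ, hκ8, inv_inv, add_comm ζ⁻¹]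
        field_simp
      · refine ⟨-1, hτx, ?_⟩
        rw [hn2, map_mul, map_add, map_inv₀, hτζ, hτ8, inv_neg]
        ring
    · have := D.mem_of_closure hcl 0 (ζ ^ 2 + (ζ ^ 2)⁻¹) (by
        rintro σ (rfl | rfl)
        · exact ⟨η, hκx, by simp [hκζ, add_comm]⟩
        · exact ⟨-1, hτx, by simp [hτζ]⟩)
      simpa using this

/-- A noncyclic group of order at least eight. -/
theorem KummerData.mem_of_card_ge_eight (hζ : IsPrimitiveRoot ζ (2 ^ k))
    (hζ₈ : 4 ≤ k → IsPrimitiveRoot ζ₈ 8) {j : ℕ} (hj : j + 4 ≤ k)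
    (D : KummerData R H (2 ^ (j + 3)) g x) {ρ : E ≃ₐ[ℚ] E} (hρ : ρ ∈ H)
    (hρi : ρ (ζ ^ 2 ^ (k - 2)) ≠ ζ ^ 2 ^ (k - 2)) :
    (∃ g, ζ ∈ R g) ∨ (∃ g, orderOf g = 2 ^ (k - 1) ∧ ζ * (ζ₈ + ζ₈⁻¹) ∈ R g) := by
  have : NeZero (2 ^ k) := ⟨by positivity⟩
  have : CharZero E := algebraRat.charZero E
  have hζ0 : ζ ≠ 0 := hζ.ne_zero (NeZero.ne _)
  have hk2 : 2 ≤ k := by omega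
  have h8 := hζ₈ (by omega)
  have h8q : ζ₈ ^ 2 ^ k = 1 := (h8.pow_eq_one_iff_dvd _).2
    ⟨2 ^ (k - 3), by rw [show 8 = 2 ^ 3 by norm_num, ← pow_add, show 3 + (k - 3) = k by omega]⟩
  obtain ⟨κ, hκ, hκζ, hκi, η, hη, hκx⟩ := D.exists_conj (j := j + 1) hk2 hζ hρ hρi
  have hη0 : η ≠ 0 := hη.ne_zero (by positivity)
  have hηq : η ^ 2 ^ k = 1 := (hη.pow_eq_one_iff_dvd _).2 (pow_dvd_pow 2 (by omega))
  have hκroot : ∀ z : E, z ^ 2 ^ k = 1 → κ z = z⁻¹ := by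
    intro z hz
    obtain ⟨t, -, rfl⟩ := hζ.eq_pow_of_pow_eq_one hz
    rw [map_pow, hκζ, inv_pow]
  have hw : IsPrimitiveRoot ((η ^ 2)⁻¹) (2 ^ (j + 2)) :=
    (hη.pow (by positivity) (by rw [pow_succ'])).inv
  -- With this value, `κ σ = σ κ` at `x` reads η^3 = η^(s-2), where `s` is the exponent of `σ`.
  obtain ⟨σ, hσ, hσx⟩ := D.exists_aut ((η ^ 2)⁻¹) (by
    rw [pow_succ 2 (j + 2), pow_mul, hw.pow_eq_one, one_pow])
  have hσi := D.apply_eq_of_pow_eq_one (j := j + 1) hk2 hζ hρ hρi hσ hw.pow_eq_one hσx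
  have hcl : ∀ h ∈ H, h ∈ Submonoid.closure {κ, σ} := fun h hh =>
    D.mem_closure_of_conj (j := j + 1) hk2 hζ hκ hκζ hκi hσ hw hσx hh
  obtain ⟨s, hs, hσζ⟩ : ∃ s : ℕ, s ≡ 1 [MOD 4] ∧ σ ζ = ζ ^ s := by
    rcases exists_exponent hk2 hζ σ with ⟨-, h⟩ | ⟨h, -⟩
    · exact h
    · exact absurd (hσi.symm.trans h)
        (ne_neg_self_of_sq_eq_neg_one (sq_pow_two_pow_eq_neg_one hk2 hζ))
  have hση : σ η = η ^ s := apply_eq_pow hζ hσζ hηq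
  -- commuting automorphisms force the exponent of `σ`
  have hs5 : s ≡ 5 [MOD 2 ^ (j + 3)] := by
    have h := DFunLike.congr_fun (aut_comm hζ κ σ) x
    rw [AlgEquiv.mul_apply, AlgEquiv.mul_apply, hκx, hσx, map_mul, map_mul, hκx, hσx, map_inv₀,
      map_pow, hκroot η hηq, hση, inv_pow, inv_inv, ← mul_assoc, ← mul_assoc] at h
    have h1 := mul_right_cancel₀ D.ne_zero h
    have h2 : η ^ s = η ^ 5 := by
      field_simp at h1
      rw [← h1]
    rwa [(hη.isOfFinOrder (by positivity)).pow_eq_pow_iff_modEq, ← hη.eq_orderOf] at h2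
  have hs8 : s ≡ 5 [MOD 8] := hs5.of_dvd ⟨2 ^ j, by rw [pow_add, mul_comm]; norm_num⟩
  have hs8' : s % 8 = 5 := hs8
  -- the order of `σ` shows that `H` is everything
  have hjk : j + 3 = k - 1 := by
    have hord : orderOf σ = 2 ^ (j + 2) := by
      rw [hw.eq_orderOf]
      exact D.orderOf_aut_two hk2 hζ hσ (by
        rw [pow_succ 2 (j + 2), pow_mul, hw.pow_eq_one, one_pow]) hσx hσi
    have hwζ : σ ζ = ζ ^ (s - 1) * ζ := by
      rw [← pow_succ, Nat.sub_add_cancel (by omega), hσζ]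
    have hwq : (ζ ^ (s - 1)) ^ 2 ^ k = 1 := by
      rw [← pow_mul, mul_comm, pow_mul, hζ.pow_eq_one, one_pow]
    have h1 := aut_pow_apply hwζ (apply_eq_pow hζ hσζ hwq) (2 ^ (j + 2))
    rw [← hord, pow_orderOf_eq_one, AlgEquiv.one_apply, hord] at h1
    have h2 := (mul_eq_right₀ hζ0).1 h1.symm
    rw [pow_geom_sum_eq_one_iff Nat.prime_two (hs.of_dvd (by norm_num)) (fun _ => hs) hwq,
      ← pow_mul, hζ.pow_eq_one_iff_dvd] at h2
    -- Otherwise `8` divides `s - 1`, against `s ≡ 5` mod 8.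
    by_contra hne
    have h3 : 2 ^ (j + 5) ∣ (s - 1) * 2 ^ (j + 2) := (pow_dvd_pow 2 (by omega)).trans h2
    have h4 : 2 ^ (j + 5) = 8 * 2 ^ (j + 2) := by rw [show j + 5 = 3 + (j + 2) by ring, pow_add]; rfl
    rw [h4] at h3
    have h5 := Nat.dvd_of_mul_dvd_mul_right (by positivity) h3
    omega
  have hη' : IsPrimitiveRoot η (2 ^ (k - 1)) := by rw [← hjk]; exact hη
  have hζ2 : IsPrimitiveRoot ((ζ ^ 2)⁻¹) (2 ^ (k - 1)) :=
    (hζ.pow (by positivity) (by rw [← pow_succ', Nat.sub_add_cancel (by omega)])).inv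
  have : NeZero (2 ^ (k - 1)) := ⟨by positivity⟩
  -- The exponent `n` is dictated by `κ ζ / ζ = ζ⁻²`; the factor for `σ` is then `ζ ^ 4`.
  obtain ⟨n, -, hn⟩ := hη'.eq_pow_of_pow_eq_one hζ2.pow_eq_one
  have hnc : n.Coprime (2 ^ (k - 1)) :=
    (hη'.pow_iff_coprime (by positivity) n).1 (by rw [hn]; exact hζ2)
  have hwn : ((η ^ 2)⁻¹) ^ n = ζ ^ 4 := by
    rw [inv_pow, ← pow_mul, mul_comm, pow_mul, hn, inv_pow, inv_inv, ← pow_mul]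
  have hκn : κ ζ = η ^ n * ζ := by rw [hn, hκζ]; field_simp
  -- The exponent `s` is known only modulo `2 ^ (k - 1)`, which leaves a sign.
  have hσ5 : σ ζ = ζ ^ 4 * ζ ∨ σ ζ = -(ζ ^ 4 * ζ) := by
    rw [← pow_succ]
    refine sq_eq_sq_iff_eq_or_eq_neg.1 ?_
    rw [hσζ, ← pow_mul, ← pow_mul, (hζ.isOfFinOrder (by positivity)).pow_eq_pow_iff_modEq,
      ← hζ.eq_orderOf, mul_comm s, mul_comm (4 + 1)]
    have := hs5.mul_left' 2
    rwa [hjk, ← pow_succ', Nat.sub_add_cancel (by omega)] at this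
  rcases hσ5 with h5 | h5
  · left
    refine ⟨_, D.mem_of_closure hcl n ζ ?_⟩
    rintro τ (rfl | rfl)
    · exact ⟨η, hκx, hκn⟩
    · exact ⟨_, hσx, by rw [hwn, h5]⟩
  · right
    refine ⟨g ^ n, ?_, D.mem_of_closure hcl n _ ?_⟩
    · rw [Nat.Coprime.orderOf_pow, D.orderOf_eq, hjk]
      rw [D.orderOf_eq, hjk]; exact hnc.symm
    -- `σ` negates `ζ₈ + ζ₈⁻¹`, which cancels the sign in `σ ζ = -ζ ^ 5`.
    · have hσ8 : σ ζ₈ = -ζ₈ := by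
        have h4 : ζ₈ ^ 4 = -1 :=
          (h8.pow (by norm_num) (a := 4) (b := 2) (by norm_num)).eq_neg_one_of_two_right
        rw [apply_eq_pow hζ hσζ h8q, ← Nat.mod_add_div s 8, hs8', pow_add, pow_mul, h8.pow_eq_one,
          one_pow, mul_one, pow_succ, h4, neg_one_mul]
      rintro τ (rfl | rfl)
      · refine ⟨η, hκx, ?_⟩
        rw [map_mul, map_add, map_inv₀, hκroot _ h8q, hκn, inv_inv]
        ring
      · refine ⟨_, hσx, ?_⟩
        rw [map_mul, map_add, map_inv₀, hσ8, hwn, h5, inv_neg]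
        ring

/-- The gradings of `ℚ(μ_{2^k})`, in terms of homogeneous elements. -/
theorem IsGrading.classification_two (hk : 1 ≤ k) (hζ : IsPrimitiveRoot ζ (2 ^ k))
    (hζ₈ : 4 ≤ k → IsPrimitiveRoot ζ₈ 8) (hR : IsGrading R) :
    (∃ g, ζ ∈ R g) ∨
    (3 ≤ k ∧ ∃ g, orderOf g = 2 ∧ ((ζ + ζ⁻¹ ∈ R 1 ∧ ζ - ζ⁻¹ ∈ R g) ∨
      (ζ - ζ⁻¹ ∈ R 1 ∧ ζ + ζ⁻¹ ∈ R g))) ∨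
    (4 ≤ k ∧ ∃ g, orderOf g = 2 ^ (k - 1) ∧ ζ * (ζ₈ + ζ₈⁻¹) ∈ R g) ∨
    (4 ≤ k ∧ ∃ g, orderOf g = 4 ∧ ζ₈ * (ζ + ζ⁻¹) ∈ R g ∧ ζ ^ 2 + (ζ ^ 2)⁻¹ ∈ R 1) := by
  have : NeZero (2 ^ k) := ⟨by positivity⟩
  have := IsCyclotomicExtension.finiteDimensional {2 ^ k} ℚ E
  have := IsCyclotomicExtension.isGalois {2 ^ k} ℚ E
  have : CharZero E := algebraRat.charZero E
  have hζ0 : ζ ≠ 0 := hζ.ne_zero (NeZero.ne _)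
  obtain ⟨H, m, g, x, D⟩ := hR.exists_kummerData
  have hmd := D.dvd_two_pow hk
  obtain ⟨j, hj, rfl⟩ := (Nat.dvd_prime_pow Nat.prime_two).1 hmd
  rcases j with _ | j
  · left
    refine ⟨_, D.mem_of 0 ζ fun σ hσ z hz => ?_⟩
    obtain ⟨w, hw1, hw2⟩ := D.exists_root σ hσ
    have : σ = 1 := D.eq_one σ hσ (by
      rw [pow_zero, pow_one] at hw1
      rw [hw2, hw1, one_mul])
    simp [this]
  have hk2 : 2 ≤ k := by omega
  have hneg := ne_neg_self_of_sq_eq_neg_one (sq_pow_two_pow_eq_neg_one hk2 hζ)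
  by_cases hall : ∀ σ ∈ H, σ (ζ ^ 2 ^ (k - 2)) = ζ ^ 2 ^ (k - 2)
  · left
    obtain ⟨n, hn⟩ := D.exists_mem_of_forall_modEq Nat.prime_two hζ
      (hmd.trans (pow_dvd_pow 2 (by omega))) fun σ hσ => by
        rcases exists_exponent hk2 hζ σ with ⟨-, s, hs, h⟩ | ⟨h, -⟩
        · exact ⟨s, hs.of_dvd (by norm_num), fun _ => hs, h⟩
        · exact absurd ((hall σ hσ).symm.trans h) hneg
    exact ⟨_, hn⟩
  push Not at hall
  obtain ⟨ρ, hρ, hρi⟩ := hall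
  rcases j with _ | j
  · -- `H` has order two
    simp only [zero_add, pow_one] at D
    have hcases : ∀ σ ∈ H, ∀ w : E, σ x = w * x → (w = 1 ∧ σ = 1) ∨ (w = -1 ∧ σ x = -1 * x) := by
      intro σ hσ w hw
      obtain ⟨w', hw'1, hw'2⟩ := D.exists_root σ hσ
      obtain rfl := mul_right_cancel₀ D.ne_zero (hw.symm.trans hw'2)
      rcases sq_eq_one_iff.1 hw'1 with rfl | rfl
      · exact Or.inl ⟨rfl, D.eq_one σ hσ (by simpa using hw)⟩
      · exact Or.inr ⟨rfl, hw⟩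
    have hρx : ρ x = -1 * x := by
      obtain ⟨w, -, hw⟩ := D.exists_root ρ hρ
      rcases hcases ρ hρ w hw with ⟨-, rfl⟩ | ⟨-, h⟩
      · exact absurd rfl hρi
      · exact h
    have hmem : ∀ y, (ρ y = y → y ∈ R 1) ∧ (ρ y = -y → y ∈ R g) := by
      refine fun y => ⟨fun hy => ?_, fun hy => ?_⟩
      · have := D.mem_of 0 y fun σ hσ w hw => by
          rcases hcases σ hσ w hw with ⟨rfl, rfl⟩ | ⟨rfl, h⟩
          · simp
          · rw [D.eq_of_apply_eq hσ hρ (h.trans hρx.symm), hy, pow_zero, one_mul]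
        simpa using this
      · have := D.mem_of 1 y fun σ hσ w hw => by
          rcases hcases σ hσ w hw with ⟨rfl, rfl⟩ | ⟨rfl, h⟩
          · simp
          · rw [D.eq_of_apply_eq hσ hρ (h.trans hρx.symm), hy, pow_one, neg_one_mul]
        simpa using this
    have hρ2 : ρ ^ 2 = 1 := by
      refine D.eq_one _ (_root_.pow_mem hρ 2) ?_
      rw [pow_two, AlgEquiv.mul_apply, hρx, map_mul, hρx, map_neg, map_one]
      ring
    obtain ⟨s, hs, hρζ⟩ : ∃ s : ℕ, s ≡ 3 [MOD 4] ∧ ρ ζ = ζ ^ s := by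
      rcases exists_exponent hk2 hζ ρ with ⟨h, -⟩ | ⟨-, h⟩
      · exact absurd h hρi
      · exact h
    have hinv := apply_eq_inv_or_eq_neg_inv_of_sq_eq_one hζ hρ2 hs hρζ
    -- For `k = 2`, `ζ⁻¹ = -ζ`, so `ζ` itself is an eigenvector of `ρ`.
    rcases hk2.eq_or_lt with rfl | hk3
    · left
      have h2 : ζ ^ 2 = -1 := by simpa using sq_pow_two_pow_eq_neg_one le_rfl hζ
      have h3 : ζ⁻¹ = -ζ := by
        exact inv_eq_of_mul_eq_one_right (by rw [mul_neg, ← pow_two, h2, neg_neg])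
      rw [h3, neg_neg] at hinv
      rcases hinv with h | h
      · exact ⟨_, (hmem ζ).2 h⟩
      · exact ⟨_, (hmem ζ).1 h⟩
    · refine Or.inr (Or.inl ⟨hk3, g, D.orderOf_eq, ?_⟩)
      rcases hinv with h | h
      · exact Or.inl ⟨(hmem _).1 (by simp [h, add_comm]), (hmem _).2 (by simp [h])⟩
      · refine Or.inr ⟨(hmem _).1 ?_, (hmem _).2 ?_⟩
        · rw [map_sub, map_inv₀, h, inv_neg, inv_inv]; ring
        · rw [map_add, map_inv₀, h, inv_neg, inv_inv]; ring
  rcases j with _ | j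
  · rcases D.mem_of_card_eq_four (by omega) hζ hζ₈ hρ hρi with h | h
    · exact Or.inl h
    · exact Or.inr (Or.inr (Or.inr h))
  · rcases D.mem_of_card_ge_eight hζ hζ₈ (by omega) hρ hρi with h | h
    · exact Or.inl h
    · exact Or.inr (Or.inr (Or.inl ⟨by omega, h⟩))

end Noncyclic

end CyclotomicGradings
namespace CyclotomicGradings

/-! ### Counting push-forwards and bounding degrees -/

section Counting

theorem orderOf_coe_muInf (g : muInf) : orderOf (((g : ℂˣ) : ℂ)) = orderOf g := by
  rw [orderOf_units, Subgroup.orderOf_coe]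

theorem exists_muInf {z : ℂ} {m : ℕ} [NeZero m] (hz : z ^ m = 1) :
    ∃ g : muInf, ((g : ℂˣ) : ℂ) = z :=
  ⟨⟨Units.ofPowEqOne z m hz (NeZero.ne m), mu_le_muInf m (NeZero.ne m)
    ((mem_rootsOfUnity _ _).2 (Units.pow_ofPowEqOne hz _))⟩, rfl⟩

theorem coe_muInf_injective : Function.Injective (fun g : muInf => ((g : ℂˣ) : ℂ)) :=
  fun _ _ h => Subtype.ext (Units.ext h)

theorem ncard_pow_eq_one (m : ℕ) [NeZero m] : {g : muInf | g ^ m = 1}.ncard = m := by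
  have h1 : (fun g : muInf => ((g : ℂˣ) : ℂ)) '' {g : muInf | g ^ m = 1} =
      (Polynomial.nthRootsFinset m (1 : ℂ) : Set ℂ) := by
    ext z
    simp only [Set.mem_image, Finset.mem_coe, Polynomial.mem_nthRootsFinset (NeZero.pos m)]
    constructor
    · rintro ⟨g, hg, rfl⟩
      have := congrArg (fun g : muInf => ((g : ℂˣ) : ℂ)) (show g ^ m = 1 from hg)
      simpa using this
    · intro hz
      obtain ⟨g, rfl⟩ := exists_muInf hz
      exact ⟨g, coe_muInf_injective (by simpa using hz), rfl⟩
  rw [← Set.ncard_image_of_injective _ coe_muInf_injective, h1, Set.ncard_coe_finset]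
  exact (Complex.isPrimitiveRoot_exp m (NeZero.ne m)).card_nthRootsFinset

theorem ncard_orderOf_eq (m : ℕ) [NeZero m] : {g : muInf | orderOf g = m}.ncard = m.totient := by
  have h1 : (fun g : muInf => ((g : ℂˣ) : ℂ)) '' {g : muInf | orderOf g = m} =
      (primitiveRoots m ℂ : Set ℂ) := by
    ext z
    simp only [Set.mem_image, Finset.mem_coe, mem_primitiveRoots (NeZero.pos m),
      IsPrimitiveRoot.iff_orderOf]
    constructor
    · rintro ⟨g, hg, rfl⟩
      rw [orderOf_coe_muInf]; exact hg
    · intro hz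
      obtain ⟨g, rfl⟩ := exists_muInf (m := m) (z := z) (by rw [← hz, pow_orderOf_eq_one])
      exact ⟨g, (orderOf_coe_muInf g).symm.trans hz, rfl⟩
  rw [← Set.ncard_image_of_injective _ coe_muInf_injective, h1, Set.ncard_coe_finset,
    Complex.card_primitiveRoots]

variable {E : Type*} [Field E] [Algebra ℚ E]

/-- The push-forwards of a power family along a set of homomorphisms are counted by the images of
the generator. -/
theorem ncard_pushforward_powerFamily {m : ℕ} [NeZero m] {a : E} (ha0 : a ≠ 0)
    {K : IntermediateField ℚ E} (ha : a ^ m ∈ K) (hP : IsGrading (powerFamily m a K))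
    (Q : (Multiplicative (ZMod m) →* muInf) → Prop) (T : Set muInf)
    (hQ : ∀ φ : Multiplicative (ZMod m) →* muInf, Q φ ↔ φ (Multiplicative.ofAdd 1) ∈ T)
    (hT : ∀ g ∈ T, g ^ m = 1) :
    {R : muInf → Submodule ℚ E | ∃ φ, Q φ ∧ R = pushforward φ (powerFamily m a K)}.ncard =
      T.ncard := by
  have h1 : {R : muInf → Submodule ℚ E | ∃ φ, Q φ ∧ R = pushforward φ (powerFamily m a K)} =
      (fun φ : Multiplicative (ZMod m) →* muInf => pushforward φ (powerFamily m a K)) ''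
        {φ | Q φ} := by
    ext R; simp only [Set.mem_image, Set.mem_ofPred_eq, eq_comm (a := R)]
  have h2 : T = (fun φ : Multiplicative (ZMod m) →* muInf => φ (Multiplicative.ofAdd 1)) ''
      {φ | Q φ} := by
    ext g
    simp only [Set.mem_image, Set.mem_ofPred_eq, hQ]
    constructor
    · intro hg
      obtain ⟨φ, hφ⟩ := exists_zmod_hom g (hT g hg)
      exact ⟨φ, hφ ▸ hg, hφ⟩
    · rintro ⟨φ, hφ, rfl⟩
      exact hφ
  rw [h1, Set.ncard_image_of_injective, h2, Set.ncard_image_of_injective]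
  · exact fun φ ψ h => zmod_hom_ext h
  -- The degree of the nonzero element `a` recovers the image of the generator.
  · intro φ ψ h
    refine zmod_hom_ext ((hP.pushforward ψ).eq_of_mem ha0 ?_
      (mem_pushforward_powerFamily ha ψ))
    have := mem_pushforward_powerFamily ha φ
    rwa [show pushforward φ (powerFamily m a K) = pushforward ψ (powerFamily m a K) from h] at this

theorem forall_mem_adjoin_apply_eq {S : Set E} {σ : E ≃ₐ[ℚ] E} (h : ∀ s ∈ S, σ s = s) :
    ∀ c ∈ IntermediateField.adjoin ℚ S, σ c = c := by
  intro c hc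
  induction hc using IntermediateField.adjoin_induction with
  | mem x hx => exact h x hx
  | algebraMap x => exact σ.commutes x
  | add x y _ _ hx hy => rw [map_add, hx, hy]
  | inv x _ hx => rw [map_inv₀, hx]
  | mul x y _ _ hx hy => rw [map_mul, hx, hy]

/-- A lower bound for the degree over a subfield in terms of conjugates. -/
theorem card_mul_finrank_le [FiniteDimensional ℚ E] [IsGalois ℚ E] {K : IntermediateField ℚ E}
    (y : E) (S : Finset E)
    (hS : ∀ ξ ∈ S, ∃ σ : E ≃ₐ[ℚ] E, (∀ c ∈ K, σ c = c) ∧ σ y = ξ) :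
    S.card * Module.finrank ℚ K ≤ Module.finrank ℚ E := by
  choose σ h1 h2 using hS
  have hle : Nat.card S ≤ Nat.card K.fixingSubgroup := by
    refine Nat.card_le_card_of_injective (fun ξ : S => (⟨σ ξ ξ.2, fun c => h1 ξ ξ.2 c c.2⟩ :
      K.fixingSubgroup)) fun ξ ξ' h => ?_
    have h3 : σ ξ ξ.2 = σ ξ' ξ'.2 := congrArg Subtype.val h
    have h4 := DFunLike.congr_fun h3 y
    rw [h2, h2] at h4
    exact Subtype.ext h4
  rw [IsGalois.card_fixingSubgroup_eq_finrank, Nat.card_eq_fintype_card, Fintype.card_coe] at hle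
  rw [← Module.finrank_mul_finrank ℚ K E, mul_comm]
  exact Nat.mul_le_mul_left _ hle

theorem IsGrading.adjoin_le [FiniteDimensional ℚ E] {R : muInf → Submodule ℚ E}
    (hR : IsGrading R) {S : Set E} (hS : ∀ s ∈ S, s ∈ R 1) :
    ∀ c ∈ IntermediateField.adjoin ℚ S, c ∈ R 1 := by
  obtain ⟨K, hK⟩ := hR.exists_subfield
  have : IntermediateField.adjoin ℚ S ≤ K :=
    IntermediateField.adjoin_le_iff.2 fun s hs => (hK s).2 (hS s hs)
  exact fun c hc => (hK c).1 (this hc)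

end Counting

/-! ### Gradings with `ζ` homogeneous -/

section ListA

theorem finrank_adjoin_pow_eq_one {F L : Type*} [Field F] [Field L] [Algebra F L] {n : ℕ}
    [NeZero n] {ω : L} (hω : IsPrimitiveRoot ω n)
    (hirr : Irreducible (Polynomial.cyclotomic n F)) :
    Module.finrank F (IntermediateField.adjoin F {x : L | x ^ n = 1}) = n.totient := by
  have h := IntermediateField.isCyclotomicExtension_adjoin_of_exists_isPrimitiveRoot {n} F L
    (by rintro n rfl -; exact ⟨_, hω⟩)
  have hset : {b : L | ∃ m ∈ ({n} : Set ℕ), m ≠ 0 ∧ b ^ m = 1} = {x : L | x ^ n = 1} := by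
    ext x
    simp [NeZero.ne n]
  rw [hset] at h
  exact IsCyclotomicExtension.finrank _ hirr

variable {E : Type*} [Field E] [Algebra ℚ E] {p k : ℕ} {ζ : E} [IsCyclotomicExtension {p ^ k} ℚ E]

omit [IsCyclotomicExtension {p ^ k} ℚ E] [Algebra ℚ E] in
theorem isPrimitiveRoot_pow_pred (hp : p.Prime) (hk : 1 ≤ k) (hζ : IsPrimitiveRoot ζ (p ^ k)) :
    IsPrimitiveRoot (ζ ^ p ^ (k - 1)) p :=
  hζ.pow (pow_pos hp.pos k) (by rw [← pow_succ, Nat.sub_add_cancel hk])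

omit [IsCyclotomicExtension {p ^ k} ℚ E] in
theorem pow_pred_mem_adjoin (hp : p.Prime) (hk : 1 ≤ k) (hζ : IsPrimitiveRoot ζ (p ^ k)) :
    ζ ^ p ^ (k - 1) ∈ IntermediateField.adjoin ℚ {x : E | x ^ p = 1} :=
  IntermediateField.subset_adjoin _ _ (isPrimitiveRoot_pow_pred hp hk hζ).pow_eq_one

theorem isGrading_powerFamily_zeta (hp : p.Prime) (hk : 1 ≤ k) (hζ : IsPrimitiveRoot ζ (p ^ k)) :
    IsGrading (powerFamily (p ^ (k - 1)) ζ (IntermediateField.adjoin ℚ {x : E | x ^ p = 1})) := by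
  have : NeZero (p ^ k) := ⟨pow_ne_zero _ hp.ne_zero⟩
  have : NeZero (p ^ (k - 1)) := ⟨pow_ne_zero _ hp.ne_zero⟩
  have : NeZero p := ⟨hp.ne_zero⟩
  have := IsCyclotomicExtension.finiteDimensional {p ^ k} ℚ E
  have := IsCyclotomicExtension.isGalois {p ^ k} ℚ E
  have hω := isPrimitiveRoot_pow_pred hp hk hζ
  refine isGrading_powerFamily _ _ _ (pow_pred_mem_adjoin hp hk hζ)
    (fun σ _ h => aut_ext hζ (by simpa using h)) ?_
  rw [IsCyclotomicExtension.finrank (n := p ^ k) E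
    (Polynomial.cyclotomic.irreducible_rat (NeZero.pos _)),
    Nat.totient_prime_pow hp hk, ← Nat.totient_prime hp,
    ← finrank_adjoin_pow_eq_one hω (Polynomial.cyclotomic.irreducible_rat (NeZero.pos _))]

/-- The gradings in the first list are those for which `ζ` is homogeneous. -/
theorem mem_listA_iff (hp : p.Prime) (hk : 1 ≤ k) (hζ : IsPrimitiveRoot ζ (p ^ k))
    {R : muInf → Submodule ℚ E} : R ∈ listA p k ζ ↔ IsGrading R ∧ ∃ g, ζ ∈ R g := by
  have : NeZero (p ^ k) := ⟨pow_ne_zero _ hp.ne_zero⟩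
  have : NeZero (p ^ (k - 1)) := ⟨pow_ne_zero _ hp.ne_zero⟩
  have : NeZero p := ⟨hp.ne_zero⟩
  have := IsCyclotomicExtension.finiteDimensional {p ^ k} ℚ E
  have hP := isGrading_powerFamily_zeta hp hk hζ
  have hω := isPrimitiveRoot_pow_pred hp hk hζ
  constructor
  · rintro ⟨φ, rfl⟩
    exact ⟨hP.pushforward φ, _, mem_pushforward_powerFamily (pow_pred_mem_adjoin hp hk hζ) φ⟩
  · rintro ⟨hR, g, hg⟩
    have hgω := hR.pow_mem hg (p ^ (k - 1))
    -- If ω = ζ^(p^(k-1)) had nontrivial degree, that degree would have order `p`, and 1 + ω + … +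
    -- ω^(p-1) = 0 would put `1` in the sum of the other components.
    have hdeg : g ^ p ^ (k - 1) = 1 := by
      by_contra hne
      have hord : orderOf (g ^ p ^ (k - 1)) = p := by
        have := Fact.mk hp
        refine orderOf_eq_prime ?_ hne
        have h1 := hR.pow_mem hgω p
        rw [hω.pow_eq_one] at h1
        exact hR.eq_of_mem one_ne_zero h1 hR.one_mem
      have hsum := hω.geom_sum_eq_zero hp.one_lt
      obtain ⟨q, hq⟩ := Nat.exists_eq_succ_of_ne_zero hp.ne_zero
      rw [hq, Finset.sum_range_succ', pow_zero] at hsum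
      have h1 : (1 : E) ∈ ⨆ (j) (_ : j ≠ 1), R j := by
        rw [eq_neg_of_add_eq_zero_right hsum]
        refine Submodule.neg_mem _ (Submodule.sum_mem _ fun i hi => ?_)
        refine (le_iSup₂_of_le (f := fun j (_ : j ≠ 1) => R j) ((g ^ p ^ (k - 1)) ^ (i + 1)) ?_
          le_rfl) (hR.pow_mem (by rw [← hq]; exact hgω) (i + 1))
        rw [Ne, ← orderOf_dvd_iff_pow_eq_one, hord]
        have := Finset.mem_range.1 hi
        exact Nat.not_dvd_of_pos_of_lt (by omega) (by omega)
      exact one_ne_zero (Submodule.disjoint_def.1 (hR.iSupIndep 1) 1 hR.one_mem h1)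
    obtain ⟨φ, hφ⟩ := exists_zmod_hom g hdeg
    refine ⟨φ, pushforward_powerFamily_eq hP φ hR (hR.adjoin_le fun x hx => ?_) (hφ ▸ hg)⟩
    obtain ⟨i, -, rfl⟩ := hω.eq_pow_of_pow_eq_one hx
    rw [hdeg] at hgω
    simpa using hR.pow_mem hgω i

theorem ncard_listA (hp : p.Prime) (hk : 1 ≤ k) (hζ : IsPrimitiveRoot ζ (p ^ k)) :
    (listA p k ζ).ncard = p ^ (k - 1) := by
  have : NeZero (p ^ k) := ⟨pow_ne_zero _ hp.ne_zero⟩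
  have : NeZero (p ^ (k - 1)) := ⟨pow_ne_zero _ hp.ne_zero⟩
  have h := ncard_pushforward_powerFamily (hζ.ne_zero (NeZero.ne _))
    (pow_pred_mem_adjoin hp hk hζ) (isGrading_powerFamily_zeta hp hk hζ) (fun _ => True)
    {g | g ^ p ^ (k - 1) = 1} (fun φ => by simpa using zmod_hom_apply_pow φ) (fun g hg => hg)
  rw [ncard_pow_eq_one] at h
  simpa [listA] using h

end ListA

end CyclotomicGradings
namespace CyclotomicGradings

/-! ### Gradings supported on ±1 -/

section ListB

variable {E : Type*} [Field E] [Algebra ℚ E]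

theorem orderOf_coe_mu_two {s : mu 2} (hs : s ≠ 1) :
    orderOf (Subgroup.inclusion (mu_le_muInf 2 two_ne_zero) s) = 2 := by
  have := Fact.mk Nat.prime_two
  refine orderOf_eq_prime ?_ fun h => hs (Subgroup.inclusion_injective _ (by rw [h, map_one]))
  rw [← map_pow]
  have : s ^ 2 = 1 := Subtype.ext ((mem_rootsOfUnity 2 _).1 s.2)
  rw [this, map_one]

theorem exists_mu_two : ∃ s : mu 2, s ≠ 1 := by
  refine ⟨⟨-1, by simp [mem_rootsOfUnity]⟩, fun h => ?_⟩
  have h1 : ((-1 : ℂˣ) : ℂ) = 1 := congrArg (fun s : mu 2 => ((s : ℂˣ) : ℂ)) h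
  norm_num at h1

theorem eq_of_orderOf_eq_two {g h : muInf} (hg : orderOf g = 2) (hh : orderOf h = 2) : g = h := by
  have key : ∀ g : muInf, orderOf g = 2 → ((g : ℂˣ) : ℂ) = -1 := fun g hg => by
    have h1 : IsPrimitiveRoot ((g : ℂˣ) : ℂ) 2 := by
      rw [IsPrimitiveRoot.iff_orderOf, orderOf_coe_muInf, hg]
    exact h1.eq_neg_one_of_two_right
  exact coe_muInf_injective ((key g hg).trans (key h hh).symm)

/-- `μ_∞` has a unique element of order two, so the results on power families apply with `m = 2`. -/
theorem pushforward_signFamily_eq {K : IntermediateField ℚ E} {b : E} (hb : b ^ 2 ∈ K)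
    (φ : Multiplicative (ZMod 2) →* muInf) (hφ : orderOf (φ (Multiplicative.ofAdd 1)) = 2) :
    pushforward (Subgroup.inclusion (mu_le_muInf 2 two_ne_zero)) (signFamily K b) =
      pushforward φ (powerFamily 2 b K) := by
  funext h
  refine le_antisymm (pushforward_le (fun s => ?_) h) (pushforward_le (fun n => ?_) h)
  · by_cases hs : s = 1
    · subst hs
      intro x hx
      simp only [signFamily, if_true] at hx
      rw [map_one]
      exact mem_pushforward_powerFamily_one φ hx
    · intro x hx
      simp only [signFamily, if_neg hs] at hx
      obtain ⟨c, hc, rfl⟩ := mem_mulSubfield.1 hx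
      rw [eq_of_orderOf_eq_two (orderOf_coe_mu_two hs) hφ]
      have := pow_mul_mem_powerFamily hb 1 hc
      rw [pow_one, Nat.cast_one] at this
      exact mem_pushforward _ this
  · intro x hx
    obtain ⟨c, hc, rfl⟩ := mem_powerFamily.1 hx
    have hn : n = Multiplicative.ofAdd (1 : ZMod 2) ^ (Multiplicative.toAdd n).val := by
      rw [← ofAdd_nsmul, nsmul_one, ZMod.natCast_zmod_val, ofAdd_toAdd]
    have hlt := ZMod.val_lt (Multiplicative.toAdd n)
    rw [hn, map_pow, ← hn]
    have hcases : (Multiplicative.toAdd n).val = 0 ∨ (Multiplicative.toAdd n).val = 1 := by omega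
    rcases hcases with h0 | h1
    · rw [h0, pow_zero, pow_zero, one_mul]
      have : c ∈ signFamily K b 1 := by simpa [signFamily] using hc
      simpa using mem_pushforward (f := Subgroup.inclusion (mu_le_muInf 2 two_ne_zero)) 1 this
    · rw [h1, pow_one, pow_one]
      obtain ⟨s, hs⟩ := exists_mu_two
      rw [eq_of_orderOf_eq_two hφ (orderOf_coe_mu_two hs)]
      refine mem_pushforward (f := Subgroup.inclusion (mu_le_muInf 2 two_ne_zero)) s ?_
      simp only [signFamily, if_neg hs]
      exact mem_mulSubfield.2 ⟨c, hc, rfl⟩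

theorem eq_pushforward_signFamily_iff [FiniteDimensional ℚ E] [IsGalois ℚ E] {a b : E}
    (hb : b ^ 2 ∈ IntermediateField.adjoin ℚ {a})
    (hgen : ∀ σ : E ≃ₐ[ℚ] E, σ a = a → σ b = b → σ = 1) (κ : E ≃ₐ[ℚ] E) (hκ : κ a = a)
    (hκb : κ b ≠ b) {R : muInf → Submodule ℚ E} :
    R = pushforward (Subgroup.inclusion (mu_le_muInf 2 two_ne_zero))
      (signFamily (IntermediateField.adjoin ℚ {a}) b) ↔
    IsGrading R ∧ ∃ g, orderOf g = 2 ∧ a ∈ R 1 ∧ b ∈ R g := by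
  have ha := IntermediateField.mem_adjoin_simple_self ℚ a
  have hP : IsGrading (powerFamily 2 b (IntermediateField.adjoin ℚ {a})) := by
    classical
    refine isGrading_powerFamily 2 b _ hb (fun σ h1 h2 => hgen σ (h1 a ha) h2) ?_
    -- The two conjugates `b` and `κ b` over `ℚ(a)` give the degree bound.
    have := card_mul_finrank_le (K := IntermediateField.adjoin ℚ {a}) b {b, κ b} (by
      intro ξ hξ
      rcases Finset.mem_insert.1 hξ with rfl | h
      · exact ⟨1, fun _ _ => rfl, rfl⟩
      · exact ⟨κ, forall_mem_adjoin_apply_eq (by simpa using hκ), (Finset.mem_singleton.1 h).symm⟩)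
    rwa [Finset.card_pair hκb.symm] at this
  constructor
  · rintro rfl
    obtain ⟨s, hs⟩ := exists_mu_two
    have hord := orderOf_coe_mu_two hs
    obtain ⟨φ, hφ⟩ := exists_zmod_hom (m := 2) (Subgroup.inclusion (mu_le_muInf 2 two_ne_zero) s)
      (orderOf_dvd_iff_pow_eq_one.1 hord.dvd)
    rw [pushforward_signFamily_eq hb φ (by rw [hφ, hord])]
    exact ⟨hP.pushforward φ, _, hord, mem_pushforward_powerFamily_one φ ha,
      hφ ▸ mem_pushforward_powerFamily hb φ⟩
  · rintro ⟨hR, g, hg, h1, h2⟩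
    obtain ⟨φ, hφ⟩ := exists_zmod_hom (m := 2) g (by rw [← hg, pow_orderOf_eq_one])
    rw [pushforward_signFamily_eq hb φ (by rw [hφ, hg])]
    exact pushforward_powerFamily_eq hP φ hR (hR.adjoin_le (by simpa using h1)) (hφ ▸ h2)

variable {p k : ℕ} {ζ : E}

omit [Algebra ℚ E] in
theorem pow_four_ne_one (hp : p.Prime) (hk : 1 ≤ k) (h : p ≠ 2 ∨ 3 ≤ k)
    (hζ : IsPrimitiveRoot ζ (p ^ k)) : ζ ^ 4 ≠ 1 := by
  intro h4
  have hd := hζ.dvd_of_pow_eq_one _ h4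
  rcases eq_or_ne p 2 with rfl | hp2
  · have h3 : 2 ^ 3 ∣ 4 := (pow_dvd_pow 2 (h.resolve_left (by simp))).trans hd
    norm_num at h3
  · have h1 : p ∣ 2 ^ 2 := (dvd_pow_self p (by omega)).trans hd
    exact hp2 ((Nat.prime_dvd_prime_iff_eq hp Nat.prime_two).1 (hp.dvd_of_dvd_pow h1))

omit [Algebra ℚ E] in
theorem add_inv_ne_zero (hζ0 : ζ ≠ 0) (h4 : ζ ^ 4 ≠ 1) : ζ + ζ⁻¹ ≠ 0 := by
  intro h
  apply h4
  field_simp at h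
  linear_combination (ζ ^ 2 - 1) * h

omit [Algebra ℚ E] in
theorem sub_inv_ne_zero (hζ0 : ζ ≠ 0) (h4 : ζ ^ 4 ≠ 1) : ζ - ζ⁻¹ ≠ 0 := by
  intro h
  apply h4
  field_simp at h
  linear_combination (ζ ^ 2 + 1) * h

variable [IsCyclotomicExtension {p ^ k} ℚ E]

theorem aut_eq_one_of_add_sub [NeZero (p ^ k)] (hζ : IsPrimitiveRoot ζ (p ^ k)) (σ : E ≃ₐ[ℚ] E)
    (h1 : σ (ζ + ζ⁻¹) = ζ + ζ⁻¹) (h2 : σ (ζ - ζ⁻¹) = ζ - ζ⁻¹) : σ = 1 := by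
  have : CharZero E := algebraRat.charZero E
  refine aut_ext hζ ?_
  rw [map_add] at h1
  rw [map_sub] at h2
  rw [AlgEquiv.one_apply]
  refine mul_left_cancel₀ (two_ne_zero (α := E)) ?_
  linear_combination h1 + h2

theorem mem_listB_iff (hp : p.Prime) (hk : 1 ≤ k) (hpk : p ≠ 2 ∨ 3 ≤ k)
    (hζ : IsPrimitiveRoot ζ (p ^ k)) {R : muInf → Submodule ℚ E} :
    R ∈ listB p k ζ ↔ IsGrading R ∧ ∃ g, orderOf g = 2 ∧
      ((ζ + ζ⁻¹ ∈ R 1 ∧ ζ - ζ⁻¹ ∈ R g) ∨ (p = 2 ∧ ζ - ζ⁻¹ ∈ R 1 ∧ ζ + ζ⁻¹ ∈ R g)) := by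
  have : NeZero (p ^ k) := ⟨pow_ne_zero _ hp.ne_zero⟩
  have : CharZero E := algebraRat.charZero E
  have := IsCyclotomicExtension.finiteDimensional {p ^ k} ℚ E
  have := IsCyclotomicExtension.isGalois {p ^ k} ℚ E
  have hζ0 : ζ ≠ 0 := hζ.ne_zero (NeZero.ne _)
  have h4 := pow_four_ne_one hp hk hpk hζ
  have h1 : R = pushforward (Subgroup.inclusion (mu_le_muInf 2 two_ne_zero))
      (signFamily (IntermediateField.adjoin ℚ {ζ + ζ⁻¹}) (ζ - ζ⁻¹)) ↔
      IsGrading R ∧ ∃ g, orderOf g = 2 ∧ ζ + ζ⁻¹ ∈ R 1 ∧ ζ - ζ⁻¹ ∈ R g := by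
    obtain ⟨κ, hκ⟩ := exists_aut_apply_eq hζ hζ.inv
    refine eq_pushforward_signFamily_iff ?_ (aut_eq_one_of_add_sub hζ) κ ?_ ?_
    · have : (ζ - ζ⁻¹) ^ 2 = (ζ + ζ⁻¹) ^ 2 - 4 := by field_simp; ring
      rw [this]
      exact sub_mem (_root_.pow_mem (IntermediateField.mem_adjoin_simple_self ℚ _) 2)
        (ofNat_mem _ 4)
    · rw [map_add, map_inv₀, hκ, inv_inv, add_comm]
    · rw [map_sub, map_inv₀, hκ, inv_inv, ← neg_sub]
      exact fun h => sub_inv_ne_zero hζ0 h4 (neg_eq_self.1 h)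
  have h2 : p = 2 → (R = pushforward (Subgroup.inclusion (mu_le_muInf 2 two_ne_zero))
      (signFamily (IntermediateField.adjoin ℚ {ζ - ζ⁻¹}) (ζ + ζ⁻¹)) ↔
      IsGrading R ∧ ∃ g, orderOf g = 2 ∧ ζ - ζ⁻¹ ∈ R 1 ∧ ζ + ζ⁻¹ ∈ R g) := by
    rintro rfl
    have hk3 : 3 ≤ k := hpk.resolve_left (by simp)
    -- The involution `ζ ↦ -ζ⁻¹` fixes `ζ - ζ⁻¹` and negates `ζ + ζ⁻¹`. It exists because `-ζ⁻¹` is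
    -- an odd power of `ζ⁻¹`.
    have hneg : IsPrimitiveRoot (-ζ⁻¹) (2 ^ k) := by
      have h := hζ.inv.pow_of_coprime (2 ^ (k - 1) + 1) (Nat.Coprime.pow_right _ (by
        rw [Nat.coprime_two_right]
        exact (Nat.even_pow.2 ⟨even_two, by omega⟩).add_one))
      rwa [pow_succ, pow_two_pow_eq_neg_one hk hζ.inv, neg_one_mul] at h
    obtain ⟨κ, hκ⟩ := exists_aut_apply_eq hζ hneg
    refine eq_pushforward_signFamily_iff ?_ (fun σ h1 h2 => aut_eq_one_of_add_sub hζ σ h2 h1) κ ?_ ?_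
    · have : (ζ + ζ⁻¹) ^ 2 = (ζ - ζ⁻¹) ^ 2 + 4 := by field_simp; ring
      rw [this]
      exact add_mem (_root_.pow_mem (IntermediateField.mem_adjoin_simple_self ℚ _) 2)
        (ofNat_mem _ 4)
    · rw [map_sub, map_inv₀, hκ, inv_neg, inv_inv]; ring
    · rw [map_add, map_inv₀, hκ, inv_neg, inv_inv, ← neg_add, add_comm]
      exact fun h => add_inv_ne_zero hζ0 h4 (neg_eq_self.1 h)
  simp only [listB, Set.mem_ofPred_eq]
  rw [and_iff_right hpk, h1]
  constructor
  · rintro (⟨hR, g, hg, h⟩ | ⟨⟨hp2, hk3⟩, h⟩)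
    · exact ⟨hR, g, hg, Or.inl h⟩
    · obtain ⟨hR, g, hg, h⟩ := (h2 hp2).1 h
      exact ⟨hR, g, hg, Or.inr ⟨hp2, h⟩⟩
  · rintro ⟨hR, g, hg, h | ⟨hp2, h⟩⟩
    · exact Or.inl ⟨hR, g, hg, h⟩
    · exact Or.inr ⟨⟨hp2, hpk.resolve_left (by simp [hp2])⟩, (h2 hp2).2 ⟨hR, g, hg, h⟩⟩

omit [IsCyclotomicExtension {p ^ k} ℚ E] in
theorem listB_eq_empty (h : ¬ (p ≠ 2 ∨ 3 ≤ k)) : listB p k ζ = ∅ := by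
  ext R
  simp only [listB, Set.mem_ofPred_eq, Set.mem_empty_iff_false, iff_false]
  tauto

theorem ncard_listB (hp : p.Prime) (hk : 1 ≤ k) (hζ : IsPrimitiveRoot ζ (p ^ k)) :
    (listB p k ζ).ncard = if p ≠ 2 then 1 else if 3 ≤ k then 2 else 0 := by
  by_cases hpk : p ≠ 2 ∨ 3 ≤ k
  swap
  · rw [listB_eq_empty hpk, Set.ncard_empty]
    push Not at hpk
    rw [if_neg (by simp [hpk.1]), if_neg (by omega)]
  set F₁ := pushforward (Subgroup.inclusion (mu_le_muInf 2 two_ne_zero))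
      (signFamily (IntermediateField.adjoin ℚ {ζ + ζ⁻¹}) (ζ - ζ⁻¹)) with hF₁
  set F₂ := pushforward (Subgroup.inclusion (mu_le_muInf 2 two_ne_zero))
      (signFamily (IntermediateField.adjoin ℚ {ζ - ζ⁻¹}) (ζ + ζ⁻¹)) with hF₂
  by_cases hp2 : p = 2
  · have hk3 : 3 ≤ k := hpk.resolve_left (by simp [hp2])
    have hset : listB p k ζ = {F₁, F₂} := by
      ext R
      simp only [listB, Set.mem_ofPred_eq, Set.mem_insert_iff, Set.mem_singleton_iff]
      tauto
    rw [hset, if_neg (by simpa using hp2), if_pos hk3, Set.ncard_pair]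
    -- Equality would give `ζ + ζ⁻¹` both degree `1` and degree `-1`.
    intro heq
    have hm1 : F₁ ∈ listB p k ζ := by rw [hset]; simp
    obtain ⟨hR, -⟩ := (mem_listB_iff hp hk hpk hζ).1 hm1
    have : NeZero (p ^ k) := ⟨pow_ne_zero _ hp.ne_zero⟩
    have hζ0 : ζ ≠ 0 := hζ.ne_zero (NeZero.ne _)
    have h4 := pow_four_ne_one hp hk hpk hζ
    have ha : ζ + ζ⁻¹ ∈ F₁ 1 := by
      have : ζ + ζ⁻¹ ∈ signFamily (IntermediateField.adjoin ℚ {ζ + ζ⁻¹}) (ζ - ζ⁻¹) 1 := by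
        simpa [signFamily] using IntermediateField.mem_adjoin_simple_self ℚ _
      simpa using mem_pushforward (f := Subgroup.inclusion (mu_le_muInf 2 two_ne_zero)) 1 this
    obtain ⟨s, hs⟩ := exists_mu_two
    have hb : ζ + ζ⁻¹ ∈ F₁ (Subgroup.inclusion (mu_le_muInf 2 two_ne_zero) s) := by
      rw [heq]
      refine mem_pushforward s ?_
      simp only [signFamily, if_neg hs]
      exact mem_mulSubfield.2 ⟨1, one_mem _, mul_one _⟩
    have h1 := hR.eq_of_mem (add_inv_ne_zero hζ0 h4) ha hb
    have h2 := orderOf_coe_mu_two hs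
    rw [← h1, orderOf_one] at h2
    norm_num at h2
  · have hset : listB p k ζ = {F₁} := by
      ext R
      simp only [listB, Set.mem_ofPred_eq, Set.mem_singleton_iff]
      tauto
    rw [hset, if_pos hp2, Set.ncard_singleton]

end ListB

end CyclotomicGradings
namespace CyclotomicGradings

/-! ### The exceptional gradings for p = 2 -/

section ListCD

variable {E : Type*} [Field E] [Algebra ℚ E] {k : ℕ} {ζ ζ₈ : E}

omit [Algebra ℚ E] in
-- For `k ≥ 4`, `8` divides the order `2 ^ (k - 1)` of `ζ ^ 2`; hence `ζ ^ 2` controls `ζ₈`.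
theorem exists_sq_pow_eq (hk : 4 ≤ k) (hζ : IsPrimitiveRoot ζ (2 ^ k))
    (h8 : IsPrimitiveRoot ζ₈ 8) : ∃ t : ℕ, (ζ ^ 2) ^ t = ζ₈ := by
  have : NeZero (2 ^ (k - 1)) := ⟨by positivity⟩
  have h2 : IsPrimitiveRoot (ζ ^ 2) (2 ^ (k - 1)) :=
    hζ.pow (by positivity) (by rw [← pow_succ', Nat.sub_add_cancel (by omega)])
  obtain ⟨t, -, ht⟩ := h2.eq_pow_of_pow_eq_one (ξ := ζ₈) ((h8.pow_eq_one_iff_dvd _).2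
    (by rw [show 8 = 2 ^ 3 by norm_num]; exact pow_dvd_pow 2 (by omega)))
  exact ⟨t, ht⟩

omit [Algebra ℚ E] in
theorem pow_four_eq_neg_one (h8 : IsPrimitiveRoot ζ₈ 8) : ζ₈ ^ 4 = -1 :=
  (h8.pow (by norm_num) (a := 4) (b := 2) (by norm_num)).eq_neg_one_of_two_right

omit [Algebra ℚ E] in
theorem add_inv_sq_eq_two (h8 : IsPrimitiveRoot ζ₈ 8) : (ζ₈ + ζ₈⁻¹) ^ 2 = 2 := by
  have h0 : ζ₈ ≠ 0 := h8.ne_zero (by norm_num)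
  field_simp
  linear_combination pow_four_eq_neg_one h8

omit [Algebra ℚ E] in
theorem mul_sqrt_two_ne_zero [CharZero E] (hζ : IsPrimitiveRoot ζ (2 ^ k))
    (h8 : IsPrimitiveRoot ζ₈ 8) : ζ * (ζ₈ + ζ₈⁻¹) ≠ 0 := by
  refine mul_ne_zero (hζ.ne_zero (by positivity)) fun h => ?_
  have := add_inv_sq_eq_two h8
  rw [h] at this
  norm_num at this

omit [Algebra ℚ E] in
theorem mul_sqrt_two_pow (h8 : IsPrimitiveRoot ζ₈ 8) (n : ℕ) :
    (ζ * (ζ₈ + ζ₈⁻¹)) ^ (2 * n) = 2 ^ n * ζ ^ (2 * n) := by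
  rw [pow_mul, mul_pow, add_inv_sq_eq_two h8, mul_pow, ← pow_mul, mul_comm]

theorem mul_sqrt_two_pow_mem_bot (hk : 4 ≤ k) (hζ : IsPrimitiveRoot ζ (2 ^ k))
    (h8 : IsPrimitiveRoot ζ₈ 8) :
    (ζ * (ζ₈ + ζ₈⁻¹)) ^ 2 ^ (k - 1) ∈ (⊥ : IntermediateField ℚ E) := by
  have h : 2 ^ (k - 1) = 2 * 2 ^ (k - 2) := by rw [← pow_succ']; congr 1; omega
  rw [h, mul_sqrt_two_pow h8, ← h, pow_two_pow_eq_neg_one (by omega) hζ, mul_neg_one]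
  exact neg_mem (_root_.pow_mem (ofNat_mem _ 2) _)

variable [IsCyclotomicExtension {2 ^ k} ℚ E]

theorem isGrading_powerFamily_mul_sqrt_two (hk : 4 ≤ k) (hζ : IsPrimitiveRoot ζ (2 ^ k))
    (h8 : IsPrimitiveRoot ζ₈ 8) :
    IsGrading (powerFamily (2 ^ (k - 1)) (ζ * (ζ₈ + ζ₈⁻¹)) ⊥) := by
  have : NeZero (2 ^ k) := ⟨by positivity⟩
  have : NeZero (2 ^ (k - 1)) := ⟨by positivity⟩
  have : CharZero E := algebraRat.charZero E
  have := IsCyclotomicExtension.finiteDimensional {2 ^ k} ℚ E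
  have := IsCyclotomicExtension.isGalois {2 ^ k} ℚ E
  refine isGrading_powerFamily _ _ _ (mul_sqrt_two_pow_mem_bot hk hζ h8) ?_ ?_
  · intro σ _ h
    obtain ⟨t, ht⟩ := exists_sq_pow_eq hk hζ h8
    -- The square of `ζ √2` is `2 ζ ^ 2`; fixing `ζ ^ 2` fixes `ζ₈`, then √2, and finally `ζ`.
    have h1 : σ (ζ ^ 2) = ζ ^ 2 := by
      have h2 : σ ((ζ * (ζ₈ + ζ₈⁻¹)) ^ (2 * 1)) = (ζ * (ζ₈ + ζ₈⁻¹)) ^ (2 * 1) := by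
        rw [map_pow, h]
      rw [mul_sqrt_two_pow h8, map_mul, map_pow, map_ofNat, mul_one] at h2
      exact mul_left_cancel₀ (pow_ne_zero 1 two_ne_zero) h2
    have h3 : σ ζ₈ = ζ₈ := by rw [← ht, map_pow, h1]
    rw [map_mul, map_add, map_inv₀, h3] at h
    refine aut_ext hζ ?_
    exact mul_right_cancel₀ (right_ne_zero_of_mul (mul_sqrt_two_ne_zero hζ h8)) h
  · rw [IntermediateField.finrank_bot, mul_one, IsCyclotomicExtension.finrank (n := 2 ^ k) E
      (Polynomial.cyclotomic.irreducible_rat (NeZero.pos _)),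
      Nat.totient_prime_pow Nat.prime_two (by omega)]
    simp

theorem mem_listC_iff (hk : 4 ≤ k) (hζ : IsPrimitiveRoot ζ (2 ^ k))
    (h8 : IsPrimitiveRoot ζ₈ 8) {R : muInf → Submodule ℚ E} :
    R ∈ listC 2 k ζ ζ₈ ↔
      IsGrading R ∧ ∃ g, orderOf g = 2 ^ (k - 1) ∧ ζ * (ζ₈ + ζ₈⁻¹) ∈ R g := by
  have : NeZero (2 ^ (k - 1)) := ⟨by positivity⟩
  have hP := isGrading_powerFamily_mul_sqrt_two hk hζ h8
  constructor
  · rintro ⟨-, φ, hφ, rfl⟩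
    exact ⟨hP.pushforward φ, _, (zmod_hom_injective_iff φ).1 hφ,
      mem_pushforward_powerFamily (mul_sqrt_two_pow_mem_bot hk hζ h8) φ⟩
  · rintro ⟨hR, g, hg, h⟩
    obtain ⟨φ, hφ⟩ := exists_zmod_hom (m := 2 ^ (k - 1)) g (by rw [← hg, pow_orderOf_eq_one])
    refine ⟨⟨rfl, hk⟩, φ, (zmod_hom_injective_iff φ).2 (hφ ▸ hg),
      pushforward_powerFamily_eq hP φ hR ?_ (hφ ▸ h)⟩
    intro c hc
    obtain ⟨r, rfl⟩ := IntermediateField.mem_bot.1 hc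
    exact hR.algebraMap_mem r

omit [IsCyclotomicExtension {2 ^ k} ℚ E] in
theorem listC_eq_empty {p : ℕ} (h : ¬ (p = 2 ∧ 4 ≤ k)) : listC p k ζ ζ₈ = ∅ := by
  ext R
  simp only [listC, Set.mem_ofPred_eq, Set.mem_empty_iff_false, iff_false]
  tauto

theorem ncard_listC (hk : 4 ≤ k) (hζ : IsPrimitiveRoot ζ (2 ^ k)) (h8 : IsPrimitiveRoot ζ₈ 8) :
    (listC 2 k ζ ζ₈).ncard = 2 ^ (k - 2) := by
  have : NeZero (2 ^ (k - 1)) := ⟨by positivity⟩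
  have : CharZero E := algebraRat.charZero E
  have h := ncard_pushforward_powerFamily (mul_sqrt_two_ne_zero hζ h8)
    (mul_sqrt_two_pow_mem_bot hk hζ h8) (isGrading_powerFamily_mul_sqrt_two hk hζ h8)
    (fun φ => Function.Injective φ) {g | orderOf g = 2 ^ (k - 1)} zmod_hom_injective_iff
    (fun g hg => by rw [← show orderOf g = 2 ^ (k - 1) from hg, pow_orderOf_eq_one])
  rw [ncard_orderOf_eq, Nat.totient_prime_pow Nat.prime_two (by omega)] at h
  have e : listC 2 k ζ ζ₈ = {R | ∃ φ : Multiplicative (ZMod (2 ^ (k - 1))) →* muInf,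
      Function.Injective φ ∧ R = pushforward φ (powerFamily (2 ^ (k - 1)) (ζ * (ζ₈ + ζ₈⁻¹)) ⊥)} := by
    ext R; simp [listC, hk]
  rw [e, h, show k - 1 - 1 = k - 2 by omega]
  exact mul_one _

omit [IsCyclotomicExtension {2 ^ k} ℚ E] in
theorem pow_four_mem_adjoin (hζ0 : ζ ≠ 0) (h8 : IsPrimitiveRoot ζ₈ 8) :
    (ζ₈ * (ζ + ζ⁻¹)) ^ 4 ∈ IntermediateField.adjoin ℚ {ζ ^ 2 + (ζ ^ 2)⁻¹} := by
  have h : (ζ₈ * (ζ + ζ⁻¹)) ^ 4 = -(ζ ^ 2 + (ζ ^ 2)⁻¹ + 2) ^ 2 := by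
    rw [mul_pow, pow_four_eq_neg_one h8]
    field_simp
    ring
  rw [h]
  exact neg_mem (_root_.pow_mem (add_mem (IntermediateField.mem_adjoin_simple_self ℚ _)
    (ofNat_mem _ 2)) 2)

theorem isGrading_powerFamily_four (hk : 4 ≤ k) (hζ : IsPrimitiveRoot ζ (2 ^ k))
    (h8 : IsPrimitiveRoot ζ₈ 8) :
    IsGrading (powerFamily 4 (ζ₈ * (ζ + ζ⁻¹))
      (IntermediateField.adjoin ℚ {ζ ^ 2 + (ζ ^ 2)⁻¹})) := by
  classical
  have : NeZero (2 ^ k) := ⟨by positivity⟩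
  have : CharZero E := algebraRat.charZero E
  have := IsCyclotomicExtension.finiteDimensional {2 ^ k} ℚ E
  have := IsCyclotomicExtension.isGalois {2 ^ k} ℚ E
  have hζ0 : ζ ≠ 0 := hζ.ne_zero (NeZero.ne _)
  have h80 : ζ₈ ≠ 0 := h8.ne_zero (by norm_num)
  have h4 := pow_four_ne_one Nat.prime_two (by omega) (Or.inr (by omega)) hζ
  have hne := add_inv_ne_zero hζ0 h4
  have hne1 : ζ ≠ ζ⁻¹ := fun h => sub_inv_ne_zero hζ0 h4 (sub_eq_zero.2 h)
  have hne2 : ζ ≠ -ζ⁻¹ := fun h => hne (by rw [h]; ring_nf; simp [← h])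
  have hself : ∀ y : E, y ≠ 0 → y ≠ -y := fun y hy h => hy (self_eq_neg.1 h)
  have h82 : ζ₈ ^ 2 ≠ 1 ∧ ζ₈ ^ 2 ≠ -1 := by
    rw [← not_or, ← sq_eq_one_iff, ← pow_mul, pow_four_eq_neg_one h8]
    exact fun h => by norm_num at h
  refine isGrading_powerFamily 4 _ _ (pow_four_mem_adjoin hζ0 h8) ?_ ?_
  · intro σ h1 h2
    have ha := h1 _ (IntermediateField.mem_adjoin_simple_self ℚ _)
    obtain ⟨t, ht⟩ := exists_sq_pow_eq hk hζ h8
    have hσ0 : σ ζ ≠ 0 := by simpa using hζ0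
    -- `σ ζ ^ 2` is a root of X² - (ζ² + ζ⁻²)X + 1, so `σ ζ` is `±ζ` or `±ζ⁻¹`. Invariance of `ζ₈ (ζ
    -- + ζ⁻¹)` leaves only `ζ`.
    have hprod : ((σ ζ) ^ 2 - ζ ^ 2) * ((σ ζ) ^ 2 - (ζ ^ 2)⁻¹) = 0 := by
      rw [map_add, map_inv₀, map_pow] at ha
      have h5 : (ζ ^ 2) * (ζ ^ 2)⁻¹ = 1 := mul_inv_cancel₀ (pow_ne_zero 2 hζ0)
      have h6 : (σ ζ ^ 2) * (σ ζ ^ 2)⁻¹ = 1 := mul_inv_cancel₀ (pow_ne_zero 2 hσ0)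
      linear_combination (σ ζ ^ 2) * ha - h6 + h5
    refine aut_ext hζ ?_
    rw [AlgEquiv.one_apply]
    rw [map_mul, map_add, map_inv₀] at h2
    rcases mul_eq_zero.1 hprod with h | h
    · have h3 : σ ζ₈ = ζ₈ := by rw [← ht, map_pow, map_pow, sub_eq_zero.1 h]
      rcases sq_eq_sq_iff_eq_or_eq_neg.1 (sub_eq_zero.1 h) with h5 | h5
      · exact h5
      · rw [h3, h5, inv_neg, ← neg_add, mul_neg] at h2
        exact absurd h2.symm (hself _ (mul_ne_zero h80 hne))
    · exfalso
      have h3 : σ ζ₈ = ζ₈⁻¹ := by rw [← ht, map_pow, map_pow, sub_eq_zero.1 h, inv_pow]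
      rw [← inv_pow, sub_eq_zero] at h
      rcases sq_eq_sq_iff_eq_or_eq_neg.1 h with h5 | h5
      · rw [h3, h5, inv_inv, add_comm ζ⁻¹] at h2
        have h6 := mul_right_cancel₀ hne h2
        apply h82.1
        rw [pow_two]; nth_rw 1 [← h6]; exact inv_mul_cancel₀ h80
      · rw [h3, h5, inv_neg, inv_inv, ← neg_add, add_comm ζ⁻¹, mul_neg, ← neg_mul] at h2
        have h6 := mul_right_cancel₀ hne h2
        apply h82.2
        rw [pow_two]; nth_rw 1 [← h6]; rw [neg_mul, inv_mul_cancel₀ h80]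
  · have hpr : ∀ ξ ∈ ({ζ, -ζ, ζ⁻¹, -ζ⁻¹} : Finset E), IsPrimitiveRoot ξ (2 ^ k) ∧
        ξ ^ 2 + (ξ ^ 2)⁻¹ = ζ ^ 2 + (ζ ^ 2)⁻¹ := by
      have hneg : ∀ ξ : E, IsPrimitiveRoot ξ (2 ^ k) → IsPrimitiveRoot (-ξ) (2 ^ k) := by
        intro ξ hξ
        have h := hξ.pow_of_coprime (2 ^ (k - 1) + 1) (Nat.Coprime.pow_right _ (by
          rw [Nat.coprime_two_right]
          exact (Nat.even_pow.2 ⟨even_two, by omega⟩).add_one))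
        rwa [pow_succ, pow_two_pow_eq_neg_one (by omega) hξ, neg_one_mul] at h
      intro ξ hξ
      simp only [Finset.mem_insert, Finset.mem_singleton] at hξ
      rcases hξ with rfl | rfl | rfl | rfl
      · exact ⟨hζ, rfl⟩
      · exact ⟨hneg _ hζ, by simp⟩
      · exact ⟨hζ.inv, by simp [add_comm]⟩
      · exact ⟨hneg _ hζ.inv, by simp [add_comm]⟩
    -- `±ζ` and `±ζ⁻¹` are four distinct conjugates of `ζ` over the subfield.
    have hcard := card_mul_finrank_le (K := IntermediateField.adjoin ℚ {ζ ^ 2 + (ζ ^ 2)⁻¹}) ζ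
      {ζ, -ζ, ζ⁻¹, -ζ⁻¹} (by
        intro ξ hξ
        obtain ⟨h1, h2⟩ := hpr ξ hξ
        obtain ⟨σ, hσ⟩ := exists_aut_apply_eq hζ h1
        refine ⟨σ, forall_mem_adjoin_apply_eq ?_, hσ⟩
        simp only [Set.mem_singleton_iff, forall_eq]
        rw [map_add, map_inv₀, map_pow, hσ, h2])
    have h4 : ({ζ, -ζ, ζ⁻¹, -ζ⁻¹} : Finset E).card = 4 := by
      rw [Finset.card_insert_of_notMem, Finset.card_insert_of_notMem, Finset.card_pair]
      · exact hself _ (inv_ne_zero hζ0)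
      · simp only [Finset.mem_insert, Finset.mem_singleton, not_or, neg_inj]
        exact ⟨fun h => hne2 (neg_eq_iff_eq_neg.1 h), hne1⟩
      · simp only [Finset.mem_insert, Finset.mem_singleton, not_or]
        exact ⟨hself _ hζ0, hne1, hne2⟩
    rwa [h4] at hcard

theorem mem_listD_iff (hk : 4 ≤ k) (hζ : IsPrimitiveRoot ζ (2 ^ k))
    (h8 : IsPrimitiveRoot ζ₈ 8) {R : muInf → Submodule ℚ E} :
    R ∈ listD 2 k ζ ζ₈ ↔ IsGrading R ∧ ∃ g, orderOf g = 4 ∧ ζ₈ * (ζ + ζ⁻¹) ∈ R g ∧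
      ζ ^ 2 + (ζ ^ 2)⁻¹ ∈ R 1 := by
  have := IsCyclotomicExtension.finiteDimensional {2 ^ k} ℚ E
  have hP := isGrading_powerFamily_four hk hζ h8
  have ha := pow_four_mem_adjoin (hζ.ne_zero (by positivity)) h8
  constructor
  · rintro ⟨-, φ, hφ, rfl⟩
    exact ⟨hP.pushforward φ, _, (zmod_hom_injective_iff φ).1 hφ,
      mem_pushforward_powerFamily ha φ,
      mem_pushforward_powerFamily_one φ (IntermediateField.mem_adjoin_simple_self ℚ _)⟩
  · rintro ⟨hR, g, hg, h, h1⟩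
    obtain ⟨φ, hφ⟩ := exists_zmod_hom (m := 4) g (by rw [← hg, pow_orderOf_eq_one])
    exact ⟨⟨rfl, hk⟩, φ, (zmod_hom_injective_iff φ).2 (hφ ▸ hg),
      pushforward_powerFamily_eq hP φ hR (hR.adjoin_le (by simpa using h1)) (hφ ▸ h)⟩

omit [IsCyclotomicExtension {2 ^ k} ℚ E] in
theorem listD_eq_empty {p : ℕ} (h : ¬ (p = 2 ∧ 4 ≤ k)) : listD p k ζ ζ₈ = ∅ := by
  ext R
  simp only [listD, Set.mem_ofPred_eq, Set.mem_empty_iff_false, iff_false]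
  tauto

omit [Algebra ℚ E] [IsCyclotomicExtension {2 ^ k} ℚ E] in
theorem zeta_eight_mul_ne_zero (hk : 4 ≤ k) (hζ : IsPrimitiveRoot ζ (2 ^ k))
    (h8 : IsPrimitiveRoot ζ₈ 8) : ζ₈ * (ζ + ζ⁻¹) ≠ 0 :=
  mul_ne_zero (h8.ne_zero (by norm_num)) (add_inv_ne_zero (hζ.ne_zero (by positivity))
    (pow_four_ne_one Nat.prime_two (by omega) (Or.inr (by omega)) hζ))

theorem ncard_listD (hk : 4 ≤ k) (hζ : IsPrimitiveRoot ζ (2 ^ k)) (h8 : IsPrimitiveRoot ζ₈ 8) :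
    (listD 2 k ζ ζ₈).ncard = 2 := by
  have h := ncard_pushforward_powerFamily (zeta_eight_mul_ne_zero hk hζ h8)
    (pow_four_mem_adjoin (hζ.ne_zero (by positivity)) h8) (isGrading_powerFamily_four hk hζ h8)
    (fun φ => Function.Injective φ) {g | orderOf g = 4} zmod_hom_injective_iff
    (fun g hg => by rw [← show orderOf g = 4 from hg, pow_orderOf_eq_one])
  rw [ncard_orderOf_eq, show (4 : ℕ).totient = 2 from by decide] at h
  have e : listD 2 k ζ ζ₈ = {R | ∃ φ : Multiplicative (ZMod 4) →* muInf,
      Function.Injective φ ∧ R = pushforward φ (powerFamily 4 (ζ₈ * (ζ + ζ⁻¹))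
        (IntermediateField.adjoin ℚ {ζ ^ 2 + (ζ ^ 2)⁻¹}))} := by
    ext R; simp [listD, hk]
  rw [e, h]

end ListCD

end CyclotomicGradings
namespace CyclotomicGradings

/-! ### Supports and disjointness of the lists -/

section Disjointness

variable {E : Type*} [Field E] [Algebra ℚ E]

/-- A homogeneous sum of two nonzero homogeneous elements has terms of equal degree. -/
theorem IsGrading.eq_of_add_mem {G : Type*} [Group G] {R : G → Submodule ℚ E} (hR : IsGrading R)
    {s t h : G} {a b : E} (ha0 : a ≠ 0) (hb0 : b ≠ 0) (ha : a ∈ R s) (hb : b ∈ R t)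
    (hab : a + b ∈ R h) : s = t := by
  by_contra hst
  by_cases hs : h = s
  · subst hs
    have : b ∈ R h := by simpa using (R h).sub_mem hab ha
    exact hst (hR.eq_of_mem hb0 this hb)
  · refine ha0 (Submodule.disjoint_def.1 (hR.iSupIndep s) a ha ?_)
    have : a = (a + b) - b := by ring
    rw [this]
    exact Submodule.sub_mem _
      ((le_iSup₂_of_le (f := fun j (_ : j ≠ s) => R j) h hs le_rfl) hab)
      ((le_iSup₂_of_le (f := fun j (_ : j ≠ s) => R j) t (Ne.symm hst) le_rfl) hb)

theorem pow_eq_one_of_ne_bot_pushforward {m : ℕ} [NeZero m] {a : E} {K : IntermediateField ℚ E}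
    (φ : Multiplicative (ZMod m) →* muInf) {g : muInf}
    (hg : pushforward φ (powerFamily m a K) g ≠ ⊥) : g ^ m = 1 := by
  by_contra hne
  refine hg (pushforward_of_forall_ne fun n hn => hne ?_)
  have h : n = Multiplicative.ofAdd (1 : ZMod m) ^ (Multiplicative.toAdd n).val := by
    rw [← ofAdd_nsmul, nsmul_one, ZMod.natCast_zmod_val, ofAdd_toAdd]
  rw [← hn, h, map_pow, ← pow_mul, mul_comm, pow_mul, zmod_hom_apply_pow, one_pow]

variable {p k : ℕ} {ζ ζ₈ : E}

theorem support_listA (hp : p.Prime) {R : muInf → Submodule ℚ E} (hR : R ∈ listA p k ζ)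
    {g : muInf} (hg : R g ≠ ⊥) : g ^ p ^ (k - 1) = 1 := by
  have : NeZero (p ^ (k - 1)) := ⟨pow_ne_zero _ hp.ne_zero⟩
  obtain ⟨φ, rfl⟩ := hR
  exact pow_eq_one_of_ne_bot_pushforward φ hg

theorem support_listB {R : muInf → Submodule ℚ E} (hR : R ∈ listB p k ζ) {g : muInf}
    (hg : R g ≠ ⊥) : g ^ 2 = 1 := by
  by_contra hne
  have key : ∀ s : mu 2, Subgroup.inclusion (mu_le_muInf 2 two_ne_zero) s ≠ g := by
    rintro s rfl
    refine hne ?_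
    rw [← map_pow, show s ^ 2 = 1 from Subtype.ext ((mem_rootsOfUnity 2 _).1 s.2), map_one]
  rcases hR with ⟨-, rfl⟩ | ⟨-, rfl⟩ <;> exact hg (pushforward_of_forall_ne key)

theorem support_listC {R : muInf → Submodule ℚ E} (hR : R ∈ listC p k ζ ζ₈) {g : muInf}
    (hg : R g ≠ ⊥) : g ^ 2 ^ (k - 1) = 1 := by
  have : NeZero (2 ^ (k - 1)) := ⟨by positivity⟩
  obtain ⟨-, φ, -, rfl⟩ := hR
  exact pow_eq_one_of_ne_bot_pushforward φ hg

theorem support_listD {R : muInf → Submodule ℚ E} (hR : R ∈ listD p k ζ ζ₈) {g : muInf}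
    (hg : R g ≠ ⊥) : g ^ 4 = 1 := by
  obtain ⟨-, φ, -, rfl⟩ := hR
  exact pow_eq_one_of_ne_bot_pushforward φ hg

theorem disjoint_listA_listB [IsCyclotomicExtension {p ^ k} ℚ E] (hp : p.Prime) (hk : 1 ≤ k)
    (hζ : IsPrimitiveRoot ζ (p ^ k)) : Disjoint (listA p k ζ) (listB p k ζ) := by
  by_cases hpk : p ≠ 2 ∨ 3 ≤ k
  swap
  · rw [listB_eq_empty hpk]; exact Set.disjoint_empty _
  have : NeZero (p ^ k) := ⟨pow_ne_zero _ hp.ne_zero⟩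
  have hζ0 : ζ ≠ 0 := hζ.ne_zero (NeZero.ne _)
  have h4 := pow_four_ne_one hp hk hpk hζ
  have hα := add_inv_ne_zero hζ0 h4
  have hβ := sub_inv_ne_zero hζ0 h4
  rw [Set.disjoint_left]
  intro R hA hB
  obtain ⟨hR, h, hζh⟩ := (mem_listA_iff hp hk hζ).1 hA
  obtain ⟨-, g, hg, hB⟩ := (mem_listB_iff hp hk hpk hζ).1 hB
  have h2 : (2 : ℚ) • ζ ∈ R h := (R h).smul_mem _ hζh
  have hg1 : g ≠ 1 := by
    rintro rfl
    rw [orderOf_one] at hg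
    norm_num at hg
  -- Were `2 ζ` homogeneous, the two summands would share a degree.
  have hsum : (2 : ℚ) • ζ = (ζ + ζ⁻¹) + (ζ - ζ⁻¹) := by
    rw [two_smul]; ring
  rw [hsum] at h2
  rcases hB with ⟨ha, hb⟩ | ⟨-, ha, hb⟩
  · exact hg1 (hR.eq_of_add_mem hα hβ ha hb h2).symm
  · exact hg1 (hR.eq_of_add_mem hα hβ hb ha h2)

theorem ne_bot_of_mem {V : Submodule ℚ E} {x : E} (h0 : x ≠ 0) (h : x ∈ V) : V ≠ ⊥ :=
  (Submodule.ne_bot_iff _).2 ⟨x, h, h0⟩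

variable [IsCyclotomicExtension {2 ^ k} ℚ E]

/-- If `ζ` and `ζ √2` are homogeneous, so is `√2 = ζ₈ + ζ₈⁻¹`. Then `ζ₈` and its inverse share a
degree and √-1 has degree `1`. But a rational multiple of it is the `2 ^ (k - 2)`-th power of `ζ
√2`, whose degree has order `2 ^ (k - 1)`. -/
theorem disjoint_listA_listC (hk : 4 ≤ k) (hζ : IsPrimitiveRoot ζ (2 ^ k))
    (h8 : IsPrimitiveRoot ζ₈ 8) : Disjoint (listA 2 k ζ) (listC 2 k ζ ζ₈) := by
  have : NeZero (2 ^ k) := ⟨by positivity⟩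
  have : CharZero E := algebraRat.charZero E
  have := IsCyclotomicExtension.finiteDimensional {2 ^ k} ℚ E
  have hζ0 : ζ ≠ 0 := hζ.ne_zero (NeZero.ne _)
  have h80 : ζ₈ ≠ 0 := h8.ne_zero (by norm_num)
  rw [Set.disjoint_left]
  intro R hA hC
  obtain ⟨hR, h, hζh⟩ := (mem_listA_iff Nat.prime_two (by omega) hζ).1 hA
  obtain ⟨-, g, hg, hC⟩ := (mem_listC_iff hk hζ h8).1 hC
  obtain ⟨t, ht⟩ := exists_sq_pow_eq hk hζ h8
  have hz8 := hR.pow_mem (hR.pow_mem hζh 2) t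
  rw [ht] at hz8
  have h1 := hR.mul_mem _ _ _ _ (hR.inv_mem hζh) hC
  rw [inv_mul_cancel_left₀ hζ0] at h1
  have h2 := hR.eq_of_add_mem h80 (inv_ne_zero h80) hz8 (hR.inv_mem hz8) h1
  have hi : ζ₈ ^ 2 ∈ R 1 := by
    have := hR.pow_mem hz8 2
    rwa [pow_two ((h ^ 2) ^ t), mul_eq_one_iff_eq_inv.2 h2] at this
  have hi' : ζ ^ 2 ^ (k - 2) ∈ R 1 := by
    have h3 : (ζ ^ 2 ^ (k - 2)) ^ 2 = (ζ₈ ^ 2) ^ 2 := by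
      rw [sq_pow_two_pow_eq_neg_one (by omega) hζ, ← pow_mul, pow_four_eq_neg_one h8]
    rcases sq_eq_sq_iff_eq_or_eq_neg.1 h3 with h4 | h4
    · rw [h4]; exact hi
    · rw [h4]; exact (R 1).neg_mem hi
  have hpow : 2 ^ (k - 2) = 2 * 2 ^ (k - 3) := by rw [← pow_succ']; congr 1; omega
  have h5 := hR.pow_mem hC (2 ^ (k - 2))
  rw [hpow, mul_sqrt_two_pow h8, ← hpow] at h5
  have h6 : (2 : E) ^ 2 ^ (k - 3) * ζ ^ 2 ^ (k - 2) ∈ R 1 := by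
    have := (R 1).smul_mem ((2 : ℚ) ^ 2 ^ (k - 3)) hi'
    rw [Algebra.smul_def] at this
    simpa using this
  have h7 := hR.eq_of_mem (mul_ne_zero (pow_ne_zero _ two_ne_zero) (pow_ne_zero _ hζ0)) h5 h6
  rw [← orderOf_dvd_iff_pow_eq_one, hg] at h7
  have := (Nat.pow_dvd_pow_iff_le_right (by norm_num)).1 h7
  omega

/-- Homogeneity of `ζ` and of `ζ ^ 2 + ζ⁻²` in degree `1` puts `ζ ^ 2`, hence `ζ₈`, in degree `1`.
Then `ζ₈ (ζ + ζ⁻¹)` has a degree of square `1`, not one of order four. -/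
theorem disjoint_listA_listD (hk : 4 ≤ k) (hζ : IsPrimitiveRoot ζ (2 ^ k))
    (h8 : IsPrimitiveRoot ζ₈ 8) : Disjoint (listA 2 k ζ) (listD 2 k ζ ζ₈) := by
  have : NeZero (2 ^ k) := ⟨by positivity⟩
  have := IsCyclotomicExtension.finiteDimensional {2 ^ k} ℚ E
  have hζ0 : ζ ≠ 0 := hζ.ne_zero (NeZero.ne _)
  have hsq0 : ζ ^ 2 ≠ 0 := pow_ne_zero 2 hζ0
  rw [Set.disjoint_left]
  intro R hA hD
  obtain ⟨hR, h, hζh⟩ := (mem_listA_iff Nat.prime_two (by omega) hζ).1 hA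
  obtain ⟨-, g, hg, hb, ha⟩ := (mem_listD_iff hk hζ h8).1 hD
  obtain ⟨t, ht⟩ := exists_sq_pow_eq hk hζ h8
  have hz2 := hR.pow_mem hζh 2
  have h1 := hR.eq_of_add_mem hsq0 (inv_ne_zero hsq0) hz2 (hR.inv_mem hz2) ha
  have hsum : ζ ^ 2 + (ζ ^ 2)⁻¹ ∈ R (h ^ 2) :=
    (R _).add_mem hz2 (by rw [h1]; exact hR.inv_mem hz2)
  have hne : ζ ^ 2 + (ζ ^ 2)⁻¹ ≠ 0 := by
    refine add_inv_ne_zero hsq0 ?_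
    rw [← pow_mul, Ne, hζ.pow_eq_one_iff_dvd, show 2 * 4 = 2 ^ 3 by norm_num,
      Nat.pow_dvd_pow_iff_le_right (by norm_num)]
    omega
  have hh : h ^ 2 = 1 := hR.eq_of_mem hne hsum ha
  have hz8 := hR.pow_mem hz2 t
  rw [ht, hh, one_pow] at hz8
  have hinv : ζ⁻¹ ∈ R h := by
    have := hR.inv_mem hζh
    rwa [inv_eq_of_mul_eq_one_right (by rw [← pow_two, hh])] at this
  have hb' := hR.mul_mem _ _ _ _ hz8 ((R h).add_mem hζh hinv)
  rw [one_mul] at hb'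
  have := hR.eq_of_mem (zeta_eight_mul_ne_zero hk hζ h8) hb hb'
  rw [← this, ← orderOf_dvd_iff_pow_eq_one, hg] at hh
  norm_num at hh

/-- A support killed by `2` cannot contain a degree of order `2 ^ (k - 1)`. -/
theorem disjoint_listB_listC (hk : 4 ≤ k) (hζ : IsPrimitiveRoot ζ (2 ^ k))
    (h8 : IsPrimitiveRoot ζ₈ 8) : Disjoint (listB 2 k ζ) (listC 2 k ζ ζ₈) := by
  have : CharZero E := algebraRat.charZero E
  rw [Set.disjoint_left]
  intro R hB hC
  obtain ⟨-, g, hg, hC⟩ := (mem_listC_iff hk hζ h8).1 hC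
  have h := support_listB hB (ne_bot_of_mem (mul_sqrt_two_ne_zero hζ h8) hC)
  rw [← orderOf_dvd_iff_pow_eq_one, hg, ← pow_one 2, ← pow_mul, one_mul,
    Nat.pow_dvd_pow_iff_le_right (by norm_num)] at h
  omega

theorem disjoint_listB_listD (hk : 4 ≤ k) (hζ : IsPrimitiveRoot ζ (2 ^ k))
    (h8 : IsPrimitiveRoot ζ₈ 8) : Disjoint (listB 2 k ζ) (listD 2 k ζ ζ₈) := by
  rw [Set.disjoint_left]
  intro R hB hD
  obtain ⟨-, g, hg, hD, -⟩ := (mem_listD_iff hk hζ h8).1 hD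
  have h := support_listB hB (ne_bot_of_mem (zeta_eight_mul_ne_zero hk hζ h8) hD)
  rw [← orderOf_dvd_iff_pow_eq_one, hg] at h
  norm_num at h

theorem disjoint_listC_listD (hk : 4 ≤ k) (hζ : IsPrimitiveRoot ζ (2 ^ k))
    (h8 : IsPrimitiveRoot ζ₈ 8) : Disjoint (listC 2 k ζ ζ₈) (listD 2 k ζ ζ₈) := by
  have : CharZero E := algebraRat.charZero E
  rw [Set.disjoint_left]
  intro R hC hD
  obtain ⟨-, g, hg, hC⟩ := (mem_listC_iff hk hζ h8).1 hC
  have h := support_listD hD (ne_bot_of_mem (mul_sqrt_two_ne_zero hζ h8) hC)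
  rw [← orderOf_dvd_iff_pow_eq_one, hg, show 4 = 2 ^ 2 by norm_num,
    Nat.pow_dvd_pow_iff_le_right (by norm_num)] at h
  omega

end Disjointness

/-! ### Completeness of the list and restriction to `μ_n` -/

section Totals

variable {E : Type*} [Field E] [Algebra ℚ E] {p k : ℕ} {ζ ζ₈ : E}

/-- Every grading of `E` by roots of unity is in the list, and conversely. -/
theorem gradings_eq [IsCyclotomicExtension {p ^ k} ℚ E] (hp : p.Prime) (hk : 1 ≤ k)
    (hζ : IsPrimitiveRoot ζ (p ^ k)) (hζ₈ : p = 2 → 4 ≤ k → IsPrimitiveRoot ζ₈ 8) :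
    gradings muInf E = listA p k ζ ∪ listB p k ζ ∪ listC p k ζ ζ₈ ∪ listD p k ζ ζ₈ := by
  ext R
  simp only [Set.mem_union]
  by_cases hp2 : p = 2
  · subst hp2
    constructor
    · intro hR
      rcases IsGrading.classification_two hk hζ (hζ₈ rfl) hR with h | ⟨hk3, g, hg, h⟩ |
        ⟨hk4, h⟩ | ⟨hk4, h⟩
      · exact Or.inl (Or.inl (Or.inl ((mem_listA_iff hp hk hζ).2 ⟨hR, h⟩)))
      · refine Or.inl (Or.inl (Or.inr ((mem_listB_iff hp hk (Or.inr hk3) hζ).2 ⟨hR, g, hg, ?_⟩)))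
        exact h.imp id fun h => ⟨rfl, h⟩
      · exact Or.inl (Or.inr ((mem_listC_iff hk4 hζ (hζ₈ rfl hk4)).2 ⟨hR, h⟩))
      · exact Or.inr ((mem_listD_iff hk4 hζ (hζ₈ rfl hk4)).2 ⟨hR, h⟩)
    · rintro (((h | h) | h) | h)
      · exact ((mem_listA_iff hp hk hζ).1 h).1
      · by_cases hk3 : 3 ≤ k
        · exact ((mem_listB_iff hp hk (Or.inr hk3) hζ).1 h).1
        · rw [listB_eq_empty (by simpa using hk3)] at h
          exact h.elim
      · have hk4 : 4 ≤ k := h.1.2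
        exact ((mem_listC_iff hk4 hζ (hζ₈ rfl hk4)).1 h).1
      · have hk4 : 4 ≤ k := h.1.2
        exact ((mem_listD_iff hk4 hζ (hζ₈ rfl hk4)).1 h).1
  · rw [listC_eq_empty (by simp [hp2]), listD_eq_empty (by simp [hp2])]
    simp only [Set.mem_empty_iff_false, or_false]
    rw [mem_listA_iff hp hk hζ, mem_listB_iff hp hk (Or.inl hp2) hζ]
    constructor
    · intro hR
      rcases IsGrading.classification_odd hp hp2 hζ hR with h | ⟨g, hg, h⟩
      · exact Or.inl ⟨hR, h⟩
      · exact Or.inr ⟨hR, g, hg, Or.inl h⟩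
    · rintro (⟨h, -⟩ | ⟨h, -⟩) <;> exact h

/-- Gradings by `n`-th roots of unity are the gradings by roots of unity supported on them. -/
theorem ncard_gradings_mu (n : ℕ) (hn : n ≠ 0) :
    (gradings (mu n) E).ncard =
      {R ∈ gradings muInf E | ∀ g : muInf, R g ≠ ⊥ → g ^ n = 1}.ncard := by
  have hinj := Subgroup.inclusion_injective (mu_le_muInf n hn)
  have himg : {R ∈ gradings muInf E | ∀ g : muInf, R g ≠ ⊥ → g ^ n = 1} =
      (fun S : mu n → Submodule ℚ E => pushforward (Subgroup.inclusion (mu_le_muInf n hn)) S) ''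
        gradings (mu n) E := by
    ext R
    constructor
    · rintro ⟨hR, h⟩
      obtain ⟨h1, h2⟩ := IsGrading.restrict hR hinj fun g hg =>
        ⟨⟨g, (mem_rootsOfUnity n _).2 (congrArg Subtype.val (h g hg))⟩, rfl⟩
      exact ⟨_, h1, h2⟩
    · rintro ⟨S, hS, rfl⟩
      refine ⟨IsGrading.pushforward hS _, fun g hg => ?_⟩
      by_contra hne
      refine hg (pushforward_of_forall_ne fun s hs => hne ?_)
      rw [← hs, ← map_pow, show s ^ n = 1 from Subtype.ext ((mem_rootsOfUnity n _).1 s.2), map_one]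
  rw [himg, Set.ncard_image_of_injective]
  intro S T h
  funext s
  have := congrFun h (Subgroup.inclusion (mu_le_muInf n hn) s)
  simpa only [pushforward_apply_of_injective hinj] using this

end Totals

end CyclotomicGradings

namespace CyclotomicGradings

/-! ### Total counts -/

section Main

variable {E : Type*} [Field E] [Algebra ℚ E] {p k : ℕ} {ζ ζ₈ : E}
  [IsCyclotomicExtension {p ^ k} ℚ E]

theorem ncard_listC_eq_ite (hζ : IsPrimitiveRoot ζ (p ^ k))
    (hζ₈ : p = 2 → 4 ≤ k → IsPrimitiveRoot ζ₈ 8) :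
    (listC p k ζ ζ₈).ncard = if p = 2 ∧ 4 ≤ k then 2 ^ (k - 2) else 0 := by
  split_ifs with h
  · obtain ⟨rfl, hk4⟩ := h
    exact ncard_listC hk4 hζ (hζ₈ rfl hk4)
  · rw [listC_eq_empty h, Set.ncard_empty]

theorem ncard_listD_eq_ite (hζ : IsPrimitiveRoot ζ (p ^ k))
    (hζ₈ : p = 2 → 4 ≤ k → IsPrimitiveRoot ζ₈ 8) :
    (listD p k ζ ζ₈).ncard = if p = 2 ∧ 4 ≤ k then 2 else 0 := by
  split_ifs with h
  · obtain ⟨rfl, hk4⟩ := h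
    exact ncard_listD hk4 hζ (hζ₈ rfl hk4)
  · rw [listD_eq_empty h, Set.ncard_empty]

theorem pairwise_disjoint_lists (hp : p.Prime) (hk : 1 ≤ k) (hζ : IsPrimitiveRoot ζ (p ^ k))
    (hζ₈ : p = 2 → 4 ≤ k → IsPrimitiveRoot ζ₈ 8) :
    [listA p k ζ, listB p k ζ, listC p k ζ ζ₈, listD p k ζ ζ₈].Pairwise Disjoint := by
  have hAB := disjoint_listA_listB hp hk hζ
  by_cases h : p = 2 ∧ 4 ≤ k
  · obtain ⟨rfl, hk4⟩ := h
    have h8 := hζ₈ rfl hk4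
    simp [hAB, disjoint_listA_listC hk4 hζ h8, disjoint_listA_listD hk4 hζ h8,
      disjoint_listB_listC hk4 hζ h8, disjoint_listB_listD hk4 hζ h8,
      disjoint_listC_listD hk4 hζ h8]
  · simp [hAB, listC_eq_empty h, listD_eq_empty h]

/-- The number of gradings is the sum of the sizes of the four lists. -/
theorem ncard_gradings_muInf (hp : p.Prime) (hk : 1 ≤ k) (hζ : IsPrimitiveRoot ζ (p ^ k))
    (hζ₈ : p = 2 → 4 ≤ k → IsPrimitiveRoot ζ₈ 8) :
    (gradings muInf E).ncard = (listA p k ζ).ncard + (listB p k ζ).ncard +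
      (listC p k ζ ζ₈).ncard + (listD p k ζ ζ₈).ncard := by
  have hd := pairwise_disjoint_lists hp hk hζ hζ₈
  simp only [List.pairwise_cons, List.mem_cons, List.not_mem_nil, or_false, forall_eq_or_imp,
    forall_eq] at hd
  obtain ⟨⟨hAB, hAC, hAD⟩, ⟨hBC, hBD⟩, hCD, -⟩ := hd
  have fA : (listA p k ζ).Finite := Set.finite_of_ncard_ne_zero (by
    rw [ncard_listA hp hk hζ]; exact pow_ne_zero _ hp.ne_zero)
  have fB : (listB p k ζ).Finite := by
    by_cases h : p ≠ 2 ∨ 3 ≤ k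
    · refine Set.finite_of_ncard_ne_zero ?_
      rw [ncard_listB hp hk hζ]
      split_ifs <;> simp_all
    · rw [listB_eq_empty h]; exact Set.finite_empty
  have fC : (listC p k ζ ζ₈).Finite := by
    by_cases h : p = 2 ∧ 4 ≤ k
    · refine Set.finite_of_ncard_ne_zero ?_
      rw [ncard_listC_eq_ite hζ hζ₈, if_pos h]
      positivity
    · rw [listC_eq_empty h]; exact Set.finite_empty
  have fD : (listD p k ζ ζ₈).Finite := by
    by_cases h : p = 2 ∧ 4 ≤ k
    · refine Set.finite_of_ncard_ne_zero ?_
      rw [ncard_listD_eq_ite hζ hζ₈, if_pos h]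
      norm_num
    · rw [listD_eq_empty h]; exact Set.finite_empty
  rw [gradings_eq hp hk hζ hζ₈,
    Set.ncard_union_eq (Set.disjoint_union_left.2 ⟨Set.disjoint_union_left.2 ⟨hAD, hBD⟩, hCD⟩)
      ((fA.union fB).union fC) fD,
    Set.ncard_union_eq (Set.disjoint_union_left.2 ⟨hAC, hBC⟩) (fA.union fB) fC,
    Set.ncard_union_eq hAB fA fB]

theorem ncard_gradings_mu_odd (hp : p.Prime) (hp2 : p ≠ 2) (hk : 1 ≤ k)
    (hζ : IsPrimitiveRoot ζ (p ^ k)) : (gradings (mu (p ^ k)) E).ncard = p ^ (k - 1) := by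
  have hζ0 : ζ ≠ 0 := hζ.ne_zero (pow_ne_zero _ hp.ne_zero)
  have h4 := pow_four_ne_one hp hk (Or.inl hp2) hζ
  rw [ncard_gradings_mu _ (pow_ne_zero _ hp.ne_zero), ← ncard_listA hp hk hζ]
  congr 1
  ext R
  rw [Set.mem_sep_iff, gradings_eq (ζ₈ := ζ) hp hk hζ (fun h => absurd h hp2),
    listC_eq_empty (by simp [hp2]), listD_eq_empty (by simp [hp2]), Set.union_empty,
    Set.union_empty]
  constructor
  · rintro ⟨hA | hB, hs⟩
    · exact hA
    · exfalso
      obtain ⟨-, g, hg, h⟩ := (mem_listB_iff hp hk (Or.inl hp2) hζ).1 hB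
      have hne : R g ≠ ⊥ := by
        rcases h with ⟨-, h⟩ | ⟨h, -⟩
        · exact ne_bot_of_mem (sub_inv_ne_zero hζ0 h4) h
        · exact absurd h hp2
      -- A degree of order two is not killed by the odd number `p ^ k`.
      have h1 := hs g hne
      rw [← orderOf_dvd_iff_pow_eq_one, hg] at h1
      exact hp2 ((Nat.prime_dvd_prime_iff_eq Nat.prime_two hp).1
        (Nat.prime_two.dvd_of_dvd_pow h1)).symm
  · intro hA
    refine ⟨Or.inl hA, fun g hg => ?_⟩
    rw [← Nat.sub_add_cancel hk, pow_succ, pow_mul, support_listA hp hA hg, one_pow]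

/-- The supports in the four lists are killed by `2 ^ (k - 1)`, `2` or `4`, which divide `2 ^ k`
whenever the list is nonempty. -/
theorem ncard_gradings_mu_two {k : ℕ} [IsCyclotomicExtension {2 ^ k} ℚ E] (hk : 1 ≤ k)
    (hζ : IsPrimitiveRoot ζ (2 ^ k)) (hζ₈ : 4 ≤ k → IsPrimitiveRoot ζ₈ 8) :
    (gradings (mu (2 ^ k)) E).ncard = (gradings muInf E).ncard := by
  rw [ncard_gradings_mu _ (by positivity)]
  congr 1
  refine Set.sep_eq_self_iff_mem_true.2 fun R hR g hg => ?_
  rw [gradings_eq Nat.prime_two hk hζ (fun _ => hζ₈)] at hR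
  have key : ∀ j ≤ k, g ^ 2 ^ j = 1 → g ^ 2 ^ k = 1 := by
    intro j hj h
    rw [← Nat.add_sub_cancel' hj, pow_add, pow_mul, h, one_pow]
  rcases hR with ((h | h) | h) | h
  · exact key (k - 1) (by omega) (support_listA Nat.prime_two h hg)
  · refine key 1 hk ?_
    simpa using support_listB h hg
  · exact key (k - 1) (by omega) (support_listC h hg)
  · have hk4 : 4 ≤ k := h.1.2
    refine key 2 (by omega) ?_
    simpa using support_listD h hg

end Main

end CyclotomicGradings

theorem mainTheorem11 {E : Type*} [Field E] [Algebra ℚ E] (p k : ℕ) (hp : p.Prime) (hk : 1 ≤ k)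
    [IsCyclotomicExtension {p ^ k} ℚ E] (ζ : E) (hζ : IsPrimitiveRoot ζ (p ^ k))
    (ζ₈ : E) (hζ₈ : p = 2 → 4 ≤ k → IsPrimitiveRoot ζ₈ 8) :
    -- the `μ_∞`-gradings are exactly the listed ones
    CyclotomicGradings.gradings CyclotomicGradings.muInf E =
        CyclotomicGradings.listA p k ζ ∪ CyclotomicGradings.listB p k ζ ∪
          CyclotomicGradings.listC p k ζ ζ₈ ∪ CyclotomicGradings.listD p k ζ ζ₈ ∧
    -- sizes of the four parts of the list, which are pairwise disjoint
    (CyclotomicGradings.listA p k ζ).ncard = p ^ (k - 1) ∧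
    (CyclotomicGradings.listB p k ζ).ncard = (if p ≠ 2 then 1 else if 3 ≤ k then 2 else 0) ∧
    (CyclotomicGradings.listC p k ζ ζ₈).ncard = (if p = 2 ∧ 4 ≤ k then 2 ^ (k - 2) else 0) ∧
    (CyclotomicGradings.listD p k ζ ζ₈).ncard = (if p = 2 ∧ 4 ≤ k then 2 else 0) ∧
    [CyclotomicGradings.listA p k ζ, CyclotomicGradings.listB p k ζ,
      CyclotomicGradings.listC p k ζ ζ₈, CyclotomicGradings.listD p k ζ ζ₈].Pairwise Disjoint ∧
    -- total numbers of gradings for odd `p`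
    (p ≠ 2 →
      (CyclotomicGradings.gradings (CyclotomicGradings.mu (p ^ k)) E).ncard = p ^ (k - 1) ∧
      (CyclotomicGradings.gradings CyclotomicGradings.muInf E).ncard = p ^ (k - 1) + 1) ∧
    -- total numbers of gradings for `p = 2`
    (p = 2 →
      (CyclotomicGradings.gradings (CyclotomicGradings.mu (2 ^ k)) E).ncard =
        (CyclotomicGradings.gradings CyclotomicGradings.muInf E).ncard ∧
      (k = 1 → (CyclotomicGradings.gradings CyclotomicGradings.muInf E).ncard = 1) ∧
      (k = 2 → (CyclotomicGradings.gradings CyclotomicGradings.muInf E).ncard = 2) ∧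
      (k = 3 → (CyclotomicGradings.gradings CyclotomicGradings.muInf E).ncard = 6) ∧
      (4 ≤ k → (CyclotomicGradings.gradings CyclotomicGradings.muInf E).ncard =
        4 + 2 ^ (k - 2) + 2 ^ (k - 1))) := by

  refine ⟨CyclotomicGradings.gradings_eq hp hk hζ hζ₈, CyclotomicGradings.ncard_listA hp hk hζ,
    CyclotomicGradings.ncard_listB hp hk hζ, CyclotomicGradings.ncard_listC_eq_ite hζ hζ₈,
    CyclotomicGradings.ncard_listD_eq_ite hζ hζ₈,
    CyclotomicGradings.pairwise_disjoint_lists hp hk hζ hζ₈, fun hp2 => ?_, ?_⟩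
  · refine ⟨CyclotomicGradings.ncard_gradings_mu_odd hp hp2 hk hζ, ?_⟩
    rw [CyclotomicGradings.ncard_gradings_muInf hp hk hζ hζ₈,
      CyclotomicGradings.ncard_listA hp hk hζ, CyclotomicGradings.ncard_listB hp hk hζ,
      CyclotomicGradings.ncard_listC_eq_ite hζ hζ₈, CyclotomicGradings.ncard_listD_eq_ite hζ hζ₈]
    simp [hp2]
  · rintro rfl
    rw [CyclotomicGradings.ncard_gradings_mu_two hk hζ (hζ₈ rfl),
      CyclotomicGradings.ncard_gradings_muInf hp hk hζ hζ₈,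
      CyclotomicGradings.ncard_listA hp hk hζ, CyclotomicGradings.ncard_listB hp hk hζ,
      CyclotomicGradings.ncard_listC_eq_ite hζ hζ₈, CyclotomicGradings.ncard_listD_eq_ite hζ hζ₈]
    refine ⟨rfl, ?_, ?_, ?_, fun hk4 => ?_⟩
    · rintro rfl; norm_num
    · rintro rfl; norm_num
    · rintro rfl; norm_num
    · have hk3 : 3 ≤ k := by omega
      simp only [hk3, hk4, ne_eq, not_true_eq_false, if_false, if_true, and_self]
      ring
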